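/- **Setting.** Let $G$ be a connected real Lie group with Lie algebra $\mathfrak g$ (left-invariant vector fields), and let $D\subset\mathfrak g$ be a bracket-generating subspace: with $V^0=0$, $V^1=D$, $V^{i+1}=V^i+[D,V^i]$ one has $V^m=\mathfrak g$ for some $m$. Let $$\mathfrak n(\mathfrak g,D)=\bigoplus_{i\ge 1}V^i/V^{i-1},\qquad [x+V^{i-1},\,y+V^{j-1}]_n=[x,y]+V^{i+j-1}\quad(x\in V^i,\ y\in V^j),$$ and let the nilpotentisation $N(G,D)$ be the simply connected Lie group with Lie algebra $\mathfrak n(\mathfrak g,D)$, identified with $\mathfrak n(\mathfrak g,D)$ by its exponential map, so that its product is given by the (finite) Baker–Campbell–Hausdorff formula. Fix a direct sum decomposition $\mathfrak g=\bigoplus_{i\ge1} W_i$ with $V^i=\bigoplus_{j\le i}W_j$ for all $i$, put $\delta_\varepsilon(\sum x_i)=\sum\varepsilon^i x_i$ ($x_i\in W_i$, $\varepsilon>0$), and identify $\mathfrak g$ with $\mathfrak n(\mathfrak g,D)$ by $\theta(\sum x_i)=\sum (x_i+V^{i-1})$; write $X\cdot_n Y=\theta^{-1}(\theta X\cdot\theta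 Y)$ for the product of $N(G,D)$ transported to $\mathfrak g$. Let $\log G$ be the local group $\mathfrak g$, near $0$, with $X\cdot_{\mathfrak g}Y=\log_G(\exp_G X\,\exp_G Y)$, with the uniformity of the vector space and the dilatations $\delta_\varepsilon$; give $G$ the uniformity of its left-invariant Riemannian distances and the dilatations $\tilde\delta_\varepsilon(\exp_G X)=\exp_G(\delta_\varepsilon X)$ near the neutral element $e$. A local group (with uniformly continuous operations near its neutral element $e$) with a local action $\delta$ of $(0,\infty)$ is said to satisfy H0, H1, H2 if, uniformly near $e$ as $\varepsilon\to0$: $\delta_\varepsilon x\to e$; $\ \delta_\varepsilon^{-1}((\delta_\varepsilon x)(\delta_\varepsilon y))$ converges, to a limit called $\beta(x,y)$; and $\delta_\varepsilon^{-1}((\delta_\varepsilon x)^{-1})\to x^{-1}$. Its virtual tangent space $VT_e$ at $e$ is then the local group with the operation $\beta$; equivalently, it is formed by the infinitesimal left translations $L_x:y\mapsto\beta(x,y)$ under composition. **Theorem.** For every such decomposition: 1. $\log G$ with $\delta_\varepsilon$, and $G$ with $\tilde\delta_\varepsilon$, are local groups with local actions of $(0,\infty)$ that satisfy H0, H1,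 H2, and $VT_0\log G$ and $VT_eG$ are local groups. 2. $N(G,D)=VT_0\log G$ as local groups: for all $X,Y\in\mathfrak g$ the limit $$\beta(X,Y)=\lim_{\varepsilon\to0}\delta_\varepsilon^{-1}\bigl(\delta_\varepsilon X\cdot_{\mathfrak g}\delta_\varepsilon Y\bigr)$$ exists and equals $X\cdot_nY$, and $\theta$ is an isomorphism of local uniform groups from $VT_0\log G$ to $N(G,D)$. In terms of translations, $X\mapsto L_X$ is injective on $\mathfrak g$ and $L_X\circ L_Y=L_{X\cdot_nY}$ for all $X,Y\in\mathfrak g$. 3. $VT_eG$ is isomorphic to $N(G,D)$: the map $\theta\circ\log_G$ is an isomorphism of local uniform groups from $VT_eG$ to $N(G,D)$. -/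

import Mathlib

open Filter Topology Set
open scoped Manifold ContDiff DirectSum

noncomputable section

section Algebra

variable {L : Type*} [LieRing L] [LieAlgebra ℝ L]

/-- The filtration `V⁰ = 0`, `V¹ = D`, `Vⁱ⁺¹ = Vⁱ + [D, Vⁱ]` of a Lie algebra. -/
def lieFiltration (D : Submodule ℝ L) : ℕ → Submodule ℝ L
  | 0 => ⊥
  | 1 => D
  | i + 2 => lieFiltration D (i + 1) ⊔
      Submodule.span ℝ {z | ∃ d ∈ D, ∃ v ∈ lieFiltration D (i + 1), ⁅d, v⁆ = z}

/-- `D` generates the Lie algebra: the filtration reaches the whole algebra. -/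
def BracketGenerating (D : Submodule ℝ L) : Prop :=
  ∃ m : ℕ, lieFiltration D m = ⊤

theorem lieFiltration_le_succ (D : Submodule ℝ L) (i : ℕ) :
    lieFiltration D i ≤ lieFiltration D (i + 1) := by
  cases i with
  | zero => exact bot_le
  | succ i => exact le_sup_left

theorem lieFiltration_mono (D : Submodule ℝ L) : Monotone (lieFiltration D) :=
  monotone_nat_of_le_succ (lieFiltration_le_succ D)

theorem lie_mem_lieFiltration_succ (D : Submodule ℝ L) {d y : L} (hd : d ∈ D) (j : ℕ)
    (hy : y ∈ lieFiltration D j) : ⁅d, y⁆ ∈ lieFiltration D (j + 1) := by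
  cases j with
  | zero =>
    have : y = 0 := hy
    rw [this, lie_zero]; exact zero_mem _
  | succ j => exact Submodule.mem_sup_right (Submodule.subset_span ⟨d, hd, y, hy, rfl⟩)

theorem lie_mem_lieFiltration (D : Submodule ℝ L) (i : ℕ) :
    ∀ (j : ℕ) {x y : L}, x ∈ lieFiltration D i → y ∈ lieFiltration D j →
      ⁅x, y⁆ ∈ lieFiltration D (i + j) := by
  induction i with
  | zero =>
    intro j x y hx _
    have : x = 0 := hx
    rw [this, zero_lie]; exact zero_mem _
  | succ i ih =>
    intro j x y hx hy
    cases i with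
    | zero => rw [Nat.zero_add, Nat.add_comm]; exact lie_mem_lieFiltration_succ D hx j hy
    | succ i =>
      obtain ⟨a, ha, b, hb, rfl⟩ := Submodule.mem_sup.1 hx
      rw [add_lie]
      refine add_mem (lieFiltration_mono D (by omega) (ih j ha hy)) ?_
      clear hx
      induction hb using Submodule.span_induction with
      | mem z hz =>
        obtain ⟨d, hd, v, hv, rfl⟩ := hz
        rw [lie_lie]
        refine sub_mem ?_ ?_
        · exact lieFiltration_mono D (by omega)
            (lie_mem_lieFiltration_succ D hd _ (ih j hv hy))
        · exact lieFiltration_mono D (by omega)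
            (ih (j + 1) hv (lie_mem_lieFiltration_succ D hd _ hy))
      | zero => rw [zero_lie]; exact zero_mem _
      | add u v _ _ hu hv => rw [add_lie]; exact add_mem hu hv
      | smul c u _ hu => rw [smul_lie]; exact Submodule.smul_mem _ c hu

/-- `Vⁱ⁻¹` as a subspace of `Vⁱ` (with `V⁰⁻¹ = V⁰ = 0` for `i = 0`). -/
abbrev prevStep (D : Submodule ℝ L) (i : ℕ) : Submodule ℝ (lieFiltration D i) :=
  (lieFiltration D (i - 1)).submoduleOf (lieFiltration D i)

/-- The homogeneous piece `V_i = Vⁱ / Vⁱ⁻¹` (zero for `i = 0`). -/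
def GradedPiece (D : Submodule ℝ L) (i : ℕ) : Type _ := lieFiltration D i ⧸ prevStep D i

namespace GradedPiece

variable (D : Submodule ℝ L) (i : ℕ)

instance : AddCommGroup (GradedPiece D i) :=
  inferInstanceAs (AddCommGroup (lieFiltration D i ⧸ prevStep D i))

instance : Module ℝ (GradedPiece D i) :=
  inferInstanceAs (Module ℝ (lieFiltration D i ⧸ prevStep D i))

/-- The projection `Vⁱ → Vⁱ / Vⁱ⁻¹`. -/
def mk : lieFiltration D i →ₗ[ℝ] GradedPiece D i := (prevStep D i).mkQ

variable {D i}

theorem mk_surjective : Function.Surjective (mk D i) := Submodule.mkQ_surjective (prevStep D i)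

theorem mk_eq_zero_iff (x : lieFiltration D i) :
    mk D i x = 0 ↔ (x : L) ∈ lieFiltration D (i - 1) :=
  Submodule.Quotient.mk_eq_zero (prevStep D i)

/-- A linear map that vanishes on `Vⁱ⁻¹` factors through `Vⁱ / Vⁱ⁻¹`. -/
def lift {M : Type*} [AddCommGroup M] [Module ℝ M] (f : lieFiltration D i →ₗ[ℝ] M)
    (hf : ∀ x : lieFiltration D i, (x : L) ∈ lieFiltration D (i - 1) → f x = 0) :
    GradedPiece D i →ₗ[ℝ] M :=
  (prevStep D i).liftQ f hf

end GradedPiece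

/-- The vector space `𝔫(𝔤, D) = ⨁ᵢ Vⁱ / Vⁱ⁻¹`. -/
abbrev NilAlgebra (D : Submodule ℝ L) : Type _ := ⨁ i : ℕ, GradedPiece D i

namespace NilAlgebra

variable (D : Submodule ℝ L)

/-- The class in `Vⁱ / Vⁱ⁻¹ ⊆ 𝔫(𝔤, D)` of an element of `Vⁱ`. -/
def cls (i : ℕ) : lieFiltration D i →ₗ[ℝ] NilAlgebra D :=
  (DirectSum.lof ℝ ℕ (GradedPiece D) i).comp (GradedPiece.mk D i)

variable {D} in
theorem cls_congr {i j : ℕ} (h : i = j) {x y : L} (hxy : x = y) (hx : x ∈ lieFiltration D i)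
    (hy : y ∈ lieFiltration D j) : cls D i ⟨x, hx⟩ = cls D j ⟨y, hy⟩ := by
  subst h; subst hxy; rfl

variable {D} in
theorem cls_eq_zero {i : ℕ} {x : L} (hx : x ∈ lieFiltration D i)
    (h : x ∈ lieFiltration D (i - 1)) : cls D i ⟨x, hx⟩ = 0 := by
  rw [cls, LinearMap.comp_apply, (GradedPiece.mk_eq_zero_iff _).2 h, map_zero]

/-- The bilinear map `Vⁱ × Vʲ → 𝔫(𝔤, D)`, `(x, y) ↦ [x, y] + Vⁱ⁺ʲ⁻¹`. -/
def preBracket (i j : ℕ) :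
    lieFiltration D i →ₗ[ℝ] lieFiltration D j →ₗ[ℝ] NilAlgebra D :=
  LinearMap.mk₂ ℝ
    (fun x y => cls D (i + j) ⟨⁅(x : L), (y : L)⁆, lie_mem_lieFiltration D i j x.2 y.2⟩)
    (fun x x' y => by
      rw [← map_add]; congr 1; ext; simp)
    (fun c x y => by
      rw [← map_smul]; congr 1; ext; simp)
    (fun x y y' => by
      rw [← map_add]; congr 1; ext; simp)
    (fun c x y => by
      rw [← map_smul]; congr 1; ext; simp)

theorem preBracket_eq_zero_left {i j : ℕ} (x : lieFiltration D i)
    (hx : (x : L) ∈ lieFiltration D (i - 1)) : preBracket D i j x = 0 := by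
  ext1 y
  refine cls_eq_zero _ ?_
  rcases Nat.eq_zero_or_pos i with rfl | hi
  · have : (x : L) = 0 := hx
    rw [this, zero_lie]; exact zero_mem _
  · exact lieFiltration_mono D (by omega) (lie_mem_lieFiltration D (i - 1) j hx y.2)

theorem preBracket_eq_zero_right {i j : ℕ} (y : lieFiltration D j)
    (hy : (y : L) ∈ lieFiltration D (j - 1)) : (preBracket D i j).flip y = 0 := by
  ext1 x
  refine cls_eq_zero _ ?_
  rcases Nat.eq_zero_or_pos j with rfl | hj
  · have : (y : L) = 0 := hy
    rw [this, lie_zero]; exact zero_mem _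
  · exact lieFiltration_mono D (by omega) (lie_mem_lieFiltration D i (j - 1) x.2 hy)

/-- The bracket with an element of `Vⁱ`, on `Vʲ/Vʲ⁻¹`. -/
def halfBracket (i j : ℕ) : lieFiltration D i →ₗ[ℝ] GradedPiece D j →ₗ[ℝ] NilAlgebra D :=
  LinearMap.flip (GradedPiece.lift (preBracket D i j).flip (preBracket_eq_zero_right D))

/-- The bracket `Vⁱ/Vⁱ⁻¹ × Vʲ/Vʲ⁻¹ → Vⁱ⁺ʲ/Vⁱ⁺ʲ⁻¹` induced on the homogeneous pieces. -/
def pieceBracket (i j : ℕ) : GradedPiece D i →ₗ[ℝ] GradedPiece D j →ₗ[ℝ] NilAlgebra D :=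
  GradedPiece.lift (halfBracket D i j) fun x hx => by
    refine LinearMap.ext fun q => ?_
    obtain ⟨y, rfl⟩ := GradedPiece.mk_surjective q
    exact LinearMap.congr_fun (preBracket_eq_zero_left D (j := j) x hx) y

/-- The bracket `[·,·]ₙ` of `𝔫(𝔤, D)`, as a bilinear map. -/
def bracketMap : NilAlgebra D →ₗ[ℝ] NilAlgebra D →ₗ[ℝ] NilAlgebra D :=
  DirectSum.toModule ℝ ℕ (NilAlgebra D →ₗ[ℝ] NilAlgebra D) fun i =>
    LinearMap.flip (DirectSum.toModule ℝ ℕ (GradedPiece D i →ₗ[ℝ] NilAlgebra D) fun j =>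
      LinearMap.flip (pieceBracket D i j))

instance : Bracket (NilAlgebra D) (NilAlgebra D) := ⟨fun x y => bracketMap D x y⟩

variable {D}

/-- `[x̂, ŷ]ₙ` is the class of `[x, y]`. -/
theorem cls_lie_cls {i j : ℕ} {x y : L} (hx : x ∈ lieFiltration D i) (hy : y ∈ lieFiltration D j) :
    ⁅cls D i ⟨x, hx⟩, cls D j ⟨y, hy⟩⁆ =
      cls D (i + j) ⟨⁅x, y⁆, lie_mem_lieFiltration D i j hx hy⟩ := by
  change bracketMap D (cls D i ⟨x, hx⟩) (cls D j ⟨y, hy⟩) = _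
  unfold bracketMap cls
  rw [LinearMap.comp_apply, LinearMap.comp_apply]
  rw [DirectSum.toModule_lof, LinearMap.flip_apply, DirectSum.toModule_lof]
  rfl

theorem induction_cls {p : NilAlgebra D → Prop} (h0 : p 0)
    (hc : ∀ (i : ℕ) (x : L) (hx : x ∈ lieFiltration D i), p (cls D i ⟨x, hx⟩))
    (ha : ∀ x y, p x → p y → p (x + y)) (x : NilAlgebra D) : p x := by
  refine DirectSum.induction_on (β := GradedPiece D) (motive := p) x h0 ?_ ha
  intro i q
  obtain ⟨v, rfl⟩ := GradedPiece.mk_surjective q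
  exact hc i v.1 v.2

theorem lie_add_left (x y z : NilAlgebra D) : ⁅x + y, z⁆ = ⁅x, z⁆ + ⁅y, z⁆ := by
  change bracketMap D (x + y) z = bracketMap D x z + bracketMap D y z
  rw [map_add, LinearMap.add_apply]

theorem lie_add_right (x y z : NilAlgebra D) : ⁅x, y + z⁆ = ⁅x, y⁆ + ⁅x, z⁆ :=
  map_add (bracketMap D x) y z

theorem lie_zero_left (x : NilAlgebra D) : ⁅(0 : NilAlgebra D), x⁆ = 0 := by
  change bracketMap D 0 x = 0
  rw [map_zero, LinearMap.zero_apply]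

theorem lie_zero_right (x : NilAlgebra D) : ⁅x, (0 : NilAlgebra D)⁆ = 0 :=
  map_zero (bracketMap D x)

theorem lie_add_lie_swap (x y : NilAlgebra D) : ⁅x, y⁆ + ⁅y, x⁆ = 0 := by
  induction x using induction_cls with
  | h0 => rw [lie_zero_left, lie_zero_right, add_zero]
  | hc i x hx =>
    induction y using induction_cls with
    | h0 => rw [lie_zero_left, lie_zero_right, add_zero]
    | hc j y hy =>
      rw [cls_lie_cls, cls_lie_cls, cls_congr (add_comm j i) (lie_skew y x).symm _
        (neg_mem (lie_mem_lieFiltration D i j hx hy)), ← map_add]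
      convert map_zero (cls D (i + j))
      exact Subtype.ext (add_neg_cancel _)
    | ha a b ha hb => rw [lie_add_left, lie_add_right, add_add_add_comm, ha, hb, add_zero]
  | ha a b ha hb => rw [lie_add_left, lie_add_right, add_add_add_comm, ha, hb, add_zero]

/-- `𝔫(𝔤, D)` is a Lie algebra. -/
instance : LieRing (NilAlgebra D) where
  add_lie := lie_add_left
  lie_add := lie_add_right
  lie_self x := by
    induction x using induction_cls with
    | h0 => rw [lie_zero_left]
    | hc i x hx =>
      rw [cls_lie_cls]
      convert map_zero (cls D (i + i))
      simp
    | ha a b ha hb => rw [lie_add_left, lie_add_right, lie_add_right, ha, hb, zero_add, add_zero, lie_add_lie_swap]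
  leibniz_lie x y z := by
    induction x using induction_cls with
    | h0 => simp only [lie_zero_left, lie_zero_right, add_zero]
    | hc i x hx =>
      induction y using induction_cls with
      | h0 => simp only [lie_zero_left, lie_zero_right, add_zero]
      | hc j y hy =>
        induction z using induction_cls with
        | h0 => simp only [lie_zero_right, add_zero]
        | hc k z hz =>
          simp only [cls_lie_cls]
          have h1 := lie_mem_lieFiltration D j (i + k) hy (lie_mem_lieFiltration D i k hx hz)
          have h2 := lie_mem_lieFiltration D (i + j) k (lie_mem_lieFiltration D i j hx hy) hz
          have e1 : j + (i + k) = i + (j + k) := by omega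
          have e2 : i + j + k = i + (j + k) := by omega
          rw [cls_congr e1 rfl h1 (e1 ▸ h1), cls_congr e2 rfl h2 (e2 ▸ h2), ← map_add]
          congr 1
          ext
          exact leibniz_lie x y z
        | ha a b ha hb => simp only [lie_add_right, ha, hb]; abel
      | ha a b ha hb => simp only [lie_add_left, lie_add_right, ha, hb]; abel
    | ha a b ha hb => simp only [lie_add_left, lie_add_right, ha, hb]; abel

instance : LieAlgebra ℝ (NilAlgebra D) where
  lie_smul c x y := map_smul (bracketMap D x) c y

end NilAlgebra

/-! ### The Baker-Campbell-Hausdorff product -/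

/-- The right-nested bracket `[a₁, [a₂, [ … , a_s] … ]]` of a word `a₁ a₂ … a_s`. -/
def nestedBracket : List L → L
  | [] => 0
  | [a] => a
  | a :: b :: l => ⁅a, nestedBracket (b :: l)⁆

/-- The term of Dynkin's form of the Baker-Campbell-Hausdorff formula attached to the exponents
`(r₁, s₁), …, (r_k, s_k)`. -/
def bchTerm (x y : L) (l : List (ℕ × ℕ)) : L :=
  ((-1 : ℝ) ^ (l.length - 1) /
      (l.length * (l.map fun p => p.1 + p.2).sum *
        (l.map fun p => p.1.factorial * p.2.factorial).prod : ℕ)) •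
    nestedBracket (l.flatMap fun p => List.replicate p.1 x ++ List.replicate p.2 y)

/-- The Baker-Campbell-Hausdorff product. In a nilpotent Lie algebra, the only case
in which it is used, only finitely many terms of the sum are non-zero. -/
def bchMul (x y : L) : L :=
  ∑ᶠ l ∈ {l : List (ℕ × ℕ) | l ≠ [] ∧ (0, 0) ∉ l}, bchTerm x y l

/-! ### Graded complements and dilatations -/

/-- A direct sum decomposition `𝔤 = ⨁ Wᵢ` with `Vⁱ = ⨁_{j ≤ i} Wⱼ` (so `W₀ = 0`). -/
structure Strata (D : Submodule ℝ L) where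
  W : ℕ → Submodule ℝ L
  internal : DirectSum.IsInternal W
  filtration_eq : ∀ i, lieFiltration D i = ⨆ j, ⨆ _ : j ≤ i, W j

namespace Strata

variable {D : Submodule ℝ L} (S : Strata D)

/-- The decomposition `x = ∑ xᵢ`, `xᵢ ∈ Wᵢ`, as a linear isomorphism. -/
def decomp : L ≃ₗ[ℝ] ⨁ i, S.W i :=
  (LinearEquiv.ofBijective (DirectSum.coeLinearMap S.W) S.internal).symm

/-- The dilatation `δ_ε x = ∑ εⁱ xᵢ`. -/
def dil (ε : ℝ) : L →ₗ[ℝ] L :=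
  (DirectSum.toModule ℝ ℕ L fun i => ε ^ i • (S.W i).subtype).comp S.decomp.toLinearMap

theorem le_filtration (i : ℕ) : S.W i ≤ lieFiltration D i := by
  rw [S.filtration_eq i]
  exact le_iSup₂_of_le i le_rfl le_rfl

/-- The natural map `Wᵢ → Vⁱ / Vⁱ⁻¹`. -/
def pieceMap (i : ℕ) : S.W i →ₗ[ℝ] GradedPiece D i :=
  (GradedPiece.mk D i).comp (Submodule.inclusion (S.le_filtration i))

theorem pieceMap_bijective (i : ℕ) : Function.Bijective (S.pieceMap i) := by
  constructor
  · rw [← LinearMap.ker_eq_bot, LinearMap.ker_eq_bot']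
    intro x hx
    have h : (x : L) ∈ lieFiltration D (i - 1) :=
      (GradedPiece.mk_eq_zero_iff _).1 hx
    ext
    rcases Nat.eq_zero_or_pos i with rfl | hi
    · exact h
    · have hd := S.internal.submodule_iSupIndep i
      refine (Submodule.disjoint_def.1 hd) x x.2 ?_
      rw [S.filtration_eq] at h
      refine (iSup₂_le fun j hj => ?_ : (⨆ j, ⨆ _ : j ≤ i - 1, S.W j) ≤ _) h
      exact le_iSup₂_of_le j (by omega) le_rfl
  · intro q
    obtain ⟨v, rfl⟩ := GradedPiece.mk_surjective q
    rcases Nat.eq_zero_or_pos i with rfl | hi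
    · refine ⟨0, ?_⟩
      rw [map_zero]
      exact ((GradedPiece.mk_eq_zero_iff v).2 v.2).symm
    · have hle : lieFiltration D i ≤ lieFiltration D (i - 1) ⊔ S.W i := by
        rw [S.filtration_eq i, S.filtration_eq (i - 1)]
        refine iSup₂_le fun j hj => ?_
        rcases Nat.lt_or_ge j i with h | h
        · exact le_sup_of_le_left (le_iSup₂_of_le j (by omega) le_rfl)
        · obtain rfl : j = i := by omega
          exact le_sup_right
      obtain ⟨a, ha, w, hw, hv⟩ := Submodule.mem_sup.1 (hle v.2)
      refine ⟨⟨w, hw⟩, ?_⟩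
      rw [← sub_eq_zero, pieceMap, LinearMap.comp_apply, ← map_sub, GradedPiece.mk_eq_zero_iff]
      change w - (v : L) ∈ lieFiltration D (i - 1)
      rw [← hv, sub_add_cancel_right]
      exact neg_mem ha

/-- The identification of `𝔤` with `𝔫(𝔤, D)`: `x = ∑ xᵢ` corresponds to `∑ (xᵢ + Vⁱ⁻¹)`. -/
def ident : L ≃ₗ[ℝ] NilAlgebra D :=
  S.decomp.trans (DFinsupp.mapRange.linearEquiv fun i =>
    LinearEquiv.ofBijective (S.pieceMap i) (S.pieceMap_bijective i))

end Strata

end Algebra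
/-! ### Local groups, dilatations and the virtual tangent space -/

/-- The data of a local group: a uniform space with a neutral element, a product and an inverse.
Only the germs of the operations at the neutral element matter. -/
structure LocalGroupData (X : Type*) where
  unif : UniformSpace X
  one : X
  mul : X → X → X
  inv : X → X

namespace LocalGroupData

variable {X Y : Type*} (P : LocalGroupData X) (Q : LocalGroupData Y)

/-- The axioms of a uniform group hold near the neutral element. With the product uniformity on
`X × X`, uniform continuity of the operation and of `x ↦ (x, x⁻¹)` is uniform continuity of the
product and of the inverse. -/
def IsLocalGroup : Prop :=
  letI := P.unif
  ∃ U ∈ 𝓝 P.one,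
    (∀ x ∈ U, ∀ y ∈ U, ∀ z ∈ U, P.mul (P.mul x y) z = P.mul x (P.mul y z)) ∧
    (∀ x ∈ U, P.mul P.one x = x ∧ P.mul x P.one = x) ∧
    (∀ x ∈ U, P.mul (P.inv x) x = P.one ∧ P.mul x (P.inv x) = P.one) ∧
    UniformContinuousOn (fun p : X × X => P.mul p.1 p.2) (U ×ˢ U) ∧
    UniformContinuousOn P.inv U

/-- `δ` is a local action of the multiplicative group `(0, ∞)` on the pointed space `(X, 1)`. -/
def IsLocalAction (δ : ℝ → X → X) : Prop :=
  letI := P.unif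
  (∃ T ∈ 𝓝 (1 : ℝ), ∃ U ∈ 𝓝 P.one,
    UniformContinuousOn (fun p : ℝ × X => δ p.1 p.2) (T ×ˢ U)) ∧
  (∀ ε > 0, Tendsto (δ ε) (𝓝 P.one) (𝓝 P.one)) ∧
  (∀ ε > 0, ∀ η > 0, ∀ᶠ x in 𝓝 P.one, δ (ε * η⁻¹) x = δ ε (δ η⁻¹ x))

/-- `β(x, y) = lim_{ε → 0} δ_ε⁻¹ ((δ_ε x) (δ_ε y))`, where `δ_ε⁻¹ = δ_{1/ε}`. -/
def virtualMul (δ : ℝ → X → X) (x y : X) : X :=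
  letI := P.unif
  haveI : Nonempty X := ⟨P.one⟩
  limUnder (𝓝[>] (0 : ℝ)) fun ε => δ ε⁻¹ (P.mul (δ ε x) (δ ε y))

/-- The hypotheses under which the virtual tangent space is defined: a local group with a local
action of `(0, ∞)` that satisfies (H0), (H1), (H2), all limits being uniform near the neutral
element. -/
structure HasVirtualTangent (δ : ℝ → X → X) : Prop where
  isLocalGroup : P.IsLocalGroup
  isLocalAction : P.IsLocalAction δ
  h0 : letI := P.unif
    ∃ U ∈ 𝓝 P.one, TendstoUniformlyOn δ (fun _ => P.one) (𝓝[>] (0 : ℝ)) U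
  h1 : letI := P.unif
    ∃ U ∈ 𝓝 P.one, TendstoUniformlyOn
      (fun (ε : ℝ) (p : X × X) => δ ε⁻¹ (P.mul (δ ε p.1) (δ ε p.2)))
      (fun p => P.virtualMul δ p.1 p.2) (𝓝[>] (0 : ℝ)) (U ×ˢ U)
  h2 : letI := P.unif
    ∃ U ∈ 𝓝 P.one, TendstoUniformlyOn
      (fun (ε : ℝ) (x : X) => δ ε⁻¹ (P.inv (δ ε x))) P.inv (𝓝[>] (0 : ℝ)) U

/-- The virtual tangent space at the neutral element, as the local group `(X, β)`: a point `x`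
stands for the infinitesimal left translation `y ↦ β(x, y)`. -/
def virtualTangent (δ : ℝ → X → X) : LocalGroupData X where
  unif := P.unif
  one := P.one
  mul := P.virtualMul δ
  inv := P.inv

/-- The infinitesimal left translation `L_x : y ↦ β(x, y)`. -/
def virtualTranslation (δ : ℝ → X → X) (x : X) : X → X :=
  fun y => P.virtualMul δ x y

/-- `f` is an isomorphism of local uniform groups, from a neighbourhood of the neutral element
of `P` to a neighbourhood of the neutral element of `Q`. -/
def IsLocalIso (f : X → Y) : Prop :=
  letI := P.unif
  letI := Q.unif
  f P.one = Q.one ∧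
  (∀ᶠ p in 𝓝 (P.one, P.one), f (P.mul p.1 p.2) = Q.mul (f p.1) (f p.2)) ∧
  ∃ U ∈ 𝓝 P.one, ∃ V ∈ 𝓝 Q.one, ∃ g : Y → X,
    MapsTo f U V ∧ MapsTo g V U ∧ InvOn g f U V ∧
    UniformContinuousOn f U ∧ UniformContinuousOn g V

end LocalGroupData

/-! ### The nilpotentisation as a group -/

section Nilpotentisation

variable {L : Type*} [LieRing L] [LieAlgebra ℝ L]

/-- `N(G, D)`: the simply connected Lie group with Lie algebra `𝔫(𝔤, D)`, identified with
`𝔫(𝔤, D)` by its exponential map, so that the group operation is given by the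
Baker-Campbell-Hausdorff formula. It carries the vector space topology and uniformity. -/
def nilpotentisation (D : Submodule ℝ L) : LocalGroupData (NilAlgebra D) where
  unif :=
    letI : TopologicalSpace (NilAlgebra D) := moduleTopology ℝ (NilAlgebra D)
    haveI : IsModuleTopology ℝ (NilAlgebra D) := ⟨rfl⟩
    haveI : IsTopologicalAddGroup (NilAlgebra D) := IsModuleTopology.topologicalAddGroup ℝ _
    IsTopologicalAddGroup.leftUniformSpace (NilAlgebra D)
  one := 0
  mul := bchMul
  inv := fun x => -x

end Nilpotentisation

/-! ### Lie groups -/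

section LieGroup

variable {E : Type*} [NormedAddCommGroup E] [NormedSpace ℝ E] [FiniteDimensional ℝ E]
  {G : Type*} [TopologicalSpace G] [ChartedSpace E G] [Group G]

instance completeSpace_of_finiteDimensional_real : CompleteSpace E :=
  FiniteDimensional.complete ℝ E

instance leInfty_minSmoothness_three : ENat.LEInfty (minSmoothness ℝ 3) :=
  ⟨by rw [minSmoothness_of_isRCLikeNormedField]; exact ENat.LEInfty.out⟩

variable (E G) in
/-- The Lie algebra of `G`. -/
abbrev LieAlg : Type _ := GroupLieAlgebra 𝓘(ℝ, E) G

variable [LieGroup 𝓘(ℝ, E) ∞ G]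

/-- Left-invariant vector fields are complete. -/
theorem exists_isMIntegralCurve_mulInvariantVectorField (X : LieAlg E G) :
    ∃ γ : ℝ → G, γ 0 = 1 ∧ IsMIntegralCurve (I := 𝓘(ℝ, E)) γ (mulInvariantVectorField X) := by
  have : IsTopologicalGroup G := topologicalGroup_of_lieGroup 𝓘(ℝ, E) ∞
  have : T1Space G := ChartedSpace.t1Space E G
  have : IsManifold 𝓘(ℝ, E) 1 G := IsManifold.of_le (n := ∞) (by exact_mod_cast le_top)
  have hv : ContMDiff 𝓘(ℝ, E) (𝓘(ℝ, E).prod 𝓘(ℝ, E)) 1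
      (fun g : G => (mulInvariantVectorField X g : TangentBundle 𝓘(ℝ, E) G)) :=
    (contMDiff_mulInvariantVectorField X).of_le (le_trans (by norm_num) le_minSmoothness)
  obtain ⟨γ, h0, hγ⟩ := exists_isMIntegralCurveAt_of_contMDiffAt_boundaryless (t₀ := 0)
    (hv.contMDiffAt (x := 1))
  obtain ⟨ε, hε, hγ⟩ := isMIntegralCurveAt_iff'.1 hγ
  refine exists_isMIntegralCurve_of_isMIntegralCurveOn hv hε (fun g => ?_) 1
  refine ⟨fun t => g * γ t, by simp [h0], ?_⟩
  intro t ht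
  have ht' : t ∈ Metric.ball (0 : ℝ) ε := by rwa [Real.ball_eq_Ioo, zero_sub, zero_add]
  have h1 := (hγ t ht').mono (s := Ioo (-ε) ε) (by rw [Real.ball_eq_Ioo, zero_sub, zero_add])
  have hd : ∀ a b : G, MDifferentiableAt 𝓘(ℝ, E) 𝓘(ℝ, E) (fun x => a * x) b := fun a _ =>
    (contMDiff_mul_left (I := 𝓘(ℝ, E)) (n := ∞) (a := a)).contMDiffAt.mdifferentiableAt (by simp)
  have h2 := (hd g (γ t)).hasMFDerivAt
  have h3 := h2.comp_hasMFDerivWithinAt t h1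
  have h4 : mulInvariantVectorField X (g * γ t) =
      mfderiv 𝓘(ℝ, E) 𝓘(ℝ, E) (fun x => g * x) (γ t) (mulInvariantVectorField X (γ t)) := by
    have hc : HasMFDerivAt 𝓘(ℝ, E) 𝓘(ℝ, E) ((fun x => g * x) ∘ (fun x => γ t * x)) (1 : G)
        ((mfderiv 𝓘(ℝ, E) 𝓘(ℝ, E) (fun x => g * x) (γ t * 1)).comp
          (mfderiv 𝓘(ℝ, E) 𝓘(ℝ, E) (fun x => γ t * x) 1)) :=
      (hd g (γ t * 1)).hasMFDerivAt.comp (1 : G) (hd (γ t) 1).hasMFDerivAt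
    have he : (fun x => g * x) ∘ (fun x => γ t * x) = fun x => g * γ t * x := by
      ext x; exact (mul_assoc _ _ _).symm
    rw [he] at hc
    have hm := hc.mfderiv
    have hr : mulInvariantVectorField X (g * γ t) =
        mfderiv 𝓘(ℝ, E) 𝓘(ℝ, E) (fun x => g * x) (γ t * 1) (mulInvariantVectorField X (γ t)) :=
      congrArg (fun A : E →L[ℝ] E => A X) hm
    have hk : ∀ h : G, h = γ t → (mfderiv 𝓘(ℝ, E) 𝓘(ℝ, E) (fun x => g * x) h : E →L[ℝ] E) =
        (mfderiv 𝓘(ℝ, E) 𝓘(ℝ, E) (fun x => g * x) (γ t) : E →L[ℝ] E) := by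
      rintro _ rfl; rfl
    exact hr.trans (congrArg (fun A : E →L[ℝ] E => A (mulInvariantVectorField X (γ t)))
      (hk _ (mul_one _)))
  refine (congrArg (fun A : ℝ →L[ℝ] E => HasMFDerivWithinAt 𝓘(ℝ, ℝ) 𝓘(ℝ, E)
    (fun t => g * γ t) (Ioo (-ε) ε) t A) ?_).mpr h3
  refine ContinuousLinearMap.ext fun r => ?_
  have h5 := (mfderiv 𝓘(ℝ, E) 𝓘(ℝ, E) (fun x => g * x) (γ t)).map_smul r
    (mulInvariantVectorField X (γ t))
  refine Eq.trans ?_ h5.symm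
  exact congrArg (fun w : E => r • w) h4

/-- The exponential map of `G`: `exp X = γ 1`, where `γ` is the integral curve, with `γ 0 = 1`, of
the left-invariant vector field of `X`. -/
def lieExp (X : LieAlg E G) : G :=
  (exists_isMIntegralCurve_mulInvariantVectorField X).choose 1

open Classical in
variable (E G) in
/-- The logarithm of `G`: a local inverse of the exponential map, sending a neighbourhood of `1` in
`G` to a neighbourhood of `0`. Its germ at `1` does not depend on the choice. -/
def lieLog : G → LieAlg E G :=
  if h : ∃ e : OpenPartialHomeomorph (LieAlg E G) G, 0 ∈ e.source ∧ EqOn e lieExp e.source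
  then h.choose.symm else fun _ => 0

variable (E G) in
/-- `G` as a uniform group, with the uniformity of its left-invariant Riemannian distances, which
is the left uniformity of the topological group. -/
def lieLocalGroup : LocalGroupData G where
  unif :=
    haveI : IsTopologicalGroup G := topologicalGroup_of_lieGroup 𝓘(ℝ, E) ∞
    IsTopologicalGroup.leftUniformSpace G
  one := 1
  mul := fun x y => x * y
  inv := fun x => x⁻¹

variable (E G) in
/-- The local group `log G`: the Lie algebra, with the operation `log (exp X exp Y)` and the
uniformity of the vector space. -/
def logLocalGroup : LocalGroupData (LieAlg E G) where
  unif := IsTopologicalAddGroup.leftUniformSpace (LieAlg E G)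
  one := 0
  mul := fun X Y => lieLog E G (lieExp X * lieExp Y)
  inv := fun X => lieLog E G (lieExp X)⁻¹

/-- The dilatations `exp X ↦ exp (δ_ε X)` of `G` near the neutral element. -/
def Strata.groupDil {D : Submodule ℝ (LieAlg E G)} (S : Strata D) (ε : ℝ) (g : G) : G :=
  lieExp (S.dil ε (lieLog E G g))

end LieGroup
end

/-! ### Exponentials in a real Banach algebra -/

section BanachAlgebra

open NormedSpace

variable {A : Type*} [NormedRing A] [NormedAlgebra ℝ A] [CompleteSpace A]

/-! In logarithmic coordinates the product of X and Y is Z(1), where Z(t) = log(exp tX exp tY).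
Differentiation gives ((e^{ad Z} - 1)/ad Z) Z' = X + e^{t ad X} Y, and e^{ad Z} = e^{t ad X} e^{t ad
Y} because Ad is a homomorphism. Applying the first K terms of log(1 + N)/N with N = e^{ad Z} - 1
recovers Z' up to an error of order K + 1. Integration over t shows that the product differs from
`bchInt ad K X Y` by O((‖X‖ + ‖Y‖)^{K+1}) (`logTrunc_mul_expInt`,
`ExpChart.hasDerivAt_log_exp_mul_exp`, `ExpChart.exists_norm_log_sub_bchInt_le`). Neither
analyticity of the group nor convergence of the Baker-Campbell-Hausdorff series enters.

Take K = m with V^m = 𝔤. The dilatation δ_ε shrinks vectors by a factor O(ε), and its inverse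
expands them by at most O(ε^{-m}), so the remainder contributes O(ε^{m+1} ε^{-m}) = O(ε). By
naturality (`units_apply_bchInt`) the main term is the truncated product of the rescaled bracket
δ_ε⁻¹[δ_ε X, δ_ε Y]. Since [Vⁱ, Vʲ] ⊆ Vⁱ⁺ʲ, the W_k-component of the bracket of layers i and j
carries the factor ε^{i+j-k} with i + j ≥ k. The rescaled bracket is therefore polynomial in ε, and
at ε = 0 only k = i + j survives: this is the bracket of 𝔫(𝔤, D) read through θ
(`Strata.ident_layerSplitting_bracket`). Hence the rescaled products converge, uniformly on compact
sets, to the truncated product of the limit bracket (`LayerSplitting.tendstoUniformlyOn_dil_inv`).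
As that bracket is nilpotent of step m, the integral expands into Dynkin's finite sum, which is the
product of N(G, D) (`map_bchInt_eq_bchMul`).

The group laws of β are limits of those of G: they hold for all vectors because δ_ε brings any
vector near 0. Local compactness turns statements about germs into the uniform ones
(`LocalGroupGerm.isLocalGroup`, `DilatationGerm.hasVirtualTangent`), and the exponential map carries
the result from log G to G. -/

theorem continuous_exp_of_real : Continuous (exp : A → A) :=
  letI : NormedAlgebra ℚ A := NormedAlgebra.restrictScalars ℚ ℝ A
  exp_continuous

theorem Continuous.exp_of_real {X : Type*} [TopologicalSpace X] {f : X → A} (hf : Continuous f) :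
    Continuous fun x => exp (f x) :=
  continuous_exp_of_real.comp hf

/-- The primitive `∫₀ˢ exp (u a) du` of the one-parameter group generated by `a`. -/
noncomputable def expInt (a : A) (s : ℝ) : A := ∫ u in (0 : ℝ)..s, exp (u • a)

theorem hasDerivAt_integral_of_continuous {F : Type*} [NormedAddCommGroup F] [NormedSpace ℝ F]
    [CompleteSpace F] {f : ℝ → F} (hf : Continuous f) (s : ℝ) :
    HasDerivAt (fun s => ∫ u in (0 : ℝ)..s, f u) (f s) s :=
  intervalIntegral.integral_hasDerivAt_right (hf.intervalIntegrable _ _)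
    (hf.stronglyMeasurableAtFilter _ _) hf.continuousAt

theorem hasDerivAt_expInt (a : A) (s : ℝ) : HasDerivAt (expInt a) (exp (s • a)) s :=
  hasDerivAt_integral_of_continuous (f := fun u : ℝ => exp (u • a))
    (Continuous.exp_of_real (by fun_prop)) s

theorem expInt_zero_right (a : A) : expInt a 0 = 0 := by simp [expInt]

/-- Justifies reading `expInt a s` as (exp (s a) - 1)/a, even when a is not invertible. -/
theorem mul_expInt (a : A) (s : ℝ) : a * expInt a s = exp (s • a) - 1 := by
  have h : ∀ t : ℝ, HasDerivAt (fun s : ℝ => a * expInt a s - exp (s • a)) 0 t := fun t => by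
    simpa using ((hasDerivAt_expInt a t).const_mul a).fun_sub (hasDerivAt_exp_smul_const' a t)
  have h2 := is_const_of_deriv_eq_zero (fun t => (h t).differentiableAt) (fun t => (h t).deriv) s 0
  simp only [expInt_zero_right, mul_zero, zero_smul, exp_zero] at h2
  rw [sub_eq_iff_eq_add] at h2
  rw [h2]; abel

theorem continuous_expInt_one : Continuous fun a : A => expInt a 1 :=
  intervalIntegral.continuous_parametric_intervalIntegral_of_continuous'
    (f := fun (a : A) (u : ℝ) => exp (u • a))
    (Continuous.exp_of_real (by fun_prop)) 0 1

theorem expInt_zero_one : expInt (0 : A) 1 = 1 := by simp [expInt]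

/-- The truncation of the power series `log (1 + N) / N`. -/
noncomputable def logTrunc (K : ℕ) (N : A) : A :=
  ∑ k ∈ Finset.range K, ((-1 : ℝ) ^ k / (k + 1 : ℝ)) • N ^ k

/-- Put N = exp (s a) - 1. Then N' = a exp (s a), and the factor a turns `expInt a s` back into N by
`mul_expInt`. So each of the k factors N contributes N^k exp (s a) to the derivative, and the factor
`expInt` contributes it once more. -/
theorem hasDerivAt_pow_mul_expInt (a : A) (k : ℕ) (s : ℝ) :
    HasDerivAt (fun s : ℝ => (exp (s • a) - 1) ^ k * expInt a s)
      ((k + 1 : ℝ) • ((exp (s • a) - 1) ^ k * exp (s • a))) s := by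
  induction k with
  | zero => simpa using hasDerivAt_expInt a s
  | succ k ih =>
    have h1 := ((hasDerivAt_exp_smul_const a s).sub_const 1).mul ih
    have hc : ∀ x : A, Commute a x → Commute (exp (s • a)) x := fun x hx =>
      (hx.smul_left s).exp_left
    have hN : Commute (exp (s • a)) (exp (s • a) - 1) :=
      (Commute.refl _).sub_right (Commute.one_right _)
    have haN : Commute a (exp (s • a) - 1) :=
      (((Commute.refl a).smul_right s).exp_right).sub_right (Commute.one_right _)
    convert! h1 using 1
    · funext u; rw [Pi.mul_apply]; simp only [pow_succ', mul_assoc]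
    · have e : exp (s • a) * a * ((exp (s • a) - 1) ^ k * expInt a s) =
          (exp (s • a) - 1) ^ (k + 1) * exp (s • a) := by
        rw [← mul_assoc (exp (s • a) * a), mul_assoc (exp (s • a)), (haN.pow_right k).eq,
          mul_assoc, mul_assoc, mul_expInt, ← pow_succ, (hN.pow_right _).eq]
      rw [e, mul_smul_comm, ← mul_assoc, ← pow_succ']
      push_cast
      module

/-- An exact version of (log(1 + N)/N) · ((e^a - 1)/a) = 1. Replace a by s a and differentiate in s:
the factors k + 1 of the preceding lemma cancel the denominators of `logTrunc`, and the geometric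
sum ∑ (-N)^k (1 + N) = 1 - (-N)^K remains. No smallness of a is needed until the remainder is
estimated. -/
theorem logTrunc_mul_expInt (K : ℕ) (a : A) :
    logTrunc K (exp a - 1) * expInt a 1 =
      1 - ∫ s in (0 : ℝ)..1, (-(exp (s • a) - 1)) ^ K := by
  have hc : Continuous fun s : ℝ => exp (s • a) := Continuous.exp_of_real (by fun_prop)
  have h : ∀ s : ℝ, HasDerivAt (fun s : ℝ => logTrunc K (exp (s • a) - 1) * expInt a s)
      (1 - (-(exp (s • a) - 1)) ^ K) s := by
    intro s
    have h1 := HasDerivAt.fun_sum (u := Finset.range K) fun k _ =>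
      (hasDerivAt_pow_mul_expInt a k s).const_smul ((-1 : ℝ) ^ k / (k + 1 : ℝ))
    convert! h1 using 1
    · funext u; simp only [logTrunc, Finset.sum_mul, smul_mul_assoc, Pi.smul_apply]
    · rw [← mul_neg_geom_sum, Finset.mul_sum]
      refine Finset.sum_congr rfl fun k _ => ?_
      rw [smul_smul, div_mul_cancel₀ _ (by positivity), neg_pow, sub_neg_eq_add,
        add_sub_cancel]
      have hN : Commute (exp (s • a)) (exp (s • a) - 1) :=
        (Commute.refl _).sub_right (Commute.one_right _)
      rcases Nat.even_or_odd k with hk | hk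
      · simp [hk.neg_one_pow, (hN.pow_right k).eq]
      · simp [hk.neg_one_pow, (hN.pow_right k).eq]
  have h2 := intervalIntegral.integral_eq_sub_of_hasDerivAt (a := 0) (b := 1)
    (fun s _ => h s) (Continuous.intervalIntegrable (by fun_prop) _ _)
  rw [intervalIntegral.integral_sub (by simp)
    (Continuous.intervalIntegrable (by fun_prop) _ _)] at h2
  simp only [expInt_zero_right, mul_zero, one_smul, sub_zero] at h2
  rw [← h2]; simp

theorem exists_norm_exp_sub_one_le :
    ∃ r > 0, ∀ a : A, ‖a‖ < r → ‖exp a - 1‖ ≤ 2 * ‖a‖ := by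
  have h := (hasStrictFDerivAt_exp_zero (𝕂 := ℝ) (𝔸 := A)).hasFDerivAt.isLittleO.def one_pos
  obtain ⟨r, hr, H⟩ := Metric.eventually_nhds_iff.1 h
  refine ⟨r, hr, fun a ha => ?_⟩
  have := H (y := a) (by simpa using ha)
  simp only [sub_zero, exp_zero, one_mul] at this
  calc ‖exp a - 1‖ = ‖(exp a - 1 - a) + a‖ := by congr 1; abel
    _ ≤ ‖exp a - 1 - a‖ + ‖a‖ := norm_add_le _ _
    _ ≤ 2 * ‖a‖ := by
      have h3 : ‖exp a - 1 - a‖ ≤ ‖a‖ := by simpa using this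
      linarith

end BanachAlgebra

/-! ### Topological groups with a chart and an exponential map -/

/-- A Grönwall estimate on `[0, 1]`. -/
theorem norm_le_exp_mul_of_norm_deriv_le {E : Type*} [NormedAddCommGroup E] [NormedSpace ℝ E]
    {f f' : ℝ → E} {δ K ε : ℝ} (hK : 1 ≤ K) (hε : 0 ≤ ε)
    (hf : ∀ s ∈ Icc (0 : ℝ) 1, HasDerivAt f (f' s) s) (h0 : ‖f 0‖ ≤ δ)
    (bound : ∀ s ∈ Icc (0 : ℝ) 1, ‖f' s‖ ≤ K * ‖f s‖ + ε) :
    ∀ s ∈ Icc (0 : ℝ) 1, ‖f s‖ ≤ Real.exp K * (δ + ε) := by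
  intro s hs
  have h := norm_le_gronwallBound_of_norm_deriv_right_le (f := f) (f' := f') (a := 0) (b := 1)
    (fun t ht => (hf t ht).continuousAt.continuousWithinAt)
    (fun t ht => (hf t (Ico_subset_Icc_self ht)).hasDerivWithinAt) h0
    (fun t ht => bound t (Ico_subset_Icc_self ht)) s hs
  have hδ : 0 ≤ δ := (norm_nonneg _).trans h0
  rw [gronwallBound_of_K_ne_0 (by positivity), sub_zero] at h
  have h1 : Real.exp (K * s) ≤ Real.exp K := Real.exp_le_exp.2 (by nlinarith [hs.1, hs.2])
  have h2 : 1 ≤ Real.exp (K * s) := Real.one_le_exp (by nlinarith [hs.1])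
  have h3 : ε / K ≤ ε := div_le_self hε hK
  have h4 : 0 ≤ ε / K := by positivity
  calc ‖f s‖ ≤ _ := h
    _ ≤ δ * Real.exp K + ε * Real.exp K := by
      refine add_le_add (mul_le_mul_of_nonneg_left h1 hδ) ?_
      exact mul_le_mul h3 (by linarith) (by linarith) hε
    _ = _ := by ring

/-- A chart at the identity of a topological group in which the product is of class `C²`. -/
structure GroupChart (E G : Type*) [NormedAddCommGroup E] [NormedSpace ℝ E] [TopologicalSpace G]
    [Group G] where
  chart : OpenPartialHomeomorph G E
  one_mem : 1 ∈ chart.source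
  map_one : chart 1 = 0
  contDiffAt_mul :
    ContDiffAt ℝ 2 (fun p : E × E => chart (chart.symm p.1 * chart.symm p.2)) 0

namespace GroupChart

variable {E G : Type*} [NormedAddCommGroup E] [NormedSpace ℝ E] [TopologicalSpace G]
  [Group G] (M : GroupChart E G)

/-- The product in the chart. -/
def mul (p : E × E) : E := M.chart (M.chart.symm p.1 * M.chart.symm p.2)

theorem symm_zero : M.chart.symm 0 = 1 := by
  rw [← M.map_one, M.chart.left_inv M.one_mem]

theorem zero_mem_target : (0 : E) ∈ M.chart.target := by
  rw [← M.map_one]; exact M.chart.map_source M.one_mem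

theorem target_mem_nhds {x : E} (hx : x ∈ M.chart.target) : M.chart.target ∈ 𝓝 x :=
  M.chart.open_target.mem_nhds hx

theorem source_mem_nhds {g : G} (hx : g ∈ M.chart.source) : M.chart.source ∈ 𝓝 g :=
  M.chart.open_source.mem_nhds hx

theorem mul_zero_left {x : E} (hx : x ∈ M.chart.target) : M.mul (0, x) = x := by
  simp [mul, M.symm_zero, M.chart.right_inv hx]

theorem mul_zero_right {x : E} (hx : x ∈ M.chart.target) : M.mul (x, 0) = x := by
  simp [mul, M.symm_zero, M.chart.right_inv hx]

theorem eventually_differentiableAt : ∀ᶠ p in 𝓝 (0 : E × E), DifferentiableAt ℝ M.mul p := by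
  filter_upwards [M.contDiffAt_mul.eventually (by simp)] with p hp
  exact hp.differentiableAt (by simp)

/-- The left-invariant vector fields in the chart. -/
noncomputable def left (x : E) : E →L[ℝ] E :=
  (fderiv ℝ M.mul (x, 0)).comp (ContinuousLinearMap.inr ℝ E E)

/-- The right-invariant vector fields in the chart. -/
noncomputable def right (x : E) : E →L[ℝ] E :=
  (fderiv ℝ M.mul (0, x)).comp (ContinuousLinearMap.inl ℝ E E)

theorem fderiv_mul_zero_left {x : E} (hx : x ∈ M.chart.target)
    (hd : DifferentiableAt ℝ M.mul (0, x)) (v : E) : fderiv ℝ M.mul (0, x) (0, v) = v := by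
  have h1 : HasFDerivAt (fun y : E => M.mul (0, y))
      ((fderiv ℝ M.mul (0, x)).comp (ContinuousLinearMap.inr ℝ E E)) x :=
    hd.hasFDerivAt.comp x (hasFDerivAt_prodMk_right 0 x)
  have h2 : HasFDerivAt (fun y : E => M.mul (0, y)) (ContinuousLinearMap.id ℝ E) x := by
    refine (hasFDerivAt_id x).congr_of_eventuallyEq ?_
    filter_upwards [M.target_mem_nhds hx] with y hy using M.mul_zero_left hy
  exact DFunLike.congr_fun (h1.unique h2) v

theorem fderiv_mul_zero_right {x : E} (hx : x ∈ M.chart.target)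
    (hd : DifferentiableAt ℝ M.mul (x, 0)) (v : E) : fderiv ℝ M.mul (x, 0) (v, 0) = v := by
  have h1 : HasFDerivAt (fun y : E => M.mul (y, 0))
      ((fderiv ℝ M.mul (x, 0)).comp (ContinuousLinearMap.inl ℝ E E)) x :=
    HasFDerivAt.comp (g := M.mul) (f := fun y : E => (y, (0 : E))) x hd.hasFDerivAt
      (hasFDerivAt_prodMk_left x (0 : E))
  have h2 : HasFDerivAt (fun y : E => M.mul (y, 0)) (ContinuousLinearMap.id ℝ E) x := by
    refine (hasFDerivAt_id x).congr_of_eventuallyEq ?_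
    filter_upwards [M.target_mem_nhds hx] with y hy using M.mul_zero_right hy
  exact DFunLike.congr_fun (h1.unique h2) v

theorem left_zero : M.left 0 = 1 := by
  ext v
  exact M.fderiv_mul_zero_left M.zero_mem_target M.eventually_differentiableAt.self_of_nhds v

theorem right_zero : M.right 0 = 1 := by
  ext v
  exact M.fderiv_mul_zero_right M.zero_mem_target M.eventually_differentiableAt.self_of_nhds v

theorem contDiffAt_fderiv_mul : ContDiffAt ℝ 1 (fderiv ℝ M.mul) 0 :=
  M.contDiffAt_mul.fderiv_right (by norm_num)

theorem contDiffAt_left : ContDiffAt ℝ 1 M.left 0 := by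
  have h : ContDiffAt ℝ 1 (fun x : E => fderiv ℝ M.mul (x, 0)) 0 :=
    ContDiffAt.comp (g := fderiv ℝ M.mul) (f := fun x : E => (x, (0 : E))) 0
      M.contDiffAt_fderiv_mul (by fun_prop)
  exact h.clm_comp contDiffAt_const

theorem contDiffAt_right : ContDiffAt ℝ 1 M.right 0 := by
  have h : ContDiffAt ℝ 1 (fun x : E => fderiv ℝ M.mul (0, x)) 0 :=
    ContDiffAt.comp (g := fderiv ℝ M.mul) (f := fun x : E => ((0 : E), x)) 0
      M.contDiffAt_fderiv_mul (by fun_prop)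
  exact h.clm_comp contDiffAt_const

/-- The adjoint representation `ad Z c = [Z, c]` of the Lie bracket in the chart. -/
noncomputable def ad : E →L[ℝ] E →L[ℝ] E := (fderiv ℝ (fun x => M.right x - M.left x) 0).flip

theorem hasFDerivAt_right_sub_left :
    HasFDerivAt (fun x => M.right x - M.left x) M.ad.flip 0 := by
  rw [ad, ContinuousLinearMap.flip_flip]
  exact ((M.contDiffAt_right.differentiableAt (by simp)).sub
    (M.contDiffAt_left.differentiableAt (by simp))).hasFDerivAt

/-- The mixed second derivatives of the product at 0 are symmetric, so the derivative of `right` is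
that of `left` with the two arguments exchanged. The commutator form is the one to be compared with
the Lie bracket of vector fields. -/
theorem ad_apply (X Y : E) :
    M.ad X Y = fderiv ℝ M.left 0 X Y - fderiv ℝ M.left 0 Y X := by
  have hd : HasFDerivAt (fderiv ℝ M.mul) (fderiv ℝ (fderiv ℝ M.mul) 0) 0 :=
    (M.contDiffAt_fderiv_mul.differentiableAt (by simp)).hasFDerivAt
  have hl1 : HasFDerivAt (fun x : E => fderiv ℝ M.mul (x, 0)) _ 0 :=
    HasFDerivAt.comp (g := fderiv ℝ M.mul) (f := fun x : E => (x, (0 : E))) (0 : E) hd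
      (hasFDerivAt_prodMk_left (𝕜 := ℝ) (0 : E) (0 : E))
  have hr1 : HasFDerivAt (fun x : E => fderiv ℝ M.mul (0, x)) _ 0 :=
    HasFDerivAt.comp (g := fderiv ℝ M.mul) (f := fun x : E => ((0 : E), x)) (0 : E) hd
      (hasFDerivAt_prodMk_right (𝕜 := ℝ) (0 : E) (0 : E))
  have hl : HasFDerivAt M.left _ 0 := hl1.clm_comp (hasFDerivAt_const _ _)
  have hr : HasFDerivAt M.right _ 0 := hr1.clm_comp (hasFDerivAt_const _ _)
  have hs : IsSymmSndFDerivAt ℝ M.mul 0 := M.contDiffAt_mul.isSymmSndFDerivAt (by simp)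
  rw [ad, (hr.fun_sub hl).fderiv, hl.fderiv]
  simp [hs.eq (0, Y) (X, 0)]

end GroupChart

/-- A chart at the identity of a topological group, together with an exponential map that is
expressed in this chart. -/
structure ExpChart (E G : Type*) [NormedAddCommGroup E] [NormedSpace ℝ E] [TopologicalSpace G]
    [Group G] extends GroupChart E G where
  exp : E → G
  exp_add_smul : ∀ (X : E) (s t : ℝ), exp ((s + t) • X) = exp (s • X) * exp (t • X)
  continuousAt_exp : ContinuousAt exp 0
  hasDerivAt_exp : ∀ X : E, HasDerivAt (fun t : ℝ => chart (exp (t • X))) X 0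

namespace ExpChart

variable {E G : Type*} [NormedAddCommGroup E] [NormedSpace ℝ E] [TopologicalSpace G]
  [Group G] (M : ExpChart E G)

theorem exp_zero : M.exp 0 = 1 := by
  have := M.exp_add_smul 0 0 0
  simpa using this

theorem exp_neg (X : E) : M.exp (-X) = (M.exp X)⁻¹ := by
  have := M.exp_add_smul X (-1) 1
  rw [neg_add_cancel, zero_smul, M.exp_zero, neg_one_smul, one_smul] at this
  exact eq_inv_of_mul_eq_one_left this.symm

theorem tendsto_exp : Tendsto M.exp (𝓝 0) (𝓝 1) := by
  have := M.continuousAt_exp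
  rwa [ContinuousAt, M.exp_zero] at this

theorem tendsto_exp_smul (X : E) : Tendsto (fun t : ℝ => M.exp (t • X)) (𝓝 0) (𝓝 1) :=
  M.tendsto_exp.comp (Continuous.tendsto' (by fun_prop) _ _ (by simp))

variable [IsTopologicalGroup G]

/-- By associativity the curve is exp(tA) · (x · exp(tB)), so differentiability of the product at
(x, 0) and (0, x) is enough. This yields the differential equation of the curves s ↦ exp(sA) g
exp(sB). -/
theorem hasDerivAt_exp_mul_mul_exp {x : E} (hx : x ∈ M.chart.target)
    (h1 : DifferentiableAt ℝ M.mul (0, x)) (h2 : DifferentiableAt ℝ M.mul (x, 0)) (A B : E) :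
    HasDerivAt (fun t : ℝ => M.chart (M.exp (t • A) * M.chart.symm x * M.exp (t • B)))
      (M.right x A + M.left x B) 0 := by
  have hB : HasDerivAt (fun t : ℝ => M.mul (x, M.chart (M.exp (t • B)))) (M.left x B) 0 := by
    have h2' : HasFDerivAt M.mul (fderiv ℝ M.mul (x, 0))
        ((fun t : ℝ => (x, M.chart (M.exp (t • B)))) 0) := by
      simpa [M.exp_zero, M.map_one] using h2.hasFDerivAt
    exact h2'.comp_hasDerivAt (0 : ℝ) ((hasDerivAt_const _ x).prodMk (M.hasDerivAt_exp B))
  have hA : HasDerivAt (fun t : ℝ => M.mul (M.chart (M.exp (t • A)),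
      M.mul (x, M.chart (M.exp (t • B))))) (fderiv ℝ M.mul (0, x) (A, M.left x B)) 0 := by
    have h1' : HasFDerivAt M.mul (fderiv ℝ M.mul (0, x))
        ((fun t : ℝ => (M.chart (M.exp (t • A)), M.mul (x, M.chart (M.exp (t • B))))) 0) := by
      simpa [M.exp_zero, M.map_one, M.mul_zero_right hx] using h1.hasFDerivAt
    exact h1'.comp_hasDerivAt (0 : ℝ) ((M.hasDerivAt_exp A).prodMk hB)
  have e : fderiv ℝ M.mul (0, x) (A, M.left x B) = M.right x A + M.left x B := by
    have : (A, M.left x B) = (A, (0 : E)) + ((0 : E), M.left x B) := by simp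
    rw [this, map_add, M.fderiv_mul_zero_left hx h1]
    rfl
  rw [e] at hA
  refine hA.congr_of_eventuallyEq ?_
  have hxs := M.chart.map_target hx
  have t1 := (M.tendsto_exp_smul A).eventually (M.source_mem_nhds M.one_mem)
  have t2 := (M.tendsto_exp_smul B).eventually (M.source_mem_nhds M.one_mem)
  have t3 : Tendsto (fun t : ℝ => M.chart.symm x * M.exp (t • B)) (𝓝 0) (𝓝 (M.chart.symm x)) := by
    simpa using tendsto_const_nhds.mul (M.tendsto_exp_smul B)
  filter_upwards [t1, t2, t3.eventually (M.source_mem_nhds hxs)] with t e1 e2 e3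
  simp only [GroupChart.mul]
  rw [M.chart.left_inv e1, M.chart.left_inv e2, M.chart.left_inv e3, mul_assoc]

theorem tendsto_exp_mul_mul_exp_neg :
    Tendsto (fun q : E × E × E => M.exp q.1 * M.chart.symm q.2.1 * M.exp (-q.2.2)) (𝓝 0) (𝓝 1) := by
  have h1 : Tendsto (fun q : E × E × E => M.exp q.1) (𝓝 0) (𝓝 1) :=
    M.tendsto_exp.comp (Continuous.tendsto' (by fun_prop) _ _ (by simp))
  have h2 : Tendsto (fun q : E × E × E => M.exp (-q.2.2)) (𝓝 0) (𝓝 1) :=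
    M.tendsto_exp.comp (Continuous.tendsto' (by fun_prop) _ _ (by simp))
  have h3 : Tendsto (fun q : E × E × E => M.chart.symm q.2.1) (𝓝 0) (𝓝 1) := by
    have := M.chart.symm.continuousAt M.zero_mem_target
    rw [ContinuousAt, M.symm_zero] at this
    exact this.comp (Continuous.tendsto' (by fun_prop) _ _ (by simp))
  simpa using (h1.mul h3).mul h2

end ExpChart

/-! ### Differentiability of conjugation and of the exponential map, from a linearised differential
equation. -/

namespace ExpChart

variable {E G : Type*} [NormedAddCommGroup E] [NormedSpace ℝ E] [CompleteSpace E]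
  [TopologicalSpace G] [Group G] [IsTopologicalGroup G] (M : ExpChart E G)

/-- Variation of constants: exp(s a) c(0) + `expInt a s` h solves c' = a c + h exactly, and Grönwall
bounds its distance to an approximate solution with the same initial value. -/
theorem norm_sub_linear_solution_le {a : E →L[ℝ] E} {c c' : ℝ → E} {h : E} {K η : ℝ}
    (hK : 1 ≤ K) (ha : ‖a‖ ≤ K) (hη : 0 ≤ η)
    (hc : ∀ s ∈ Icc (0 : ℝ) 1, HasDerivAt c (c' s) s)
    (bound : ∀ s ∈ Icc (0 : ℝ) 1, ‖c' s - (a (c s) + h)‖ ≤ η) :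
    ‖c 1 - (NormedSpace.exp a (c 0) + expInt a 1 h)‖ ≤ Real.exp K * η := by
  let d : ℝ → E := fun s => NormedSpace.exp (s • a) (c 0) + expInt a s h
  have hd : ∀ s, HasDerivAt d (a (d s) + h) s := by
    intro s
    have h1 := ((hasDerivAt_exp_smul_const' a s).clm_apply (hasDerivAt_const s (c 0))).add
      ((hasDerivAt_expInt a s).clm_apply (hasDerivAt_const s h))
    convert! h1 using 1
    have h2 := DFunLike.congr_fun (mul_expInt a s) h
    simp only [mul_apply_eq_comp, sub_apply,
      one_apply_eq_self] at h2
    simp only [d, map_add, h2, mul_apply_eq_comp, map_zero, add_zero]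
    abel
  have h0 : d 0 = c 0 := by simp [d, expInt_zero_right]
  have := norm_le_exp_mul_of_norm_deriv_le (f := fun s => c s - d s)
    (f' := fun s => c' s - (a (d s) + h)) (δ := 0) hK hη
    (fun s hs => (hc s hs).sub (hd s)) (by simp [h0]) (fun s hs => ?_) 1 (by simp)
  · simpa [d] using this
  · calc ‖c' s - (a (d s) + h)‖ = ‖a (c s - d s) + (c' s - (a (c s) + h))‖ := by
          congr 1; rw [map_sub]; abel
      _ ≤ ‖a (c s - d s)‖ + ‖c' s - (a (c s) + h)‖ := norm_add_le _ _
      _ ≤ K * ‖c s - d s‖ + η := by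
        refine add_le_add (a.le_of_opNorm_le ha _) (bound s hs)

/-- The derivative of `(y, h) ↦ exp (Z + h) y exp (-Z)`. -/
theorem eventually_hasFDerivAt_exp_mul_mul_exp_neg :
    ∀ᶠ Z in 𝓝 (0 : E), HasFDerivAt
      (fun p : E × E => M.chart (M.exp (Z + p.2) * M.chart.symm p.1 * M.exp (-Z)))
      ((NormedSpace.exp (M.ad Z)).coprod (expInt (M.ad Z) 1)) 0 := by
  -- In the chart the curve c(s) = exp(s(Z + h)) y exp(-sZ) solves c' = right(c)(Z + h) - left(c) Z,
  -- and c(1) is the function to be differentiated. For y = 0 and h = 0 it is constantly 0, so with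
  -- Z fixed the equation linearises to c' = ad Z c + h, whose value at time 1 is the asserted
  -- derivative.
  have hl : Tendsto (fun x : E => (x, (0 : E))) (𝓝 0) (𝓝 0) :=
    Continuous.tendsto' (by fun_prop) _ _ (by simp)
  have hr : Tendsto (fun x : E => ((0 : E), x)) (𝓝 0) (𝓝 0) :=
    Continuous.tendsto' (by fun_prop) _ _ (by simp)
  have hrc : Tendsto (fun x => M.right x) (𝓝 0) (𝓝 1) := by
    have := M.contDiffAt_right.continuousAt
    rwa [ContinuousAt, M.right_zero] at this
  -- closeness to the linearised equation
  have hlin : ∀ η > 0, ∀ᶠ x in 𝓝 (0 : E),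
      ‖M.right x - M.left x - M.ad.flip x‖ ≤ η * ‖x‖ ∧ ‖M.right x - 1‖ ≤ η := by
    intro η hη
    have h1 := M.hasFDerivAt_right_sub_left.isLittleO.def hη
    have h2 : ∀ᶠ x in 𝓝 (0 : E), dist (M.right x) 1 < η := hrc.eventually (Metric.ball_mem_nhds _ hη)
    filter_upwards [h1, h2] with x h1 h2
    refine ⟨?_, by rw [← dist_eq_norm]; exact h2.le⟩
    simpa [M.right_zero, M.left_zero] using h1
  obtain ⟨ρ, hρ, Hρ⟩ := Metric.eventually_nhds_iff.1 (((hlin 1 one_pos).and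
    (M.target_mem_nhds M.zero_mem_target)).and
    ((hl.eventually M.eventually_differentiableAt).and
      (hr.eventually M.eventually_differentiableAt)))
  have Hg : ∀ᶠ g in 𝓝 (1 : G), g ∈ M.chart.source ∧ ‖M.chart g‖ < ρ := by
    refine Filter.Eventually.and (M.source_mem_nhds M.one_mem) ?_
    have := (M.chart.continuousAt M.one_mem)
    rw [ContinuousAt, M.map_one] at this
    simpa using this.eventually (Metric.ball_mem_nhds _ hρ)
  have Hy : ∀ᶠ q in 𝓝 (0 : E × E × E), q.2.1 ∈ M.chart.target :=
    (Continuous.tendsto' (f := fun q : E × E × E => q.2.1) (by fun_prop) 0 0 rfl).eventually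
      (M.target_mem_nhds M.zero_mem_target)
  obtain ⟨r, hr0, Hr'⟩ := Metric.eventually_nhds_iff.1
    ((M.tendsto_exp_mul_mul_exp_neg.eventually Hg).and Hy)
  have Hr := fun q hq => (@Hr' q hq).1
  have hrt : ∀ y : E, ‖y‖ < r → y ∈ M.chart.target := fun y hy =>
    (@Hr' (0, y, 0) (by simpa using hy)).2
  have hball : ∀ᶠ Z in 𝓝 (0 : E), ‖Z‖ < min (r / 2) 1 := by
    filter_upwards [Metric.ball_mem_nhds (0 : E) (show 0 < min (r / 2) 1 by positivity)] with Z hZ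
    simpa using hZ
  filter_upwards [hball] with Z hZ
  have hZr : ‖Z‖ < r / 2 := hZ.trans_le (min_le_left _ _)
  have hZ1 : ‖Z‖ ≤ 1 := (hZ.trans_le (min_le_right _ _)).le
  set a : E →L[ℝ] E := M.ad Z with ha
  -- The growth rate of the curve is at most ‖ad‖ + 1, by the linearisation with η = 1 and ‖Z‖ ≤ 1;
  -- the further unit is slack.
  let K : ℝ := ‖M.ad‖ + 2
  have hK1 : 1 ≤ K := by have := norm_nonneg M.ad; simp only [K]; linarith
  have haK : ‖a‖ ≤ K := by
    have := M.ad.le_opNorm Z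
    have h2 := mul_le_of_le_one_right (norm_nonneg M.ad) hZ1
    simp only [K]; linarith
  -- the curve
  have curve : ∀ p : E × E, ‖p‖ < r / 2 → ∃ c : ℝ → E, c 0 = p.1 ∧
      c 1 = M.chart (M.exp (Z + p.2) * M.chart.symm p.1 * M.exp (-Z)) ∧
      ∀ s ∈ Icc (0 : ℝ) 1, ‖c s‖ < ρ ∧
        HasDerivAt c (M.right (c s) (Z + p.2) - M.left (c s) Z) s := by
    rintro ⟨y, h⟩ hp
    have hy : ‖y‖ < r / 2 := (norm_fst_le (y, h)).trans_lt hp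
    have hh : ‖h‖ < r / 2 := (norm_snd_le (y, h)).trans_lt hp
    let u : ℝ → G := fun s => M.exp (s • (Z + h)) * M.chart.symm y * M.exp (-(s • Z))
    have hu : ∀ s ∈ Icc (0 : ℝ) 1, u s ∈ M.chart.source ∧ ‖M.chart (u s)‖ < ρ := by
      intro s hs
      have hs1 : ‖s‖ ≤ 1 := by rw [Real.norm_eq_abs, abs_le]; constructor <;> linarith [hs.1, hs.2]
      refine Hr (s • (Z + h), y, s • Z) ?_
      rw [dist_zero_right]
      have e1 : ‖s • (Z + h)‖ < r := by
        rw [norm_smul]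
        have := norm_add_le Z h
        nlinarith [norm_nonneg (Z + h)]
      have e2 : ‖s • Z‖ < r := by
        rw [norm_smul]
        nlinarith [norm_nonneg Z]
      simp only [Prod.norm_mk]
      exact max_lt e1 (max_lt (by linarith) e2)
    refine ⟨fun s => M.chart (u s), ?_, by simp [u], fun s hs => ⟨(hu s hs).2, ?_⟩⟩
    · have : y ∈ M.chart.target := hrt y (hy.trans (half_lt_self hr0))
      simp [u, M.exp_zero, M.chart.right_inv this]
    · obtain ⟨hus, hun⟩ := hu s hs
      obtain ⟨⟨-, ht⟩, d2, d1⟩ := Hρ (y := M.chart (u s)) (by simpa using hun)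
      have key := M.hasDerivAt_exp_mul_mul_exp ht d1 d2 (Z + h) (-Z)
      -- The derivative formula is known at time 0 only. The one-parameter law splits off exp((t -
      -- s)(Z + h)) on the left and exp(-(t - s)Z) on the right, with the point at time s in
      -- between.
      rw [M.chart.left_inv hus, ← sub_self s] at key
      have key2 := key.comp_sub_const s s
      convert! key2 using 1
      · funext t
        have e1 : t • (Z + h) = ((t - s) + s) • (Z + h) := by rw [sub_add_cancel]
        have e2 : -(t • Z) = (s + (t - s)) • (-Z) := by rw [add_sub_cancel, smul_neg]
        simp only [u]
        rw [e1, e2, M.exp_add_smul, M.exp_add_smul, smul_neg s Z]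
        simp only [mul_assoc]
      · rw [map_neg, sub_eq_add_neg]
  -- Grönwall with initial value ‖y‖ and forcing term 2‖h‖ gives ‖c(s)‖ ≤ 3 e^K ‖(y, h)‖.
  let C : ℝ := 3 * Real.exp K
  have hC : 0 < C := by positivity
  refine HasFDerivAt.of_isLittleO (Asymptotics.IsLittleO.of_bound fun η₀ hη₀ => ?_)
  -- With this choice the final error e^K η (C + 1)‖p‖ is exactly η₀‖p‖.
  let η := η₀ / (Real.exp K * (C + 1))
  have hη : 0 < η := by positivity
  obtain ⟨δ, hδ, Hδ⟩ := Metric.eventually_nhds_iff.1 (hlin η hη)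
  have hsmall : ∀ᶠ p in 𝓝 (0 : E × E), ‖p‖ < min (r / 2) (δ / C) := by
    filter_upwards [Metric.ball_mem_nhds (0 : E × E)
      (show 0 < min (r / 2) (δ / C) by positivity)] with p hp
    simpa using hp
  filter_upwards [hsmall] with p hp
  have hpC : C * ‖p‖ < δ := by
    have := hp.trans_le (min_le_right _ _)
    rwa [lt_div_iff₀' hC] at this
  obtain ⟨c, hc0, hc1, hc⟩ := curve p (hp.trans_le (min_le_left _ _))
  have hone : ‖(1 : E →L[ℝ] E)‖ ≤ 1 := ContinuousLinearMap.norm_id_le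
  have hcb : ∀ s ∈ Icc (0 : ℝ) 1, ‖c s‖ ≤ C * ‖p‖ := by
    intro s hs
    have := norm_le_exp_mul_of_norm_deriv_le (f := c) (δ := ‖p.1‖) (ε := 2 * ‖p.2‖) hK1
      (by positivity) (fun s hs => (hc s hs).2) (by rw [hc0]) (fun s hs => ?_) s hs
    · refine this.trans ?_
      have h1 := norm_fst_le p
      have h2 := norm_snd_le p
      have h3 := Real.exp_pos K
      simp only [C]
      nlinarith
    · obtain ⟨⟨⟨b1, b2⟩, -⟩, -⟩ := Hρ (y := c s) (by simpa using (hc s hs).1)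
      have e : M.right (c s) (Z + p.2) - M.left (c s) Z =
          (M.right (c s) - M.left (c s) - M.ad.flip (c s)) Z + M.ad.flip (c s) Z +
          ((M.right (c s) - 1) p.2 + (1 : E →L[ℝ] E) p.2) := by
        simp only [sub_apply, map_add, one_apply_eq_self]; abel
      have n1 := (M.right (c s) - M.left (c s) - M.ad.flip (c s)).le_of_opNorm_le b1 Z
      have n2 := (M.ad.flip (c s)).le_of_opNorm_le (M.ad.flip.le_opNorm (c s)) Z
      have n3 := (M.right (c s) - 1).le_of_opNorm_le b2 p.2
      have n4 := (1 : E →L[ℝ] E).le_of_opNorm_le hone p.2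
      rw [ContinuousLinearMap.opNorm_flip] at n2
      rw [e]
      have n5 := norm_add₄_le (a := (M.right (c s) - M.left (c s) - M.ad.flip (c s)) Z)
        (b := M.ad.flip (c s) Z) (c := (M.right (c s) - 1) p.2) (d := (1 : E →L[ℝ] E) p.2)
      rw [← add_assoc]
      refine n5.trans ?_
      have n6 : ‖M.ad‖ * ‖c s‖ * ‖Z‖ ≤ ‖M.ad‖ * ‖c s‖ :=
        mul_le_of_le_one_right (by positivity) hZ1
      have n7 : 1 * ‖c s‖ * ‖Z‖ ≤ 1 * ‖c s‖ := mul_le_of_le_one_right (by positivity) hZ1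
      simp only [K]
      nlinarith [norm_nonneg (c s)]
  have hfin := norm_sub_linear_solution_le (a := a) (c := c) (h := p.2)
    (η := η * ((C + 1) * ‖p‖)) hK1 haK (by positivity) (fun s hs => (hc s hs).2) (fun s hs => ?_)
  · rw [hc0, hc1] at hfin
    have h00 : M.chart (M.exp (Z + (0 : E × E).2) * M.chart.symm (0 : E × E).1 * M.exp (-Z)) = 0 := by
      simp [M.symm_zero, M.exp_neg, M.map_one]
    rw [h00, sub_zero, sub_zero, ContinuousLinearMap.coprod_apply]
    refine hfin.trans (le_of_eq ?_)
    simp only [η]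
    field_simp
  · obtain ⟨b1, b2⟩ := Hδ (y := c s) (by
      rw [dist_zero_right]; exact (hcb s hs).trans_lt hpC)
    have e : M.right (c s) (Z + p.2) - M.left (c s) Z - (a (c s) + p.2) =
        (M.right (c s) - M.left (c s) - M.ad.flip (c s)) Z + (M.right (c s) - 1) p.2 := by
      simp only [sub_apply, map_add, one_apply_eq_self, ContinuousLinearMap.flip_apply, ha]; abel
    rw [e]
    refine (norm_add_le _ _).trans ?_
    have n1 := (M.right (c s) - M.left (c s) - M.ad.flip (c s)).le_of_opNorm_le b1 Z
    have n3 := (M.right (c s) - 1).le_of_opNorm_le b2 p.2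
    have n7 : η * ‖c s‖ * ‖Z‖ ≤ η * ‖c s‖ := mul_le_of_le_one_right (by positivity) hZ1
    have n8 := mul_le_mul_of_nonneg_left (hcb s hs) hη.le
    have n9 := mul_le_mul_of_nonneg_left (norm_snd_le p) hη.le
    nlinarith

end ExpChart

/-! ### The differential of the exponential map near 0, and its local inverse. -/

namespace ExpChart

variable {E G : Type*} [NormedAddCommGroup E] [NormedSpace ℝ E] [CompleteSpace E]
  [TopologicalSpace G] [Group G] [IsTopologicalGroup G] (M : ExpChart E G)

theorem hasFDerivAt_exp_mul_exp_neg {Z : E} (hZ : HasFDerivAt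
      (fun p : E × E => M.chart (M.exp (Z + p.2) * M.chart.symm p.1 * M.exp (-Z)))
      ((NormedSpace.exp (M.ad Z)).coprod (expInt (M.ad Z) 1)) 0) :
    HasFDerivAt (fun W : E => M.chart (M.exp W * M.exp (-Z))) (expInt (M.ad Z) 1) Z := by
  have h1 : HasFDerivAt (fun W : E => ((0 : E), W - Z)) (ContinuousLinearMap.inr ℝ E E) Z :=
    (hasFDerivAt_const (0 : E) Z).prodMk ((hasFDerivAt_id Z).sub_const Z)
  have h2 := HasFDerivAt.comp (f := fun W : E => ((0 : E), W - Z)) Z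
    (g := fun p : E × E => M.chart (M.exp (Z + p.2) * M.chart.symm p.1 * M.exp (-Z)))
    (by rw [sub_self]; exact hZ) h1
  convert! h2 using 1
  · funext W; simp [M.symm_zero]
  · ext v; simp

theorem hasFDerivAt_conj {Z : E} (hZ : HasFDerivAt
      (fun p : E × E => M.chart (M.exp (Z + p.2) * M.chart.symm p.1 * M.exp (-Z)))
      ((NormedSpace.exp (M.ad Z)).coprod (expInt (M.ad Z) 1)) 0) :
    HasFDerivAt (fun y : E => M.chart (M.exp Z * M.chart.symm y * M.exp (-Z)))
      (NormedSpace.exp (M.ad Z)) 0 := by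
  have h1 : HasFDerivAt (fun y : E => (y, (0 : E))) (ContinuousLinearMap.inl ℝ E E) 0 :=
    hasFDerivAt_prodMk_left 0 0
  have h2 := HasFDerivAt.comp (f := fun y : E => (y, (0 : E))) 0
    (g := fun p : E × E => M.chart (M.exp (Z + p.2) * M.chart.symm p.1 * M.exp (-Z)))
    hZ h1
  convert! h2 using 1
  · funext W; simp
  · ext v; simp

theorem eventually_exp_mem_source : ∀ᶠ Z in 𝓝 (0 : E), M.exp Z ∈ M.chart.source :=
  M.tendsto_exp.eventually (M.source_mem_nhds M.one_mem)

theorem tendsto_chart_exp : Tendsto (fun Z => M.chart (M.exp Z)) (𝓝 0) (𝓝 0) := by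
  have := M.chart.continuousAt M.one_mem
  rw [ContinuousAt, M.map_one] at this
  exact this.comp M.tendsto_exp

theorem tendsto_expInt_ad : Tendsto (fun Z => expInt (M.ad Z) 1) (𝓝 0) (𝓝 1) := by
  have : Continuous fun Z => expInt (M.ad Z) 1 := continuous_expInt_one.comp M.ad.continuous
  exact this.tendsto' _ _ (by simp [expInt_zero_one])

/-- Writing exp W = (exp W exp(-Z)) exp Z gives the differential right(exp Z) ∘ `expInt (ad Z) 1` at
every Z near 0. It is continuous at 0 with value 1, which makes the derivative at 0 strict, as the
inverse function theorem requires. -/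
theorem hasStrictFDerivAt_chart_exp :
    HasStrictFDerivAt (fun Z => M.chart (M.exp Z)) (1 : E →L[ℝ] E) 0 := by
  have hmul : ∀ᶠ Z in 𝓝 (0 : E), ∀ᶠ W in 𝓝 Z, M.exp W * M.exp (-Z) ∈ M.chart.source := by
    have h : Tendsto (fun q : E × E => M.exp q.1 * M.exp (-q.2)) (𝓝 (0, 0)) (𝓝 1) := by
      have h1 : Tendsto (fun q : E × E => M.exp q.1) (𝓝 (0, 0)) (𝓝 1) :=
        M.tendsto_exp.comp (Continuous.tendsto' (by fun_prop) _ _ (by simp))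
      have h2 : Tendsto (fun q : E × E => M.exp (-q.2)) (𝓝 (0, 0)) (𝓝 1) :=
        M.tendsto_exp.comp (Continuous.tendsto' (by fun_prop) _ _ (by simp))
      simpa using h1.mul h2
    have h3 := (h.eventually (M.source_mem_nhds M.one_mem)).eventually_nhds
    have h4 : Tendsto (fun Z : E => (Z, Z)) (𝓝 0) (𝓝 (0, 0)) :=
      Continuous.tendsto' (by fun_prop) _ _ rfl
    filter_upwards [h4.eventually h3] with Z hZ
    have h5 : Tendsto (fun W : E => (W, Z)) (𝓝 Z) (𝓝 (Z, Z)) :=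
      Continuous.tendsto' (by fun_prop) _ _ rfl
    exact h5.eventually hZ
  have hdiff : ∀ᶠ Z in 𝓝 (0 : E), DifferentiableAt ℝ M.mul (0, M.chart (M.exp Z)) := by
    have : Tendsto (fun Z : E => ((0 : E), M.chart (M.exp Z))) (𝓝 0) (𝓝 0) :=
      tendsto_const_nhds.prodMk_nhds M.tendsto_chart_exp
    exact this.eventually M.eventually_differentiableAt
  have key : ∀ᶠ Z in 𝓝 (0 : E), HasFDerivAt (fun Z => M.chart (M.exp Z))
      ((M.right (M.chart (M.exp Z))).comp (expInt (M.ad Z) 1)) Z := by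
    filter_upwards [hmul, hdiff, M.eventually_hasFDerivAt_exp_mul_mul_exp_neg,
      M.eventually_exp_mem_source] with Z h1 h2 h3 h4
    have h5 := M.hasFDerivAt_exp_mul_exp_neg h3
    have h6 : HasFDerivAt (fun W => M.mul (M.chart (M.exp W * M.exp (-Z)), M.chart (M.exp Z)))
        ((M.right (M.chart (M.exp Z))).comp (expInt (M.ad Z) 1)) Z := by
      have h7 : HasFDerivAt M.mul (fderiv ℝ M.mul (0, M.chart (M.exp Z)))
          (M.chart (M.exp Z * M.exp (-Z)), M.chart (M.exp Z)) := by
        simpa [M.exp_neg, M.map_one] using h2.hasFDerivAt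
      have h8 := HasFDerivAt.comp (g := M.mul)
        (f := fun W => (M.chart (M.exp W * M.exp (-Z)), M.chart (M.exp Z))) Z h7
        (h5.prodMk (hasFDerivAt_const _ _))
      convert! h8 using 1
    refine h6.congr_of_eventuallyEq ?_
    filter_upwards [h1] with W hW
    simp only [GroupChart.mul]
    rw [M.chart.left_inv hW, M.chart.left_inv h4, M.exp_neg, inv_mul_cancel_right]
  have hcont : ContinuousAt
      (fun Z => (M.right (M.chart (M.exp Z))).comp (expInt (M.ad Z) 1)) 0 := by
    refine ContinuousAt.clm_comp ?_ ?_
    · have : ContinuousAt M.right (M.chart (M.exp 0)) := by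
        rw [M.exp_zero, M.map_one]; exact M.contDiffAt_right.continuousAt
      refine ContinuousAt.comp (g := M.right) this ?_
      rw [ContinuousAt, M.exp_zero, M.map_one]
      exact M.tendsto_chart_exp
    · exact (continuous_expInt_one.comp M.ad.continuous).continuousAt
  have := hasStrictFDerivAt_of_hasFDerivAt_of_continuousAt key hcont
  simpa [M.exp_zero, M.map_one, M.right_zero, expInt_zero_one, ContinuousLinearMap.one_def]
    using this

/-- The exponential map is a local homeomorphism at `0`. -/
theorem exists_openPartialHomeomorph_exp :
    ∃ e : OpenPartialHomeomorph E G, 0 ∈ e.source ∧ EqOn e M.exp e.source := by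
  have h : HasStrictFDerivAt (fun Z => M.chart (M.exp Z))
    ((ContinuousLinearEquiv.refl ℝ E : E ≃L[ℝ] E) : E →L[ℝ] E) 0 := M.hasStrictFDerivAt_chart_exp
  let e := (h.toOpenPartialHomeomorph _).trans M.chart.symm
  obtain ⟨U, hU, hUo, h0⟩ := mem_nhds_iff.1 M.eventually_exp_mem_source
  refine ⟨e.restrOpen U hUo, ?_, ?_⟩
  · rw [OpenPartialHomeomorph.restrOpen_source]
    refine ⟨?_, h0⟩
    rw [OpenPartialHomeomorph.trans_source]
    refine ⟨h.mem_toOpenPartialHomeomorph_source, ?_⟩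
    simpa [M.exp_zero, M.map_one] using M.zero_mem_target
  · intro Z hZ
    rw [OpenPartialHomeomorph.restrOpen_source] at hZ
    exact M.chart.left_inv (hU hZ.2)

end ExpChart

/-! ### The Baker-Campbell-Hausdorff formula with remainder. -/

/-- The Baker-Campbell-Hausdorff product of a bracket `ad`, in integral form and truncated at
order `K`. -/
noncomputable def bchInt {E : Type*} [NormedAddCommGroup E] [NormedSpace ℝ E]
    (ad : E →L[ℝ] E →L[ℝ] E) (K : ℕ) (X Y : E) : E :=
  ∫ t in (0 : ℝ)..1,
    logTrunc K (NormedSpace.exp (t • ad X) * NormedSpace.exp (t • ad Y) - 1)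
      (X + NormedSpace.exp (t • ad X) Y)

namespace ExpChart

variable {E G : Type*} [NormedAddCommGroup E] [NormedSpace ℝ E] [CompleteSpace E]
  [TopologicalSpace G] [Group G] [IsTopologicalGroup G] (M : ExpChart E G)

/-- The exponential map is differentiable at `Z`, and the estimates needed for the
Baker-Campbell-Hausdorff formula hold at `Z`. -/
structure IsSmall (Z : E) : Prop where
  hasFDerivAt : HasFDerivAt
      (fun p : E × E => M.chart (M.exp (Z + p.2) * M.chart.symm p.1 * M.exp (-Z)))
      ((NormedSpace.exp (M.ad Z)).coprod (expInt (M.ad Z) 1)) 0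
  isUnit : IsUnit (expInt (M.ad Z) 1)
  norm_expInt : ‖1 - expInt (M.ad Z) 1‖ ≤ 1 / 2
  norm_exp : ‖NormedSpace.exp (M.ad Z)‖ ≤ 2
  norm_exp_sub_one : ∀ s ∈ Icc (0 : ℝ) 1, ‖NormedSpace.exp (s • M.ad Z) - 1‖ ≤ 2 * ‖M.ad Z‖

theorem eventually_isSmall : ∀ᶠ Z in 𝓝 (0 : E), M.IsSmall Z := by
  have h1 : ∀ᶠ Z in 𝓝 (0 : E), IsUnit (expInt (M.ad Z) 1) :=
    M.tendsto_expInt_ad.eventually (Units.isOpen.mem_nhds isUnit_one)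
  have h2 : ∀ᶠ Z in 𝓝 (0 : E), ‖1 - expInt (M.ad Z) 1‖ < 1 / 2 := by
    have := M.tendsto_expInt_ad.eventually (Metric.ball_mem_nhds 1 (show (0 : ℝ) < 1 / 2 by norm_num))
    filter_upwards [this] with Z hZ
    rwa [← dist_eq_norm, dist_comm]
  obtain ⟨r, hr, H⟩ := exists_norm_exp_sub_one_le (A := E →L[ℝ] E)
  have h3 : ∀ᶠ Z in 𝓝 (0 : E), ‖M.ad Z‖ < min r (1 / 2) := by
    have : Tendsto (fun Z => ‖M.ad Z‖) (𝓝 0) (𝓝 0) :=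
      Continuous.tendsto' (by fun_prop) _ _ (by simp)
    exact this.eventually (gt_mem_nhds (by positivity))
  filter_upwards [M.eventually_hasFDerivAt_exp_mul_mul_exp_neg, h1, h2, h3] with Z e0 e1 e2 e3
  have e4 : ∀ s ∈ Icc (0 : ℝ) 1, ‖NormedSpace.exp (s • M.ad Z) - 1‖ ≤ 2 * ‖M.ad Z‖ := by
    intro s hs
    have hs1 : ‖s • M.ad Z‖ ≤ ‖M.ad Z‖ := by
      rw [norm_smul, Real.norm_eq_abs, abs_of_nonneg hs.1]
      exact mul_le_of_le_one_left (norm_nonneg _) hs.2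
    have := H _ (hs1.trans_lt (e3.trans_le (min_le_left _ _)))
    linarith
  refine ⟨e0, e1, e2.le, ?_, e4⟩
  have h5 := e4 1 (by simp)
  rw [one_smul] at h5
  have hone : ‖(1 : E →L[ℝ] E)‖ ≤ 1 := ContinuousLinearMap.norm_id_le
  have h6 := e3.trans_le (min_le_right _ _)
  calc ‖NormedSpace.exp (M.ad Z)‖ = ‖(NormedSpace.exp (M.ad Z) - 1) + 1‖ := by
        rw [sub_add_cancel]
    _ ≤ _ := norm_add_le _ _
    _ ≤ 2 := by linarith

theorem tendsto_conj_group (Z : E) :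
    Tendsto (fun y : E => M.exp Z * M.chart.symm y * M.exp (-Z)) (𝓝 0) (𝓝 1) := by
  have h1 : Tendsto M.chart.symm (𝓝 0) (𝓝 1) := by
    have := M.chart.symm.continuousAt M.zero_mem_target
    rwa [ContinuousAt, M.symm_zero] at this
  simpa [M.exp_neg] using (tendsto_const_nhds (x := M.exp Z)).mul h1 |>.mul
    (tendsto_const_nhds (x := M.exp (-Z)))

/-- Here exp(ad A) is the derivative at the identity of conjugation by exp A; conjugation by a
product is the composition of the conjugations, and derivatives are unique. -/
theorem exp_ad_eq_mul {A B Z : E} (hA : M.IsSmall A) (hB : M.IsSmall B) (hZ : M.IsSmall Z)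
    (h : M.exp Z = M.exp A * M.exp B) :
    NormedSpace.exp (M.ad Z) = NormedSpace.exp (M.ad A) * NormedSpace.exp (M.ad B) := by
  have dZ := M.hasFDerivAt_conj hZ.hasFDerivAt
  have dA := M.hasFDerivAt_conj hA.hasFDerivAt
  have dB := M.hasFDerivAt_conj hB.hasFDerivAt
  have h0 : M.chart (M.exp B * M.chart.symm 0 * M.exp (-B)) = 0 := by
    simp [M.symm_zero, M.exp_neg, M.map_one]
  rw [← h0] at dA
  refine dZ.unique ((HasFDerivAt.comp (0 : E) dA dB).congr_of_eventuallyEq ?_)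
  filter_upwards [(M.tendsto_conj_group B).eventually (M.source_mem_nhds M.one_mem)] with y hy
  simp only [Function.comp]
  rw [M.chart.left_inv hy]
  simp only [M.exp_neg, h, mul_inv_rev, mul_assoc]

variable {e : OpenPartialHomeomorph E G}

/-- With Z = Z(t), exp((t+τ)X) exp((t+τ)Y) = exp(τX) · (exp(tX) exp(τY) exp(-tX)) · exp Z. In the
chart, the product of the factors before exp Z has derivative X + e^{t ad X} Y at τ = 0. The map y ↦
log(y exp Z) is a local inverse of W ↦ exp W exp(-Z), whose derivative at Z is the invertible map
`expInt (ad Z) 1`. -/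
theorem hasDerivAt_log_exp_mul_exp (he : EqOn e M.exp e.source) {X Y : E} {t : ℝ} (hX : M.IsSmall (t • X))
    (hZ : M.IsSmall (e.symm (M.exp (t • X) * M.exp (t • Y))))
    (hmem : M.exp (t • X) * M.exp (t • Y) ∈ e.target) :
    ∃ Z' : E, HasDerivAt (fun t : ℝ => e.symm (M.exp (t • X) * M.exp (t • Y))) Z' t ∧
      expInt (M.ad (e.symm (M.exp (t • X) * M.exp (t • Y)))) 1 Z' =
        X + NormedSpace.exp (t • M.ad X) Y := by
  set Z := e.symm (M.exp (t • X) * M.exp (t • Y)) with hZdef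
  have hZs : Z ∈ e.source := e.map_target hmem
  have hexpZ : M.exp Z = M.exp (t • X) * M.exp (t • Y) := by
    rw [← he hZs, hZdef, e.right_inv hmem]
  obtain ⟨u, hu⟩ := hZ.isUnit
  let u' : E ≃L[ℝ] E := ContinuousLinearEquiv.ofUnit u
  have hu' : (u' : E →L[ℝ] E) = expInt (M.ad Z) 1 := by rw [← hu]; rfl
  -- the logarithm in the chart
  let l : E → E := fun y => e.symm (M.chart.symm y * M.exp Z)
  have hl0 : l 0 = Z := by simp only [l, M.symm_zero, one_mul, hexpZ, ← hZdef]
  have hsymm : Tendsto M.chart.symm (𝓝 0) (𝓝 1) := by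
    have := M.chart.symm.continuousAt M.zero_mem_target
    rwa [ContinuousAt, M.symm_zero] at this
  have hprod : Tendsto (fun y => M.chart.symm y * M.exp Z) (𝓝 0) (𝓝 (M.exp Z)) := by
    simpa using hsymm.mul (tendsto_const_nhds (x := M.exp Z))
  have hmem' : M.exp Z ∈ e.target := by rw [hexpZ]; exact hmem
  have hl : ContinuousAt l 0 := by
    have h1 := (e.symm.continuousAt (x := M.exp Z) hmem').tendsto.comp hprod
    rw [ContinuousAt]
    simpa [l, M.symm_zero, Function.comp_def] using h1
  have hdl : HasFDerivAt l (u'.symm : E →L[ℝ] E) 0 := by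
    refine HasFDerivAt.of_local_left_inverse
      (f := fun W : E => M.chart (M.exp W * M.exp (-Z))) hl ?_ ?_
    · rw [hl0, hu']; exact M.hasFDerivAt_exp_mul_exp_neg hZ.hasFDerivAt
    · filter_upwards [hprod.eventually (e.open_target.mem_nhds hmem'),
        M.target_mem_nhds M.zero_mem_target] with y h1 h2
      simp only [l]
      rw [← he (e.map_target h1), e.right_inv h1, M.exp_neg, mul_inv_cancel_right,
        M.chart.right_inv h2]
  -- the increment of the product
  let F : E → E := fun y => M.chart (M.exp (t • X) * M.chart.symm y * M.exp (-(t • X)))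
  have hF : HasFDerivAt F (NormedSpace.exp (M.ad (t • X))) 0 := M.hasFDerivAt_conj hX.hasFDerivAt
  let κ : ℝ → E := fun τ => M.mul (M.chart (M.exp (τ • X)), F (M.chart (M.exp (τ • Y))))
  have hF0 : F 0 = 0 := by simp [F, M.symm_zero, M.exp_neg, M.map_one]
  have hκ : HasDerivAt κ (X + NormedSpace.exp (t • M.ad X) Y) 0 := by
    have h1 : HasDerivAt (fun τ : ℝ => F (M.chart (M.exp (τ • Y))))
        (NormedSpace.exp (M.ad (t • X)) Y) 0 := by
      have : HasFDerivAt F (NormedSpace.exp (M.ad (t • X))) (M.chart (M.exp ((0 : ℝ) • Y))) := by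
        simpa [M.exp_zero, M.map_one] using hF
      exact this.comp_hasDerivAt (0 : ℝ) (M.hasDerivAt_exp Y)
    have h2 : HasFDerivAt M.mul (fderiv ℝ M.mul (0, 0))
        (M.chart (M.exp ((0 : ℝ) • X)), F (M.chart (M.exp ((0 : ℝ) • Y)))) := by
      rw [zero_smul, zero_smul, M.exp_zero, M.map_one, hF0]
      exact M.eventually_differentiableAt.self_of_nhds.hasFDerivAt
    have h3 := HasFDerivAt.comp_hasDerivAt (0 : ℝ) h2 ((M.hasDerivAt_exp X).prodMk h1)
    have e1 : fderiv ℝ M.mul (0, 0) (X, NormedSpace.exp (M.ad (t • X)) Y) =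
        X + NormedSpace.exp (t • M.ad X) Y := by
      have : (X, NormedSpace.exp (M.ad (t • X)) Y) =
        (X, (0 : E)) + ((0 : E), NormedSpace.exp (M.ad (t • X)) Y) := by simp
      rw [this, map_add, M.fderiv_mul_zero_left M.zero_mem_target
        M.eventually_differentiableAt.self_of_nhds, M.fderiv_mul_zero_right M.zero_mem_target
        M.eventually_differentiableAt.self_of_nhds, map_smul]
    rw [e1] at h3
    exact h3
  have hκ0 : κ 0 = 0 := by
    simp [κ, M.exp_zero, M.map_one, hF0, M.mul_zero_left M.zero_mem_target]
  refine ⟨u'.symm (X + NormedSpace.exp (t • M.ad X) Y), ?_, ?_⟩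
  · have h1 : HasDerivAt (fun τ => l (κ τ)) (u'.symm (X + NormedSpace.exp (t • M.ad X) Y)) 0 := by
      rw [← hκ0] at hdl
      exact hdl.comp_hasDerivAt (0 : ℝ) hκ
    rw [← sub_self t] at h1
    refine (h1.comp_sub_const t t).congr_of_eventuallyEq ?_
    have hsub : Tendsto (fun τ : ℝ => τ - t) (𝓝 t) (𝓝 0) :=
      Continuous.tendsto' (by fun_prop) _ _ (by simp)
    have hex : Tendsto (fun τ : ℝ => M.chart (M.exp (τ • Y))) (𝓝 0) (𝓝 0) :=
      M.tendsto_chart_exp.comp (Continuous.tendsto' (by fun_prop) _ _ (by simp))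
    have hc : Tendsto (fun τ : ℝ => M.exp (t • X) * M.chart.symm (M.chart (M.exp (τ • Y))) *
        M.exp (-(t • X))) (𝓝 0) (𝓝 1) := (M.tendsto_conj_group (t • X)).comp hex
    have hp : Tendsto (fun τ : ℝ => M.exp (τ • X) * (M.exp (t • X) *
        M.chart.symm (M.chart (M.exp (τ • Y))) * M.exp (-(t • X)))) (𝓝 0) (𝓝 1) := by
      simpa using (M.tendsto_exp_smul X).mul hc
    have hev : ∀ᶠ τ in 𝓝 (0 : ℝ), e.symm (M.exp ((t + τ) • X) * M.exp ((t + τ) • Y)) = l (κ τ) := by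
      have hs := M.source_mem_nhds M.one_mem
      filter_upwards [hc.eventually hs, hp.eventually hs, (M.tendsto_exp_smul X).eventually hs,
        (M.tendsto_exp_smul Y).eventually hs] with τ a1 a2 a3 a4
      simp only [l, κ, F, GroupChart.mul]
      rw [M.chart.left_inv a3, M.chart.left_inv a1, M.chart.left_inv a2, M.chart.left_inv a4,
        hexpZ, add_comm t τ, M.exp_add_smul X, M.exp_add_smul Y, M.exp_neg]
      congr 1
      group
    filter_upwards [hsub.eventually hev] with τ hτ
    rw [← hτ, add_sub_cancel]
  · have := u'.apply_symm_apply (X + NormedSpace.exp (t • M.ad X) Y)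
    rw [← hu']
    exact this

theorem norm_pow_le_of_norm_le {a : E →L[ℝ] E} {c : ℝ} (h : ‖a‖ ≤ c) (K : ℕ) :
    ‖a ^ K‖ ≤ c ^ K := by
  have hc : 0 ≤ c := (norm_nonneg _).trans h
  induction K with
  | zero => rw [pow_zero, pow_zero]; exact ContinuousLinearMap.norm_id_le
  | succ K ih =>
    rw [pow_succ, pow_succ]
    exact (norm_mul_le _ _).trans (mul_le_mul ih h (norm_nonneg _) (by positivity))

/-- The Baker-Campbell-Hausdorff formula with remainder. -/
theorem exists_norm_log_sub_bchInt_le (h0 : 0 ∈ e.source) (he : EqOn e M.exp e.source) (K : ℕ) :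
    ∃ r > 0, ∃ C : ℝ, 0 ≤ C ∧ ∀ X Y : E, ‖X‖ < r → ‖Y‖ < r →
      ‖e.symm (M.exp X * M.exp Y) - bchInt M.ad K X Y‖ ≤ C * (‖X‖ + ‖Y‖) ^ (K + 1) := by
  have he0 : e 0 = 1 := by rw [he h0, M.exp_zero]
  have h1t : (1 : G) ∈ e.target := by rw [← he0]; exact e.map_source h0
  have hs1 : e.symm 1 = 0 := by rw [← he0, e.left_inv h0]
  have hprod : Tendsto (fun q : E × E => M.exp q.1 * M.exp q.2) (𝓝 0) (𝓝 1) := by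
    have t1 : Tendsto (fun q : E × E => M.exp q.1) (𝓝 0) (𝓝 1) :=
      M.tendsto_exp.comp (Continuous.tendsto' (by fun_prop) _ _ (by simp))
    have t2 : Tendsto (fun q : E × E => M.exp q.2) (𝓝 0) (𝓝 1) :=
      M.tendsto_exp.comp (Continuous.tendsto' (by fun_prop) _ _ (by simp))
    simpa using t1.mul t2
  have hlog : Tendsto (fun q : E × E => e.symm (M.exp q.1 * M.exp q.2)) (𝓝 0) (𝓝 0) := by
    have := (e.symm.continuousAt (x := 1) h1t).tendsto
    rw [hs1] at this
    exact this.comp hprod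
  have hfst : Tendsto (fun q : E × E => q.1) (𝓝 0) (𝓝 0) :=
    Continuous.tendsto' (by fun_prop) _ _ (by simp)
  have hsnd : Tendsto (fun q : E × E => q.2) (𝓝 0) (𝓝 0) :=
    Continuous.tendsto' (by fun_prop) _ _ (by simp)
  obtain ⟨r, hr, H⟩ := Metric.eventually_nhds_iff.1
    (((hfst.eventually M.eventually_isSmall).and (hsnd.eventually M.eventually_isSmall)).and
    ((hlog.eventually M.eventually_isSmall).and
      (hprod.eventually (e.open_target.mem_nhds h1t))))
  refine ⟨r, hr, (2 * (‖M.ad‖ * 4)) ^ K * 4, by positivity, fun X Y hX hY => ?_⟩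
  set N := ‖X‖ + ‖Y‖ with hN
  have hN0 : 0 ≤ N := by positivity
  let Z : ℝ → E := fun t => e.symm (M.exp (t • X) * M.exp (t • Y))
  have good : ∀ t ∈ Icc (0 : ℝ) 1, (M.IsSmall (t • X) ∧ M.IsSmall (t • Y)) ∧
      M.IsSmall (Z t) ∧ M.exp (t • X) * M.exp (t • Y) ∈ e.target := by
    intro t ht
    have ht1 : ∀ W : E, ‖t • W‖ ≤ ‖W‖ := fun W => by
      rw [norm_smul, Real.norm_eq_abs, abs_of_nonneg ht.1]
      exact mul_le_of_le_one_left (norm_nonneg _) ht.2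
    refine @H (t • X, t • Y) ?_
    rw [dist_zero_right, Prod.norm_mk]
    exact max_lt ((ht1 X).trans_lt hX) ((ht1 Y).trans_lt hY)
  have hex : ∀ t ∈ Icc (0 : ℝ) 1, ∃ Z' : E, HasDerivAt Z Z' t ∧
      expInt (M.ad (Z t)) 1 Z' = X + NormedSpace.exp (t • M.ad X) Y := fun t ht =>
    M.hasDerivAt_log_exp_mul_exp he (good t ht).1.1 (good t ht).2.1 (good t ht).2.2
  choose! Z' hZ' hEZ' using hex
  -- Z' is the sum of (1 - expInt(ad Z)) Z', of norm at most ‖Z'‖/2, and X + e^{t ad X} Y, of norm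
  -- at most ‖X‖ + 2‖Y‖; hence ‖Z'‖ ≤ 4N.
  have hZ'b : ∀ t ∈ Icc (0 : ℝ) 1, ‖Z' t‖ ≤ 4 * N := by
    intro t ht
    have g := (good t ht).2.1.norm_expInt
    have gX := (good t ht).1.1.norm_exp
    rw [map_smul] at gX
    have b1 := (NormedSpace.exp (t • M.ad X)).le_of_opNorm_le gX Y
    have b2 := (1 - expInt (M.ad (Z t)) 1).le_of_opNorm_le g (Z' t)
    have b3 : Z' t = (1 - expInt (M.ad (Z t)) 1) (Z' t) + (X + NormedSpace.exp (t • M.ad X) Y) := by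
      rw [← hEZ' t ht]; simp
    have b4 : ‖Z' t‖ ≤ ‖(1 - expInt (M.ad (Z t)) 1) (Z' t)‖ +
        (‖X‖ + ‖NormedSpace.exp (t • M.ad X) Y‖) := by
      conv_lhs => rw [b3]
      exact (norm_add_le _ _).trans (add_le_add le_rfl (norm_add_le _ _))
    rw [hN]
    linarith [norm_nonneg X]
  have hZ0 : Z 0 = 0 := by simp [Z, M.exp_zero, hs1]
  have hZb : ∀ t ∈ Icc (0 : ℝ) 1, ‖Z t‖ ≤ 4 * N := by
    intro t ht
    have := norm_image_sub_le_of_norm_deriv_le_segment' (f := Z) (f' := Z') (C := 4 * N)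
      (a := 0) (b := 1) (fun s hs => (hZ' s hs).hasDerivWithinAt)
      (fun s hs => hZ'b s (Ico_subset_Icc_self hs)) t ht
    rw [hZ0, sub_zero, sub_zero] at this
    exact this.trans (mul_le_of_le_one_right (by positivity) ht.2)
  let f : ℝ → E := fun t =>
    logTrunc K (NormedSpace.exp (t • M.ad X) * NormedSpace.exp (t • M.ad Y) - 1)
      (X + NormedSpace.exp (t • M.ad X) Y)
  have hf : Continuous f := by
    have c1 : Continuous fun t : ℝ => NormedSpace.exp (t • M.ad X) :=
      Continuous.exp_of_real (by fun_prop)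
    have c2 : Continuous fun t : ℝ => NormedSpace.exp (t • M.ad Y) :=
      Continuous.exp_of_real (by fun_prop)
    simp only [f, logTrunc]
    fun_prop
  have hdiff := norm_image_sub_le_of_norm_deriv_le_segment_01'
    (f := fun t => Z t - ∫ u in (0 : ℝ)..t, f u) (f' := fun t => Z' t - f t)
    (C := (2 * (‖M.ad‖ * 4)) ^ K * 4 * N ^ (K + 1))
    (fun t ht => ((hZ' t ht).sub (hasDerivAt_integral_of_continuous hf t)).hasDerivWithinAt)
    (fun t ht => ?_)
  · simpa [hZ0, Z, f, bchInt] using hdiff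
  · have ht' := Ico_subset_Icc_self ht
    have g := good t ht'
    have hZt : M.exp (Z t) = M.exp (t • X) * M.exp (t • Y) := by
      rw [← he (e.map_target g.2.2), e.right_inv g.2.2]
    have hw := M.exp_ad_eq_mul g.1.1 g.1.2 g.2.1 hZt
    rw [map_smul, map_smul] at hw
    -- After e^{t ad X} e^{t ad Y} is replaced by e^{ad Z} and X + e^{t ad X} Y by expInt(ad Z) Z',
    -- the identity `logTrunc_mul_expInt` leaves Z' minus a remainder of order K in ad Z, applied to
    -- Z'.
    have hft : f t = Z' t - (∫ s in (0 : ℝ)..1, (-(NormedSpace.exp (s • M.ad (Z t)) - 1)) ^ K)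
        (Z' t) := by
      simp only [f]
      rw [← hw, ← hEZ' t ht', ← mul_apply_eq_comp, logTrunc_mul_expInt]
      simp
    rw [hft, sub_sub_cancel]
    have hadZ : ‖M.ad (Z t)‖ ≤ ‖M.ad‖ * (4 * N) :=
      (M.ad.le_opNorm _).trans (mul_le_mul_of_nonneg_left (hZb t ht') (norm_nonneg _))
    have hint : ‖∫ s in (0 : ℝ)..1, (-(NormedSpace.exp (s • M.ad (Z t)) - 1)) ^ K‖ ≤
        (2 * (‖M.ad‖ * (4 * N))) ^ K := by
      have := intervalIntegral.norm_integral_le_of_norm_le_const (a := 0) (b := 1)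
        (f := fun s : ℝ => (-(NormedSpace.exp (s • M.ad (Z t)) - 1)) ^ K)
        (C := (2 * (‖M.ad‖ * (4 * N))) ^ K) (fun s hs => ?_)
      · simpa using this
      · rw [uIoc_of_le zero_le_one] at hs
        have hb : ‖-(NormedSpace.exp (s • M.ad (Z t)) - 1)‖ ≤ 2 * (‖M.ad‖ * (4 * N)) := by
          rw [norm_neg]
          exact (g.2.1.norm_exp_sub_one s (Ioc_subset_Icc_self hs)).trans (by linarith)
        exact norm_pow_le_of_norm_le hb K
    refine (ContinuousLinearMap.le_of_opNorm_le _ hint _).trans ?_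
    calc (2 * (‖M.ad‖ * (4 * N))) ^ K * ‖Z' t‖ ≤ (2 * (‖M.ad‖ * (4 * N))) ^ K * (4 * N) := by
          gcongr; exact hZ'b t ht'
      _ = _ := by
        rw [show 2 * (‖M.ad‖ * (4 * N)) = 2 * (‖M.ad‖ * 4) * N by ring, mul_pow]; ring

end ExpChart

/-! ### The chart of a Lie group at the identity -/

section LieChart

variable {E : Type*} [NormedAddCommGroup E] [NormedSpace ℝ E]
  {G : Type*} [TopologicalSpace G] [ChartedSpace E G] [Group G]

variable (E G) in
/-- The preferred chart at the identity, translated so that the identity is sent to `0`. -/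
noncomputable def chartOne : OpenPartialHomeomorph G E :=
  (chartAt E (1 : G)).transHomeomorph (Homeomorph.subRight (chartAt E (1 : G) 1))

theorem chartOne_apply (g : G) : chartOne E G g = chartAt E (1 : G) g - chartAt E (1 : G) 1 := rfl

theorem chartOne_symm_apply (x : E) :
    (chartOne E G).symm x = (chartAt E (1 : G)).symm (x + chartAt E (1 : G) 1) := rfl

theorem one_mem_chartOne_source : (1 : G) ∈ (chartOne E G).source := mem_chart_source E (1 : G)

theorem chartOne_one : chartOne E G 1 = 0 := sub_self _

theorem mem_chartOne_target {x : E} (hx : x ∈ (chartOne E G).target) :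
    x + chartAt E (1 : G) 1 ∈ (chartAt E (1 : G)).target := hx

theorem zero_mem_chartOne_target : (0 : E) ∈ (chartOne E G).target := by
  rw [← chartOne_one (E := E) (G := G)]
  exact (chartOne E G).map_source one_mem_chartOne_source

theorem chartOne_symm_zero : (chartOne E G).symm 0 = 1 := by
  rw [← chartOne_one (E := E) (G := G), (chartOne E G).left_inv one_mem_chartOne_source]

variable [LieGroup 𝓘(ℝ, E) ∞ G]

theorem contMDiffAt_chartOne {g : G} (hg : g ∈ (chartOne E G).source) :
    ContMDiffAt 𝓘(ℝ, E) 𝓘(ℝ, E) ∞ (chartOne E G) g := by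
  have h1 : ContMDiffAt 𝓘(ℝ, E) 𝓘(ℝ, E) ∞ (chartAt E (1 : G)) g :=
    contMDiffAt_of_mem_maximalAtlas (IsManifold.chart_mem_maximalAtlas 1) hg
  exact h1.sub contMDiffAt_const

theorem contMDiffAt_chartOne_symm {x : E} (hx : x ∈ (chartOne E G).target) :
    ContMDiffAt 𝓘(ℝ, E) 𝓘(ℝ, E) ∞ (chartOne E G).symm x := by
  have h1 : ContMDiffAt 𝓘(ℝ, E) 𝓘(ℝ, E) ∞ (chartAt E (1 : G)).symm (x + chartAt E (1 : G) 1) :=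
    contMDiffAt_symm_of_mem_maximalAtlas (IsManifold.chart_mem_maximalAtlas 1)
      (mem_chartOne_target hx)
  have h2 : ContMDiffAt 𝓘(ℝ, E) 𝓘(ℝ, E) ∞ (fun x : E => x + chartAt E (1 : G) 1) x :=
    (contDiff_id.add contDiff_const).contMDiff.contMDiffAt
  exact ContMDiffAt.comp (g := (chartAt E (1 : G)).symm)
    (f := fun x : E => x + chartAt E (1 : G) 1) x h1 h2

/-- The tangent space at 1 is read in the preferred chart at 1, so the differential of that chart at
1 is the identity. This is why the Lie algebra and the model space can be identified without any
linear change of coordinates. -/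
theorem hasMFDerivAt_chartOne :
    HasMFDerivAt 𝓘(ℝ, E) 𝓘(ℝ, E) (chartOne E G) (1 : G) (ContinuousLinearMap.id ℝ E) := by
  have : IsManifold 𝓘(ℝ, E) 1 G := IsManifold.of_le (n := ∞) (by exact_mod_cast le_top)
  have h1 := (mdifferentiableAt_extChartAt (I := 𝓘(ℝ, E))
    (mem_chart_source E (1 : G))).hasMFDerivAt
  rw [mfderiv_extChartAt_self] at h1
  have h2 := h1.sub (hasMFDerivAt_const (chartAt E (1 : G) 1) (1 : G))
  refine (h2.congr_of_eventuallyEq ?_).congr_mfderiv ?_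
  · filter_upwards with g
    simp [chartOne_apply]
  · exact sub_zero (ContinuousLinearMap.id ℝ E)

theorem hasMFDerivAt_chartOne_symm :
    HasMFDerivAt 𝓘(ℝ, E) 𝓘(ℝ, E) (chartOne E G).symm (0 : E) (ContinuousLinearMap.id ℝ E) := by
  have : IsManifold 𝓘(ℝ, E) 1 G := IsManifold.of_le (n := ∞) (by exact_mod_cast le_top)
  have h1 := ((contMDiffAt_chartOne_symm (G := G)
    (zero_mem_chartOne_target (E := E))).mdifferentiableAt (by simp)).hasMFDerivAt
  have h2 : HasMFDerivAt 𝓘(ℝ, E) 𝓘(ℝ, E) (chartOne E G) ((chartOne E G).symm 0)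
      (ContinuousLinearMap.id ℝ E) := by
    rw [chartOne_symm_zero]; exact hasMFDerivAt_chartOne
  have h3 := h2.comp (0 : E) h1
  have h4 : HasMFDerivAt 𝓘(ℝ, E) 𝓘(ℝ, E) (chartOne E G ∘ (chartOne E G).symm) (0 : E)
      (ContinuousLinearMap.id ℝ E) := by
    refine (hasMFDerivAt_id (0 : E)).congr_of_eventuallyEq ?_
    filter_upwards [(chartOne E G).open_target.mem_nhds zero_mem_chartOne_target] with x hx
    exact (chartOne E G).right_inv hx
  have h5 := hasMFDerivAt_unique h3 h4
  exact h1.congr_mfderiv h5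

theorem contDiffAt_chartOne_mul :
    ContDiffAt ℝ ∞ (fun p : E × E =>
      chartOne E G ((chartOne E G).symm p.1 * (chartOne E G).symm p.2)) 0 := by
  rw [← contMDiffAt_iff_contDiffAt]
  have h1 : ContMDiffAt 𝓘(ℝ, E × E) 𝓘(ℝ, E) ∞ (fun p : E × E => (chartOne E G).symm p.1) 0 :=
    ContMDiffAt.comp (g := (chartOne E G).symm) (f := fun p : E × E => p.1) (0 : E × E)
      (contMDiffAt_chartOne_symm zero_mem_chartOne_target) contDiff_fst.contMDiff.contMDiffAt
  have h2 : ContMDiffAt 𝓘(ℝ, E × E) 𝓘(ℝ, E) ∞ (fun p : E × E => (chartOne E G).symm p.2) 0 :=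
    ContMDiffAt.comp (g := (chartOne E G).symm) (f := fun p : E × E => p.2) (0 : E × E)
      (contMDiffAt_chartOne_symm zero_mem_chartOne_target) contDiff_snd.contMDiff.contMDiffAt
  refine ContMDiffAt.comp (g := chartOne E G)
    (f := fun p : E × E => (chartOne E G).symm p.1 * (chartOne E G).symm p.2) (0 : E × E)
    (contMDiffAt_chartOne ?_) (h1.mul h2)
  simp only [Prod.fst_zero, Prod.snd_zero, chartOne_symm_zero, mul_one]
  exact one_mem_chartOne_source

variable (E G) in
/-- The chart at the identity of a Lie group. -/
noncomputable def lieGroupChart : GroupChart E G where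
  chart := chartOne E G
  one_mem := one_mem_chartOne_source
  map_one := chartOne_one
  contDiffAt_mul := contDiffAt_chartOne_mul.of_le (by norm_cast)

/-- In the chart, the left-invariant vector fields are given by `GroupChart.left`. -/
theorem mfderiv_chartOne_symm_comp_left {x : E} (hx : x ∈ (chartOne E G).target)
    (hd : DifferentiableAt ℝ (lieGroupChart E G).mul (x, 0)) :
    (mfderiv 𝓘(ℝ, E) 𝓘(ℝ, E) (chartOne E G).symm x : E →L[ℝ] E).comp
        ((lieGroupChart E G).left x) =
      (mfderiv 𝓘(ℝ, E) 𝓘(ℝ, E) (fun h : G => (chartOne E G).symm x * h) 1 : E →L[ℝ] E) := by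
  have : IsTopologicalGroup G := topologicalGroup_of_lieGroup 𝓘(ℝ, E) ∞
  set g := (chartOne E G).symm x with hg
  have hs : (chartOne E G).symm 0 = 1 := (lieGroupChart E G).symm_zero
  -- the derivative of the product in the chart
  have h1 : HasFDerivAt (fun y : E => (lieGroupChart E G).mul (x, y)) ((lieGroupChart E G).left x) 0 :=
    hd.hasFDerivAt.comp (0 : E) (hasFDerivAt_prodMk_right x (0 : E))
  have hm0 : (lieGroupChart E G).mul (x, 0) = x := (lieGroupChart E G).mul_zero_right hx
  have h2 := ((contMDiffAt_chartOne_symm (G := G) hx).mdifferentiableAt (by simp)).hasMFDerivAt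
  have h2' : HasMFDerivAt 𝓘(ℝ, E) 𝓘(ℝ, E) (chartOne E G).symm ((lieGroupChart E G).mul (x, 0))
      (mfderiv 𝓘(ℝ, E) 𝓘(ℝ, E) (chartOne E G).symm x : E →L[ℝ] E) := by
    rw [hm0]; exact h2
  have h3 := HasMFDerivAt.comp (f := fun y : E => (lieGroupChart E G).mul (x, y)) (0 : E) h2'
    h1.hasMFDerivAt
  -- the other composition
  have h4 := ((contMDiff_mul_left (I := 𝓘(ℝ, E)) (n := ∞) (a := g)).contMDiffAt (x := (1 : G))
    |>.mdifferentiableAt (by simp)).hasMFDerivAt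
  have h4' : HasMFDerivAt 𝓘(ℝ, E) 𝓘(ℝ, E) (fun h : G => g * h) ((chartOne E G).symm 0)
      (mfderiv 𝓘(ℝ, E) 𝓘(ℝ, E) (fun h : G => g * h) 1 : E →L[ℝ] E) := by
    rw [hs]; exact h4
  have h5 := h4'.comp (0 : E) hasMFDerivAt_chartOne_symm
  have h6 : HasMFDerivAt 𝓘(ℝ, E) 𝓘(ℝ, E)
      ((chartOne E G).symm ∘ fun y : E => (lieGroupChart E G).mul (x, y)) (0 : E)
      ((mfderiv 𝓘(ℝ, E) 𝓘(ℝ, E) (fun h : G => g * h) 1 : E →L[ℝ] E).comp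
        (ContinuousLinearMap.id ℝ E)) := by
    refine h5.congr_of_eventuallyEq ?_
    have ht : Tendsto (fun y : E => g * (chartOne E G).symm y) (𝓝 0) (𝓝 g) := by
      have := (chartOne E G).symm.continuousAt (x := 0) zero_mem_chartOne_target
      rw [ContinuousAt, hs] at this
      simpa using (tendsto_const_nhds (x := g)).mul this
    filter_upwards [ht.eventually ((chartOne E G).open_source.mem_nhds
      ((chartOne E G).map_target hx))] with y hy
    exact (chartOne E G).left_inv hy
  have h7 := hasMFDerivAt_unique h3 h6
  exact h7.trans (ContinuousLinearMap.comp_id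
    (mfderiv 𝓘(ℝ, E) 𝓘(ℝ, E) (fun h : G => g * h) 1 : E →L[ℝ] E))

end LieChart

/-- Near `0`, the integral curves from `0` of the left-invariant vector fields exist for a uniform
time and depend continuously on the field. -/
theorem GroupChart.exists_left_flow {E G : Type*} [NormedAddCommGroup E] [NormedSpace ℝ E]
    [CompleteSpace E] [TopologicalSpace G] [Group G] (M : GroupChart E G) {P : Set E}
    (hP : P ∈ 𝓝 0) :
    ∃ ε > 0, ∃ x : E → ℝ → E, Tendsto (fun X => x X (ε / 2)) (𝓝 0) (𝓝 0) ∧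
      ∀ᶠ X in 𝓝 (0 : E), x X 0 = 0 ∧
        ∀ t ∈ Ioo (-ε) ε, x X t ∈ P ∧ HasDerivAt (x X) (M.left (x X t) X) t := by
  -- The field X is adjoined as a state variable with zero derivative, so that continuous dependence
  -- on the initial point yields continuous dependence on X.
  let f : E × E → E × E := fun p => (M.left p.1 p.2, 0)
  have hf : ContDiffAt ℝ 1 f 0 := by
    refine ContDiffAt.prodMk (ContDiffAt.clm_apply ?_ contDiffAt_snd) contDiffAt_const
    exact ContDiffAt.comp (g := M.left) (f := fun p : E × E => p.1) (0 : E × E)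
      M.contDiffAt_left contDiffAt_fst
  obtain ⟨ε₀, hε₀, a, r, L, K, hr, hpl⟩ := IsPicardLindelof.of_contDiffAt_one hf
  obtain ⟨α, hα, hαc⟩ := (hpl 0).exists_forall_mem_closedBall_eq_hasDerivWithinAt_continuousOn
  simp only [zero_sub, zero_add] at hα hαc
  have hball : ∀ X : E, ‖X‖ ≤ r → ((0 : E), X) ∈ Metric.closedBall (0 : E × E) r := fun X hX => by
    simpa using hX
  have hI : (0 : ℝ) ∈ Icc (-ε₀) ε₀ := ⟨by linarith, hε₀.le⟩
  -- the parameter is constant along the flow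
  have hsnd : ∀ X : E, ‖X‖ ≤ r → ∀ t ∈ Icc (-ε₀) ε₀, (α ((0, X), t)).2 = X := by
    intro X hX t ht
    obtain ⟨h0, hd⟩ := hα _ (hball X hX)
    have hd2 : ∀ s ∈ Icc (-ε₀) ε₀,
        HasDerivWithinAt (fun s => (α ((0, X), s)).2) 0 (Icc (-ε₀) ε₀) s :=
      fun s hs => (hasFDerivAt_snd (𝕜 := ℝ) (E := E) (F := E)).comp_hasDerivWithinAt s (hd s hs)
    have := (convex_Icc (-ε₀) ε₀).norm_image_sub_le_of_norm_hasDerivWithin_le (C := 0) hd2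
      (by simp) hI ht
    rw [zero_mul, norm_le_zero_iff, sub_eq_zero] at this
    rw [this, h0]
  have hzero : ∀ t ∈ Icc (-ε₀) ε₀, α ((0, 0), t) = 0 := by
    intro t ht
    obtain ⟨h0, hd⟩ := hα _ (hball 0 (by simp))
    have hd2 : ∀ s ∈ Icc (-ε₀) ε₀,
        HasDerivWithinAt (fun s => α ((0, 0), s)) 0 (Icc (-ε₀) ε₀) s := by
      intro s hs
      have := hd s hs
      simp only [f, hsnd 0 (by simp) s hs, map_zero] at this
      exact this
    have := (convex_Icc (-ε₀) ε₀).norm_image_sub_le_of_norm_hasDerivWithin_le (C := 0) hd2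
      (by simp) hI ht
    rw [zero_mul, norm_le_zero_iff, sub_eq_zero] at this
    rw [this, h0]; rfl
  have hcont : ∀ t ∈ Ioo (-ε₀) ε₀, ContinuousAt (fun q : E × ℝ => α ((0, q.1), q.2)) (0, t) := by
    intro t ht
    have h1 : ContinuousAt α ((0, 0), t) := hαc.continuousAt
      (prod_mem_nhds (Metric.closedBall_mem_nhds _ (by exact_mod_cast hr))
        (Icc_mem_nhds ht.1 ht.2))
    exact ContinuousAt.comp (f := fun q : E × ℝ => (((0 : E), q.1), q.2)) (x := (0, t)) h1
      (by fun_prop)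
  have hev : ∀ᶠ q in 𝓝 ((0 : E), (0 : ℝ)), (α ((0, q.1), q.2)).1 ∈ P := by
    have h1 := hcont 0 ⟨by linarith, hε₀⟩
    have h2 : Tendsto (fun q : E × ℝ => (α ((0, q.1), q.2)).1) (𝓝 (0, 0)) (𝓝 0) := by
      have := (continuous_fst.tendsto _).comp h1.tendsto
      simpa [hzero 0 hI, Function.comp_def] using this
    exact h2.eventually hP
  obtain ⟨ρ, hρ, Hρ⟩ := Metric.eventually_nhds_iff.1 hev
  refine ⟨min ρ ε₀, by positivity, fun X t => (α ((0, X), t)).1, ?_, ?_⟩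
  · have hm : min ρ ε₀ / 2 ∈ Ioo (-ε₀) ε₀ := by
      have h1 : min ρ ε₀ ≤ ε₀ := min_le_right _ _
      have h2 : 0 < min ρ ε₀ := by positivity
      constructor <;> linarith
    have h1 := (hcont _ hm).tendsto
    have h2 : Tendsto (fun X : E => (X, min ρ ε₀ / 2)) (𝓝 0) (𝓝 (0, min ρ ε₀ / 2)) :=
      Continuous.tendsto' (by fun_prop) _ _ rfl
    have h3 := (continuous_fst.tendsto _).comp (h1.comp h2)
    simpa [hzero _ (Ioo_subset_Icc_self hm), Function.comp_def] using h3
  · have hX : ∀ᶠ X in 𝓝 (0 : E), ‖X‖ < min ρ r := by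
      have : 0 < min ρ r := by positivity
      filter_upwards [Metric.ball_mem_nhds (0 : E) this] with X hX
      simpa using hX
    filter_upwards [hX] with X hX
    have hXr : ‖X‖ ≤ r := (hX.trans_le (min_le_right _ _)).le
    obtain ⟨h0, hd⟩ := hα _ (hball X hXr)
    refine ⟨by rw [h0], fun t ht => ⟨?_, ?_⟩⟩
    · refine @Hρ (X, t) ?_
      rw [Prod.dist_eq, dist_zero_right, Real.dist_eq, sub_zero]
      refine max_lt (hX.trans_le (min_le_left _ _)) (abs_lt.2 ?_)
      have h1 : min ρ ε₀ ≤ ρ := min_le_left _ _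
      exact ⟨by linarith [ht.1], by linarith [ht.2]⟩
    · have h1 : min ρ ε₀ ≤ ε₀ := min_le_right _ _
      have ht' : t ∈ Icc (-ε₀) ε₀ := ⟨by linarith [ht.1], by linarith [ht.2]⟩
      have h2 := (hd t ht').hasDerivAt
        (Icc_mem_nhds (by linarith [ht.1]) (by linarith [ht.2]))
      have h3 := (hasFDerivAt_fst (𝕜 := ℝ) (E := E) (F := E)).comp_hasDerivAt t h2
      simpa [f, hsnd X hXr t ht', Function.comp_def] using h3

/-! ### The exponential map of a Lie group: one-parameter law and continuity at 0. -/

section LieExp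

variable {E : Type*} [NormedAddCommGroup E] [NormedSpace ℝ E] [FiniteDimensional ℝ E]
  {G : Type*} [TopologicalSpace G] [ChartedSpace E G] [Group G] [LieGroup 𝓘(ℝ, E) ∞ G]

theorem contMDiff_one_mulInvariantVectorField (X : LieAlg E G) :
    ContMDiff 𝓘(ℝ, E) (𝓘(ℝ, E).prod 𝓘(ℝ, E)) 1
      (fun g : G => (mulInvariantVectorField X g : TangentBundle 𝓘(ℝ, E) G)) :=
  (contMDiff_mulInvariantVectorField X).of_le (le_trans (by norm_num) le_minSmoothness)

theorem mulInvariantVectorField_mul (X : LieAlg E G) (g h : G) :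
    (mulInvariantVectorField X (g * h) : E) =
      (mfderiv 𝓘(ℝ, E) 𝓘(ℝ, E) (fun x : G => g * x) h : E →L[ℝ] E)
        (mulInvariantVectorField X h) := by
  have hd : ∀ a b : G, MDifferentiableAt 𝓘(ℝ, E) 𝓘(ℝ, E) (fun x => a * x) b := fun a _ =>
    (contMDiff_mul_left (I := 𝓘(ℝ, E)) (n := ∞) (a := a)).contMDiffAt.mdifferentiableAt (by simp)
  have hc : HasMFDerivAt 𝓘(ℝ, E) 𝓘(ℝ, E) ((fun x => g * x) ∘ (fun x => h * x)) (1 : G)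
      ((mfderiv 𝓘(ℝ, E) 𝓘(ℝ, E) (fun x => g * x) (h * 1)).comp
        (mfderiv 𝓘(ℝ, E) 𝓘(ℝ, E) (fun x => h * x) 1)) :=
    (hd g (h * 1)).hasMFDerivAt.comp (1 : G) (hd h 1).hasMFDerivAt
  have he : (fun x => g * x) ∘ (fun x => h * x) = fun x => g * h * x := by
    ext x; exact (mul_assoc _ _ _).symm
  rw [he] at hc
  have hr : mulInvariantVectorField X (g * h) =
      mfderiv 𝓘(ℝ, E) 𝓘(ℝ, E) (fun x => g * x) (h * 1) (mulInvariantVectorField X h) :=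
    congrArg (fun A : E →L[ℝ] E => A X) hc.mfderiv
  have hk : ∀ k : G, k = h → (mfderiv 𝓘(ℝ, E) 𝓘(ℝ, E) (fun x => g * x) k : E →L[ℝ] E) =
      (mfderiv 𝓘(ℝ, E) 𝓘(ℝ, E) (fun x => g * x) h : E →L[ℝ] E) := by
    rintro _ rfl; rfl
  exact hr.trans (congrArg (fun A : E →L[ℝ] E => A (mulInvariantVectorField X h))
    (hk _ (mul_one _)))

theorem IsMIntegralCurve.mul_left {X : LieAlg E G} {γ : ℝ → G}
    (hγ : IsMIntegralCurve (I := 𝓘(ℝ, E)) γ (mulInvariantVectorField X)) (g : G) :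
    IsMIntegralCurve (I := 𝓘(ℝ, E)) (fun t => g * γ t) (mulInvariantVectorField X) := by
  intro t
  have h2 := ((contMDiff_mul_left (I := 𝓘(ℝ, E)) (n := ∞) (a := g)).contMDiffAt (x := γ t)
    |>.mdifferentiableAt (by simp)).hasMFDerivAt
  have h3 := h2.comp t (hγ t)
  refine (congrArg (fun A : ℝ →L[ℝ] E => HasMFDerivAt 𝓘(ℝ, ℝ) 𝓘(ℝ, E)
    (fun t => g * γ t) t A) ?_).mpr h3
  refine ContinuousLinearMap.ext fun r => ?_
  have h5 := (mfderiv 𝓘(ℝ, E) 𝓘(ℝ, E) (fun x => g * x) (γ t)).map_smul r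
    (mulInvariantVectorField X (γ t))
  refine Eq.trans ?_ h5.symm
  exact congrArg (fun w : E => r • w) (mulInvariantVectorField_mul X g (γ t))

theorem t2Space_of_lieGroup (E G : Type*) [NormedAddCommGroup E] [NormedSpace ℝ E]
    [TopologicalSpace G] [ChartedSpace E G] [Group G] [LieGroup 𝓘(ℝ, E) ∞ G] : T2Space G := by
  have : IsTopologicalGroup G := topologicalGroup_of_lieGroup 𝓘(ℝ, E) ∞
  have : T1Space G := ChartedSpace.t1Space E G
  infer_instance

theorem IsMIntegralCurve.eq_of_apply_zero_eq {X : LieAlg E G} {γ γ' : ℝ → G}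
    (hγ : IsMIntegralCurve (I := 𝓘(ℝ, E)) γ (mulInvariantVectorField X))
    (hγ' : IsMIntegralCurve (I := 𝓘(ℝ, E)) γ' (mulInvariantVectorField X)) (h : γ 0 = γ' 0) :
    γ = γ' := by
  have : IsManifold 𝓘(ℝ, E) 1 G := IsManifold.of_le (n := ∞) (by exact_mod_cast le_top)
  have : T2Space G := t2Space_of_lieGroup E G
  exact isMIntegralCurve_Ioo_eq_of_contMDiff_boundaryless
    (contMDiff_one_mulInvariantVectorField X) hγ hγ' h

/-- The one-parameter subgroup of `X`. -/
noncomputable def oneParam (X : LieAlg E G) : ℝ → G :=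
  (exists_isMIntegralCurve_mulInvariantVectorField X).choose

theorem oneParam_zero (X : LieAlg E G) : oneParam X 0 = 1 :=
  (exists_isMIntegralCurve_mulInvariantVectorField X).choose_spec.1

theorem isMIntegralCurve_oneParam (X : LieAlg E G) :
    IsMIntegralCurve (I := 𝓘(ℝ, E)) (oneParam X) (mulInvariantVectorField X) :=
  (exists_isMIntegralCurve_mulInvariantVectorField X).choose_spec.2

theorem lieExp_smul (X : LieAlg E G) (t : ℝ) : lieExp (t • X) = oneParam X t := by
  have h1 := (isMIntegralCurve_oneParam X).comp_mul t
  rw [← mulInvariantVectorField_smul] at h1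
  have h2 := (isMIntegralCurve_oneParam (t • X)).eq_of_apply_zero_eq h1
    (by simp [oneParam_zero])
  have h3 := congrFun h2 1
  simp only [Function.comp_apply, one_mul] at h3
  exact h3

/-- The one-parameter subgroup shifted by s and its left translate by exp(sX) are integral curves of
the same left-invariant field with the same value at 0. -/
theorem lieExp_add_smul (X : LieAlg E G) (s t : ℝ) :
    (lieExp ((s + t) • X) : G) = lieExp (s • X) * lieExp (t • X) := by
  rw [lieExp_smul, lieExp_smul, lieExp_smul]
  have h1 := (isMIntegralCurve_oneParam X).comp_add s
  have h2 := (isMIntegralCurve_oneParam X).mul_left (oneParam X s)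
  have h3 := congrFun (h1.eq_of_apply_zero_eq h2 (by simp [oneParam_zero])) t
  simpa [add_comm] using h3

theorem mulInvariantVectorField_one (X : LieAlg E G) :
    (mulInvariantVectorField X (1 : G) : E) = X := by
  have h : HasMFDerivAt 𝓘(ℝ, E) 𝓘(ℝ, E) (fun x : G => 1 * x) (1 : G)
      (ContinuousLinearMap.id ℝ E) := by
    refine (hasMFDerivAt_id (1 : G)).congr_of_eventuallyEq ?_
    filter_upwards with g
    simp
  exact congrArg (fun A : E →L[ℝ] E => A X) h.mfderiv

theorem hasDerivAt_chartOne_lieExp (X : LieAlg E G) :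
    HasDerivAt (fun t : ℝ => chartOne E G (lieExp (t • X))) (X : E) 0 := by
  simp only [lieExp_smul]
  have h1 := isMIntegralCurve_oneParam X 0
  have h2 : HasMFDerivAt 𝓘(ℝ, E) 𝓘(ℝ, E) (chartOne E G) (oneParam X 0)
      (ContinuousLinearMap.id ℝ E) := by
    rw [oneParam_zero]; exact hasMFDerivAt_chartOne
  have h3 : HasFDerivAt (fun t : ℝ => chartOne E G (oneParam X t)) ((1 : ℝ →L[ℝ] ℝ).smulRight
      (mulInvariantVectorField X (oneParam X 0) : E)) 0 := (h2.comp (0 : ℝ) h1).hasFDerivAt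
  refine h3.hasDerivAt.congr_deriv ?_
  have h4 : ∀ g : G, g = 1 → (mulInvariantVectorField X g : E) = X := by
    rintro _ rfl; exact mulInvariantVectorField_one X
  exact (one_smul ℝ (mulInvariantVectorField X (oneParam X 0) : E)).trans
    (h4 _ (oneParam_zero X))

/-- `lieExp` chooses an integral curve for each X separately. Uniqueness identifies it, for small X,
with the flow in the chart, which is continuous in X at the fixed time ε/2; rescaling X turns time
ε/2 into time 1. -/
theorem tendsto_lieExp : Tendsto (fun X : E => (lieExp (X : LieAlg E G) : G)) (𝓝 0) (𝓝 1) := by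
  have : IsManifold 𝓘(ℝ, E) 1 G := IsManifold.of_le (n := ∞) (by exact_mod_cast le_top)
  have : T2Space G := t2Space_of_lieGroup E G
  let M := lieGroupChart E G
  have hP : {x : E | x ∈ (chartOne E G).target ∧ DifferentiableAt ℝ M.mul (x, 0)} ∈ 𝓝 0 := by
    have hl : Tendsto (fun x : E => (x, (0 : E))) (𝓝 0) (𝓝 0) :=
      Continuous.tendsto' (by fun_prop) _ _ (by simp)
    exact Filter.inter_mem (M.target_mem_nhds M.zero_mem_target)
      (hl.eventually M.eventually_differentiableAt)
  obtain ⟨ε, hε, x, hx, H⟩ := M.exists_left_flow hP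
  have key : ∀ᶠ X in 𝓝 (0 : E),
      (lieExp ((ε / 2) • X : LieAlg E G) : G) = (chartOne E G).symm (x X (ε / 2)) := by
    filter_upwards [H] with X hX
    obtain ⟨h0, hX⟩ := hX
    have hγ : IsMIntegralCurveOn (I := 𝓘(ℝ, E)) (fun t => (chartOne E G).symm (x X t))
        (mulInvariantVectorField (X : LieAlg E G)) (Ioo (-ε) ε) := by
      intro t ht
      obtain ⟨⟨h1, h2⟩, h3⟩ := hX t ht
      have h4 := ((contMDiffAt_chartOne_symm (G := G) h1).mdifferentiableAt (by simp)).hasMFDerivAt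
      have h5 := h4.comp t h3.hasFDerivAt.hasMFDerivAt
      refine HasMFDerivAt.hasMFDerivWithinAt ?_
      refine (congrArg (fun A : ℝ →L[ℝ] E => HasMFDerivAt 𝓘(ℝ, ℝ) 𝓘(ℝ, E)
        (fun t => (chartOne E G).symm (x X t)) t A) ?_).mpr h5
      refine ContinuousLinearMap.ext fun r => ?_
      have h6 := congrArg (fun A : E →L[ℝ] E => A X) (mfderiv_chartOne_symm_comp_left h1 h2)
      have h7 := (mfderiv 𝓘(ℝ, E) 𝓘(ℝ, E) (chartOne E G).symm (x X t) : E →L[ℝ] E).map_smul r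
        (M.left (x X t) X)
      refine Eq.trans ?_ h7.symm
      exact congrArg (fun w : E => r • w) h6.symm
    have heq := isMIntegralCurveOn_Ioo_eqOn_of_contMDiff_boundaryless (t₀ := 0)
      ⟨by linarith, hε⟩ (contMDiff_one_mulInvariantVectorField X)
      ((isMIntegralCurve_oneParam (G := G) X).isMIntegralCurveOn _) hγ
      (by rw [oneParam_zero, h0, chartOne_symm_zero])
    rw [lieExp_smul]
    exact heq ⟨by linarith, by linarith⟩
  have h1 : Tendsto (fun X : E => (chartOne E G).symm (x X (ε / 2))) (𝓝 0) (𝓝 1) := by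
    have := (chartOne E G).symm.continuousAt (x := 0) zero_mem_chartOne_target
    rw [ContinuousAt, chartOne_symm_zero] at this
    exact this.comp hx
  have h2 := h1.congr' (key.mono fun _ h => h.symm)
  have h3 : Tendsto (fun X : E => (ε / 2)⁻¹ • X) (𝓝 0) (𝓝 0) :=
    Continuous.tendsto' (by fun_prop) _ _ (by simp)
  refine (h2.comp h3).congr fun X => ?_
  exact congrArg (fun Y : E => (lieExp (Y : LieAlg E G) : G))
    (smul_inv_smul₀ (show ε / 2 ≠ 0 by positivity) X)

end LieExp

/-! ### The Lie bracket in the chart at the identity. -/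

section LieExpChart

variable {E : Type*} [NormedAddCommGroup E] [NormedSpace ℝ E] [FiniteDimensional ℝ E]
  {G : Type*} [TopologicalSpace G] [ChartedSpace E G] [Group G] [LieGroup 𝓘(ℝ, E) ∞ G]

theorem lieExp_zero : (lieExp (0 : LieAlg E G) : G) = 1 := by
  have := lieExp_smul (0 : LieAlg E G) 0
  rwa [smul_zero, oneParam_zero] at this

variable (E G) in
/-- A Lie group with its exponential map, in the chart at the identity. -/
noncomputable def lieExpChart : ExpChart E G where
  toGroupChart := lieGroupChart E G
  exp := fun X : E => lieExp (X : LieAlg E G)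
  exp_add_smul := fun X s t => lieExp_add_smul X s t
  continuousAt_exp := by
    have h : (lieExp ((0 : E) : LieAlg E G) : G) = 1 := lieExp_zero
    rw [ContinuousAt, h]
    exact tendsto_lieExp
  hasDerivAt_exp := hasDerivAt_chartOne_lieExp

/-- The Lie bracket of the Lie algebra is computed from these pullbacks. Equality near the base
point suffices, since the bracket of vector fields depends on germs only. -/
theorem mpullbackWithin_mulInvariantVectorField_eventuallyEq (X : LieAlg E G) :
    (VectorField.mpullbackWithin 𝓘(ℝ, E) 𝓘(ℝ, E) (extChartAt 𝓘(ℝ, E) (1 : G)).symm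
      (mulInvariantVectorField X) (range 𝓘(ℝ, E)) : E → E) =ᶠ[𝓝 (chartAt E (1 : G) 1)]
      fun z => (lieGroupChart E G).left (z - chartAt E (1 : G) 1) X := by
  have : IsManifold 𝓘(ℝ, E) 1 G := IsManifold.of_le (n := ∞) (by exact_mod_cast le_top)
  set c := chartAt E (1 : G) 1 with hc
  let M := lieGroupChart E G
  have hP : ∀ᶠ x in 𝓝 (0 : E), x ∈ (chartOne E G).target ∧ DifferentiableAt ℝ M.mul (x, 0) := by
    have hl : Tendsto (fun x : E => (x, (0 : E))) (𝓝 0) (𝓝 0) :=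
      Continuous.tendsto' (by fun_prop) _ _ (by simp)
    exact Filter.inter_mem (M.target_mem_nhds M.zero_mem_target)
      (hl.eventually M.eventually_differentiableAt)
  have ht : Tendsto (fun z : E => z - c) (𝓝 c) (𝓝 0) :=
    Continuous.tendsto' (by fun_prop) _ _ (by simp)
  filter_upwards [ht.eventually hP] with z hz
  obtain ⟨h1, h2⟩ := hz
  have hz' : z ∈ (extChartAt 𝓘(ℝ, E) (1 : G)).target := by
    have := mem_chartOne_target h1
    rw [sub_add_cancel] at this
    simpa using this
  have hinv := isInvertible_mfderivWithin_extChartAt_symm (I := 𝓘(ℝ, E)) hz'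
  have hsymm : (extChartAt 𝓘(ℝ, E) (1 : G)).symm z = (chartOne E G).symm (z - c) := by
    simp [chartOne_symm_apply, hc]
  -- the derivatives of the two charts agree
  have hder : (mfderivWithin 𝓘(ℝ, E) 𝓘(ℝ, E) (extChartAt 𝓘(ℝ, E) (1 : G)).symm
      (range 𝓘(ℝ, E)) z : E →L[ℝ] E) =
      (mfderiv 𝓘(ℝ, E) 𝓘(ℝ, E) (chartOne E G).symm (z - c) : E →L[ℝ] E) := by
    have d1 := ((contMDiffAt_chartOne_symm (G := G) h1).mdifferentiableAt (by simp)).hasMFDerivAt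
    have d2 : HasFDerivAt (fun z : E => z - c) (ContinuousLinearMap.id ℝ E) z :=
      (hasFDerivAt_id z).sub_const c
    have d3 := HasMFDerivAt.comp (f := fun z : E => z - c) z d1 d2.hasMFDerivAt
    have d4 : HasMFDerivAt 𝓘(ℝ, E) 𝓘(ℝ, E) (extChartAt 𝓘(ℝ, E) (1 : G)).symm z
        ((mfderiv 𝓘(ℝ, E) 𝓘(ℝ, E) (chartOne E G).symm (z - c) : E →L[ℝ] E).comp
          (ContinuousLinearMap.id ℝ E)) := by
      refine d3.congr_of_eventuallyEq (Filter.Eventually.of_forall fun w => ?_)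
      simp [chartOne_symm_apply, hc]
    rw [ModelWithCorners.range_eq_univ, mfderivWithin_univ]
    exact d4.mfderiv.trans (ContinuousLinearMap.comp_id
      (mfderiv 𝓘(ℝ, E) 𝓘(ℝ, E) (chartOne E G).symm (z - c) : E →L[ℝ] E))
  have hleft := congrArg (fun A : E →L[ℝ] E => A X) (mfderiv_chartOne_symm_comp_left h1 h2)
  have hval : (mulInvariantVectorField X ((extChartAt 𝓘(ℝ, E) (1 : G)).symm z) : E) =
      (mfderivWithin 𝓘(ℝ, E) 𝓘(ℝ, E) (extChartAt 𝓘(ℝ, E) (1 : G)).symm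
      (range 𝓘(ℝ, E)) z : E →L[ℝ] E) (M.left (z - c) X) := by
    rw [hder]
    have e : ∀ g : G, g = (chartOne E G).symm (z - c) → (mulInvariantVectorField X g : E) =
      (mulInvariantVectorField X ((chartOne E G).symm (z - c)) : E) := by rintro _ rfl; rfl
    exact (e _ hsymm).trans hleft.symm
  rw [VectorField.mpullbackWithin_apply]
  exact (congrArg (fun v : E => ((mfderivWithin 𝓘(ℝ, E) 𝓘(ℝ, E)
    (extChartAt 𝓘(ℝ, E) (1 : G)).symm (range 𝓘(ℝ, E)) z : E →L[ℝ] E).inverse) v) hval).trans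
    (congrArg (fun A : E →L[ℝ] E => A (M.left (z - c) X)) (hinv.inverse_comp_self))

/-- As `left 0 = 1`, the two fields take the values X and Y at c, and DW(V) - DV(W) becomes the
commutator form of `ad_apply`. -/
theorem GroupChart.lieBracketWithin_eq_ad (M : GroupChart E G) {V W : E → E} {c X Y : E}
    (hV : V =ᶠ[𝓝 c] fun z => M.left (z - c) X) (hW : W =ᶠ[𝓝 c] fun z => M.left (z - c) Y) :
    VectorField.lieBracketWithin ℝ V W univ c = M.ad X Y := by
  have hd : ∀ W : E, HasFDerivAt (fun z => M.left (z - c) W) ((fderiv ℝ M.left 0).flip W) c := by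
    intro W
    have h1 : HasFDerivAt M.left (fderiv ℝ M.left 0) (c - c) := by
      rw [sub_self]; exact (M.contDiffAt_left.differentiableAt (by simp)).hasFDerivAt
    have h2 := HasFDerivAt.comp (f := fun z : E => z - c) c h1 ((hasFDerivAt_id c).sub_const c)
    have h3 := h2.clm_apply (hasFDerivAt_const W c)
    convert! h3 using 1
    ext v; simp
  rw [VectorField.lieBracketWithin_univ, hV.lieBracket_vectorField_eq hW,
    VectorField.lieBracket_eq]
  simp only
  rw [(hd X).fderiv, (hd Y).fderiv, M.ad_apply, sub_self, M.left_zero]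
  simp

/-- The bracket of the Lie algebra in the chart at the identity. -/
theorem lieGroupChart_ad (X Y : LieAlg E G) :
    ((lieGroupChart E G).ad X Y : E) = (⁅X, Y⁆ : LieAlg E G) := by
  have : IsManifold 𝓘(ℝ, E) 1 G := IsManifold.of_le (n := ∞) (by exact_mod_cast le_top)
  have key := (lieGroupChart E G).lieBracketWithin_eq_ad
    (mpullbackWithin_mulInvariantVectorField_eventuallyEq X)
    (mpullbackWithin_mulInvariantVectorField_eventuallyEq Y)
  have hset : ((extChartAt 𝓘(ℝ, E) (1 : G)).symm ⁻¹' univ ∩ range 𝓘(ℝ, E)) = univ := by simp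
  have hpt : extChartAt 𝓘(ℝ, E) (1 : G) 1 = chartAt E (1 : G) 1 := by simp
  rw [← hset, ← hpt] at key
  -- The bracket on the manifold is the bracket in the chart, carried back by the inverse of the
  -- chart's differential, which is the identity at 1.
  have hid : (mfderiv 𝓘(ℝ, E) 𝓘(ℝ, E) (extChartAt 𝓘(ℝ, E) (1 : G)) 1 : E →L[ℝ] E).inverse =
      ContinuousLinearMap.id ℝ E :=
    (congrArg (fun A : E →L[ℝ] E => A.inverse) mfderiv_extChartAt_self).trans
      ContinuousLinearMap.inverse_id
  exact ((congrArg (fun A : E →L[ℝ] E => A _) hid).trans key).symm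

end LieExpChart

/-! ### Dilatations of a filtered bracket -/

section Naturality

variable {E : Type*} [NormedAddCommGroup E] [NormedSpace ℝ E] [CompleteSpace E]

theorem logTrunc_units_conj (K : ℕ) (u : (E →L[ℝ] E)ˣ) (N : E →L[ℝ] E) :
    logTrunc K (u * N * ↑u⁻¹) = u * logTrunc K N * ↑u⁻¹ := by
  simp only [logTrunc, Units.conj_pow, Finset.mul_sum, Finset.sum_mul, mul_smul_comm,
    smul_mul_assoc]

theorem continuous_bchInt_integrand {X : Type*} [TopologicalSpace X] {K : ℕ}
    {B : X → E →L[ℝ] E →L[ℝ] E} {x y : X → E} {t : X → ℝ} (hB : Continuous B) (hx : Continuous x)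
    (hy : Continuous y) (ht : Continuous t) :
    Continuous fun p => logTrunc K (NormedSpace.exp (t p • B p (x p)) *
      NormedSpace.exp (t p • B p (y p)) - 1) (x p + NormedSpace.exp (t p • B p (x p)) (y p)) := by
  have c1 : Continuous fun p => NormedSpace.exp (t p • B p (x p)) :=
    Continuous.exp_of_real (by fun_prop)
  have c2 : Continuous fun p => NormedSpace.exp (t p • B p (y p)) :=
    Continuous.exp_of_real (by fun_prop)
  simp only [logTrunc]
  fun_prop

/-- Continuity in the bracket B is the point: the bracket will depend on ε, and the limit ε → 0 is
taken in it. -/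
theorem continuous_bchInt {X : Type*} [TopologicalSpace X] {K : ℕ}
    {B : X → E →L[ℝ] E →L[ℝ] E} {x y : X → E} (hB : Continuous B) (hx : Continuous x)
    (hy : Continuous y) : Continuous fun p => bchInt (B p) K (x p) (y p) :=
  intervalIntegral.continuous_parametric_intervalIntegral_of_continuous'
    (continuous_bchInt_integrand (X := X × ℝ) (hB.comp continuous_fst) (hx.comp continuous_fst)
      (hy.comp continuous_fst) continuous_snd) 0 1

/-- An isomorphism of brackets is an isomorphism for the truncated products. -/
theorem units_apply_bchInt (u : (E →L[ℝ] E)ˣ) {B ad : E →L[ℝ] E →L[ℝ] E}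
    (h : ∀ X Y, u.1 (B X Y) = ad (u.1 X) (u.1 Y)) (K : ℕ) (X Y : E) :
    u.1 (bchInt B K X Y) = bchInt ad K (u.1 X) (u.1 Y) := by
  let _ : NormedAlgebra ℚ (E →L[ℝ] E) := NormedAlgebra.restrictScalars ℚ ℝ _
  have hinv : ∀ v : E, (↑u⁻¹ : E →L[ℝ] E) (u.1 v) = v := fun v =>
    DFunLike.congr_fun u.inv_mul v
  have hu : ∀ v : E, u.1 ((↑u⁻¹ : E →L[ℝ] E) v) = v := fun v =>
    DFunLike.congr_fun u.mul_inv v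
  have hconj : ∀ X, ad (u.1 X) = u * B X * ↑u⁻¹ := by
    intro X; ext v
    simp only [mul_apply_eq_comp, h, hu]
  have hexp : ∀ (t : ℝ) X, NormedSpace.exp (t • ad (u.1 X)) =
      u * NormedSpace.exp (t • B X) * ↑u⁻¹ := by
    intro t X
    rw [← NormedSpace.exp_units_conj, hconj, mul_smul_comm, smul_mul_assoc]
  simp only [bchInt]
  rw [← ContinuousLinearMap.intervalIntegral_comp_comm]
  · congr 1
    funext t
    have e : u * NormedSpace.exp (t • B X) * ↑u⁻¹ * (u * NormedSpace.exp (t • B Y) * ↑u⁻¹) - 1 =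
        u * (NormedSpace.exp (t • B X) * NormedSpace.exp (t • B Y) - 1) * ↑u⁻¹ := by
      rw [mul_sub, sub_mul, mul_one, Units.mul_inv]
      congr 1
      simp only [mul_assoc, Units.inv_mul_cancel_left]
    rw [hexp, hexp, e, logTrunc_units_conj]
    simp only [mul_apply_eq_comp, hinv, map_add]
  · exact (continuous_bchInt_integrand (X := ℝ) continuous_const continuous_const continuous_const
      continuous_id).intervalIntegrable _ _

end Naturality

/-- A splitting of a normed space into finitely many layers of positive degree, with a bracket
that respects the associated filtration. -/
structure LayerSplitting {E : Type*} [NormedAddCommGroup E] [NormedSpace ℝ E] (m : ℕ)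
    (ad : E →L[ℝ] E →L[ℝ] E) where
  proj : ℕ → E →L[ℝ] E
  sum_proj : ∀ x, ∑ i ∈ Finset.range (m + 1), proj i x = x
  proj_proj : ∀ i j x, proj i (proj j x) = if i = j then proj j x else 0
  proj_zero : proj 0 = 0
  proj_ad : ∀ i j k x y, i + j < k → proj k (ad (proj i x) (proj j y)) = 0

namespace LayerSplitting

variable {E : Type*} [NormedAddCommGroup E] [NormedSpace ℝ E] {m : ℕ}
  {ad : E →L[ℝ] E →L[ℝ] E} (S : LayerSplitting m ad)

theorem proj_of_lt {k : ℕ} (hk : m < k) (x : E) : S.proj k x = 0 := by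
  rw [← S.sum_proj x, map_sum]
  refine Finset.sum_eq_zero fun i hi => ?_
  rw [S.proj_proj, if_neg]
  have := Finset.mem_range.1 hi
  omega

theorem eq_zero_of_proj {x : E} (h : ∀ k, S.proj k x = 0) : x = 0 := by
  rw [← S.sum_proj x]
  exact Finset.sum_eq_zero fun i _ => h i

/-- The dilatation of factor `ε`. -/
noncomputable def dil (ε : ℝ) : E →L[ℝ] E := ∑ i ∈ Finset.range (m + 1), ε ^ i • S.proj i

theorem dil_apply (ε : ℝ) (x : E) :
    S.dil ε x = ∑ i ∈ Finset.range (m + 1), ε ^ i • S.proj i x := by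
  simp [dil]

theorem continuous_dil : Continuous S.dil := by
  unfold dil
  fun_prop

theorem dil_proj (ε : ℝ) (k : ℕ) (x : E) : S.dil ε (S.proj k x) = ε ^ k • S.proj k x := by
  rcases Nat.lt_or_ge m k with hk | hk
  · rw [S.proj_of_lt hk, map_zero, smul_zero]
  · rw [dil_apply, Finset.sum_eq_single k]
    · rw [S.proj_proj, if_pos rfl]
    · intro i _ hi
      rw [S.proj_proj, if_neg hi, smul_zero]
    · intro h
      exact absurd (Finset.mem_range.2 (by omega)) h

theorem dil_dil (ε η : ℝ) (x : E) : S.dil ε (S.dil η x) = S.dil (ε * η) x := by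
  rw [S.dil_apply η, map_sum, S.dil_apply]
  refine Finset.sum_congr rfl fun i _ => ?_
  rw [map_smul, dil_proj, smul_smul, mul_pow, mul_comm]

theorem dil_one (x : E) : S.dil 1 x = x := by
  rw [dil_apply]
  simp only [one_pow, one_smul]
  exact S.sum_proj x

/-- The dilatation of a non-zero factor as an invertible map. -/
noncomputable def dilUnit (ε : ℝ) (hε : ε ≠ 0) : (E →L[ℝ] E)ˣ where
  val := S.dil ε
  inv := S.dil ε⁻¹
  val_inv := by
    ext x
    rw [mul_apply_eq_comp, S.dil_dil, mul_inv_cancel₀ hε, S.dil_one]; rfl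
  inv_val := by
    ext x
    rw [mul_apply_eq_comp, S.dil_dil, inv_mul_cancel₀ hε, S.dil_one]; rfl

/-- The bracket transported by the dilatation of factor `ε`, extended to `ε = 0`. -/
noncomputable def bracket (ε : ℝ) : E →L[ℝ] E →L[ℝ] E :=
  ∑ i ∈ Finset.range (m + 1), ∑ j ∈ Finset.range (m + 1), ∑ k ∈ Finset.range (m + 1),
    ε ^ (i + j - k) • (ContinuousLinearMap.compL ℝ E E E (S.proj k)).comp
      (ad.bilinearComp (S.proj i) (S.proj j))

theorem bracket_apply (ε : ℝ) (X Y : E) :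
    S.bracket ε X Y = ∑ i ∈ Finset.range (m + 1), ∑ j ∈ Finset.range (m + 1),
      ∑ k ∈ Finset.range (m + 1),
        ε ^ (i + j - k) • S.proj k (ad (S.proj i X) (S.proj j Y)) := by
  simp [bracket]

theorem continuous_bracket : Continuous S.bracket := by
  unfold bracket
  fun_prop

/-- For ε ≠ 0 this says that `bracket ε` is δ_ε⁻¹[δ_ε X, δ_ε Y], but it needs no inverse. The
truncated exponent i + j - k is harmless: components with k > i + j vanish by `proj_ad`. -/
theorem dil_bracket (ε : ℝ) (X Y : E) :
    S.dil ε (S.bracket ε X Y) = ad (S.dil ε X) (S.dil ε Y) := by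
  rw [bracket_apply, S.dil_apply ε X, S.dil_apply ε Y]
  simp only [map_sum, sum_apply, map_smul, smul_apply]
  rw [Finset.sum_comm]
  refine Finset.sum_congr rfl fun j _ => ?_
  rw [Finset.smul_sum]
  refine Finset.sum_congr rfl fun i _ => ?_
  conv_rhs => rw [← S.sum_proj (ad (S.proj i X) (S.proj j Y))]
  rw [Finset.smul_sum, Finset.smul_sum]
  refine Finset.sum_congr rfl fun k _ => ?_
  rw [S.dil_proj]
  rcases Nat.lt_or_ge (i + j) k with hk | hk
  · rw [S.proj_ad i j k X Y hk]; simp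
  · rw [smul_smul, smul_smul, ← pow_add, ← pow_add, Nat.sub_add_cancel hk, add_comm j i]

/-- At ε = 0 the powers with i + j > k vanish, the components with i + j < k vanish by `proj_ad`,
and 0^0 = 1 keeps those with i + j = k. So the limit bracket is graded. -/
theorem proj_bracket_zero (n : ℕ) (X Y : E) :
    S.proj n (S.bracket 0 X Y) = ∑ p ∈ Finset.HasAntidiagonal.antidiagonal n,
      S.proj n (ad (S.proj p.1 X) (S.proj p.2 Y)) := by
  rcases Nat.lt_or_ge m n with hn | hn
  · rw [S.proj_of_lt hn, Finset.sum_eq_zero]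
    exact fun p _ => S.proj_of_lt hn _
  have h1 : S.proj n (S.bracket 0 X Y) = ∑ i ∈ Finset.range (m + 1), ∑ j ∈ Finset.range (m + 1),
      if i + j = n then S.proj n (ad (S.proj i X) (S.proj j Y)) else 0 := by
    rw [bracket_apply]
    simp only [map_sum, map_smul]
    refine Finset.sum_congr rfl fun i _ => Finset.sum_congr rfl fun j _ => ?_
    rw [Finset.sum_eq_single n]
    · rw [S.proj_proj, if_pos rfl]
      split_ifs with h
      · rw [h, Nat.sub_self, pow_zero, one_smul]
      · rcases Nat.lt_or_ge (i + j) n with hk | hk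
        · rw [S.proj_ad i j n X Y hk, smul_zero]
        · rw [zero_pow (by omega), zero_smul]
    · intro k _ hk
      rw [S.proj_proj, if_neg (Ne.symm hk), smul_zero]
    · intro h
      exact absurd (Finset.mem_range.2 (by omega)) h
  rw [h1, ← Finset.sum_product', ← Finset.sum_filter]
  refine Finset.sum_congr ?_ fun _ _ => rfl
  ext p
  simp only [Finset.mem_filter, Finset.mem_product, Finset.mem_range,
    Finset.HasAntidiagonal.mem_antidiagonal]
  omega

/-- There is no layer of degree 0, so every power of ε that contributes is at least the first. -/
theorem norm_dil_le {ε : ℝ} (hε : 0 ≤ ε) (hε1 : ε ≤ 1) (x : E) :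
    ‖S.dil ε x‖ ≤ ε * ((∑ i ∈ Finset.range (m + 1), ‖S.proj i‖) * ‖x‖) := by
  rw [dil_apply, Finset.sum_mul, Finset.mul_sum]
  refine (norm_sum_le _ _).trans (Finset.sum_le_sum fun i _ => ?_)
  rw [norm_smul, norm_pow, Real.norm_of_nonneg hε]
  rcases Nat.eq_zero_or_pos i with rfl | hi
  · simp [S.proj_zero]
  · refine mul_le_mul ?_ ((S.proj i).le_opNorm x) (norm_nonneg _) hε
    exact pow_le_of_le_one hε hε1 (by omega)

/-- The degrees are at most m; the loss ε^{-m} is what forces a Baker-Campbell-Hausdorff remainder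
of order m + 1. -/
theorem norm_dil_inv_le {ε : ℝ} (hε : 0 < ε) (hε1 : ε ≤ 1) (x : E) :
    ‖S.dil ε⁻¹ x‖ ≤ (ε ^ m)⁻¹ * ((∑ i ∈ Finset.range (m + 1), ‖S.proj i‖) * ‖x‖) := by
  rw [dil_apply, Finset.sum_mul, Finset.mul_sum]
  refine (norm_sum_le _ _).trans (Finset.sum_le_sum fun i hi => ?_)
  rw [norm_smul, norm_pow, Real.norm_of_nonneg (by positivity)]
  refine mul_le_mul ?_ ((S.proj i).le_opNorm x) (norm_nonneg _) (by positivity)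
  rw [inv_pow]
  refine inv_anti₀ (by positivity) (pow_le_pow_of_le_one hε.le hε1 ?_)
  have := Finset.mem_range.1 hi
  omega

variable [FiniteDimensional ℝ E]

/-- The rescaled product converges, uniformly on bounded sets, to the product of the bracket at
`ε = 0`. -/
theorem tendstoUniformlyOn_dil_inv {μ : E → E → E} {r C : ℝ} (hr : 0 < r) (hC : 0 ≤ C)
    (hμ : ∀ X Y : E, ‖X‖ < r → ‖Y‖ < r →
      ‖μ X Y - bchInt ad m X Y‖ ≤ C * (‖X‖ + ‖Y‖) ^ (m + 1)) {Q : Set (E × E)}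
    (hQ : IsCompact Q) :
    TendstoUniformlyOn (fun (ε : ℝ) (p : E × E) => S.dil ε⁻¹ (μ (S.dil ε p.1) (S.dil ε p.2)))
      (fun p => bchInt (S.bracket 0) m p.1 p.2) (𝓝[>] 0) Q := by
  have : CompleteSpace E := FiniteDimensional.complete ℝ E
  obtain ⟨R, hR⟩ := hQ.isBounded.exists_norm_le
  have hR' : ∀ p ∈ Q, ‖p.1‖ ≤ max R 0 ∧ ‖p.2‖ ≤ max R 0 := fun p hp =>
    ⟨(norm_fst_le p).trans ((hR p hp).trans (le_max_left _ _)),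
      (norm_snd_le p).trans ((hR p hp).trans (le_max_left _ _))⟩
  set R₀ := max R 0
  have hR0 : 0 ≤ R₀ := le_max_right _ _
  set c := ∑ i ∈ Finset.range (m + 1), ‖S.proj i‖
  have hc : 0 ≤ c := Finset.sum_nonneg fun _ _ => norm_nonneg _
  rw [Metric.tendstoUniformlyOn_iff]
  intro η hη
  -- the products of the transported brackets
  have hcont : Continuous fun q : ℝ × (E × E) => bchInt (S.bracket q.1) m q.2.1 q.2.2 :=
    continuous_bchInt (S.continuous_bracket.comp continuous_fst) (by fun_prop) (by fun_prop)
  obtain ⟨v, hv, Hv⟩ := hQ.mem_uniformity_of_prod (s := univ)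
    (f := fun (ε : ℝ) (p : E × E) => bchInt (S.bracket ε) m p.1 p.2) hcont.continuousOn
    (mem_univ (0 : ℝ)) (Metric.dist_mem_uniformity (half_pos hη))
  rw [nhdsWithin_univ] at hv
  have h1 : ∀ᶠ ε in 𝓝[>] (0 : ℝ), ε ∈ v := nhdsWithin_le_nhds hv
  have h2 : ∀ᶠ ε in 𝓝[>] (0 : ℝ), ε < 1 := nhdsWithin_le_nhds (gt_mem_nhds one_pos)
  have h3 : ∀ᶠ ε in 𝓝[>] (0 : ℝ), ε * (c * R₀) < r := by
    have : Tendsto (fun ε : ℝ => ε * (c * R₀)) (𝓝 0) (𝓝 0) :=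
      Continuous.tendsto' (by fun_prop) _ _ (by simp)
    exact nhdsWithin_le_nhds (this.eventually (gt_mem_nhds hr))
  have h4 : ∀ᶠ ε in 𝓝[>] (0 : ℝ), ε * (c * (C * (2 * (c * R₀)) ^ (m + 1))) < η / 2 := by
    have : Tendsto (fun ε : ℝ => ε * (c * (C * (2 * (c * R₀)) ^ (m + 1)))) (𝓝 0) (𝓝 0) :=
      Continuous.tendsto' (by fun_prop) _ _ (by simp)
    exact nhdsWithin_le_nhds (this.eventually (gt_mem_nhds (half_pos hη)))
  filter_upwards [h1, h2, h3, h4, self_mem_nhdsWithin] with ε e1 e2 e3 e4 hε p hp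
  have hε : 0 < ε := hε
  have b1 := Hv ε e1 p hp
  have hb : ∀ x : E, ‖x‖ ≤ R₀ → ‖S.dil ε x‖ ≤ ε * (c * R₀) := fun x hx =>
    (S.norm_dil_le hε.le e2.le x).trans (by gcongr)
  have n1 := hb _ (hR' p hp).1
  have n2 := hb _ (hR' p hp).2
  have b2 := hμ _ _ (n1.trans_lt e3) (n2.trans_lt e3)
  -- Naturality under δ_ε turns the main term into the product of the rescaled bracket, with no
  -- error.
  have hnat : S.dil ε⁻¹ (bchInt ad m (S.dil ε p.1) (S.dil ε p.2)) =
      bchInt (S.bracket ε) m p.1 p.2 := by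
    have := units_apply_bchInt (S.dilUnit ε hε.ne') (S.dil_bracket ε) m p.1 p.2
    change S.dil ε _ = bchInt ad m (S.dil ε p.1) (S.dil ε p.2) at this
    rw [← this, S.dil_dil, inv_mul_cancel₀ hε.ne', S.dil_one]
  have b3 : dist (bchInt (S.bracket ε) m p.1 p.2)
      (S.dil ε⁻¹ (μ (S.dil ε p.1) (S.dil ε p.2))) < η / 2 := by
    rw [← hnat, dist_comm, dist_eq_norm, ← map_sub]
    refine lt_of_le_of_lt ?_ e4
    refine (S.norm_dil_inv_le hε e2.le _).trans ?_
    -- The remainder is of order ε^{m+1}; after the loss ε^{-m} one factor ε is left, and the choice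
    -- of ε in `h4` makes it smaller than η/2.
    have b4 : ‖μ (S.dil ε p.1) (S.dil ε p.2) - bchInt ad m (S.dil ε p.1) (S.dil ε p.2)‖ ≤
        C * (ε * (2 * (c * R₀))) ^ (m + 1) := by
      refine b2.trans ?_
      gcongr
      linarith
    calc _ ≤ (ε ^ m)⁻¹ * (c * (C * (ε * (2 * (c * R₀))) ^ (m + 1))) := by gcongr
      _ = _ := by
        rw [mul_pow]
        have : ε ^ m ≠ 0 := by positivity
        field_simp
        ring
  calc _ ≤ dist (bchInt (S.bracket 0) m p.1 p.2) (bchInt (S.bracket ε) m p.1 p.2) + _ :=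
        dist_triangle _ _ _
    _ < η / 2 + η / 2 := add_lt_add (by rw [dist_comm]; exact b1) b3
    _ = η := add_halves η

end LayerSplitting

/-! ### Dynkin's form of the truncated product for a nilpotent bracket -/

/-- The lists of length `k` with entries in `P`. -/
def listsOfLength {α : Type*} [DecidableEq α] (P : Finset α) : ℕ → Finset (List α)
  | 0 => {[]}
  | k + 1 => (P ×ˢ listsOfLength P k).image fun q => q.1 :: q.2

theorem mem_listsOfLength {α : Type*} [DecidableEq α] {P : Finset α} {k : ℕ} {l : List α} :
    l ∈ listsOfLength P k ↔ l.length = k ∧ ∀ q ∈ l, q ∈ P := by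
  induction k generalizing l with
  | zero =>
    simp only [listsOfLength, Finset.mem_singleton, List.length_eq_zero_iff]
    constructor
    · rintro rfl; simp
    · exact fun h => h.1
  | succ k ih =>
    simp only [listsOfLength, Finset.mem_image, Finset.mem_product, Prod.exists]
    constructor
    · rintro ⟨a, l', ⟨ha, hl'⟩, rfl⟩
      obtain ⟨h1, h2⟩ := ih.1 hl'
      simp only [List.length_cons, h1, List.mem_cons, true_and]
      rintro q (rfl | hq)
      · exact ha
      · exact h2 q hq
    · rintro ⟨h1, h2⟩
      match l with
      | [] => simp at h1
      | a :: l' =>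
        refine ⟨a, l', ⟨h2 a (by simp), ih.2 ⟨by simpa using h1, fun q hq => h2 q (by simp [hq])⟩⟩,
          rfl⟩

theorem sum_listsOfLength_succ {α M : Type*} [DecidableEq α] [AddCommMonoid M] (P : Finset α)
    (k : ℕ) (f : List α → M) :
    ∑ l ∈ listsOfLength P (k + 1), f l = ∑ q ∈ P, ∑ l ∈ listsOfLength P k, f (q :: l) := by
  rw [listsOfLength, Finset.sum_image, Finset.sum_product]
  rintro ⟨a, l⟩ _ ⟨b, l'⟩ _ h
  simpa using h

/-- The degree of a list of exponents. -/
def blockDeg (l : List (ℕ × ℕ)) : ℕ := (l.map fun p => p.1 + p.2).sum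

/-- The product of the factorials of a list of exponents. -/
def blockFact (l : List (ℕ × ℕ)) : ℕ := (l.map fun p => p.1.factorial * p.2.factorial).prod

/-- The word in two letters with given exponents. -/
def blockWord {E : Type*} (X Y : E) (l : List (ℕ × ℕ)) : List E :=
  l.flatMap fun p => List.replicate p.1 X ++ List.replicate p.2 Y

theorem length_blockWord {E : Type*} (X Y : E) (l : List (ℕ × ℕ)) :
    (blockWord X Y l).length = blockDeg l := by
  simp [blockWord, blockDeg, List.length_flatMap]

theorem length_le_blockDeg {l : List (ℕ × ℕ)} (h : (0, 0) ∉ l) : l.length ≤ blockDeg l := by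
  induction l with
  | nil => simp
  | cons q l ih =>
    simp only [List.mem_cons, not_or] at h
    have h1 := ih h.2
    have h2 : q.1 + q.2 ≠ 0 := fun h0 => h.1 (Prod.ext (by simp; omega) (by simp; omega))
    simp only [blockDeg, List.length_cons, List.map_cons, List.sum_cons] at h1 ⊢
    omega

theorem add_le_blockDeg {l : List (ℕ × ℕ)} {q : ℕ × ℕ} (h : q ∈ l) : q.1 + q.2 ≤ blockDeg l :=
  List.single_le_sum (by simp) _ (List.mem_map.2 ⟨q, h, rfl⟩)

/-- The exponents smaller than `N`, not both zero. -/
def blockIndex (N : ℕ) : Finset (ℕ × ℕ) := (Finset.range N ×ˢ Finset.range N).erase (0, 0)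

theorem zero_notMem_of_mem_listsOfLength {N k : ℕ} {l : List (ℕ × ℕ)}
    (h : l ∈ listsOfLength (blockIndex N) k) : (0, 0) ∉ l := fun h0 => by
  have := (mem_listsOfLength.1 h).2 _ h0
  simp [blockIndex] at this

section Nested

variable {E : Type*} [NormedAddCommGroup E] [NormedSpace ℝ E] (B : E →L[ℝ] E →L[ℝ] E)

/-- The right-nested bracket of a word. -/
noncomputable def nestedApply : List E → E
  | [] => 0
  | [a] => a
  | a :: b :: l => B a (nestedApply (b :: l))

theorem nestedApply_cons (a : E) {l : List E} (hl : l ≠ []) :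
    nestedApply B (a :: l) = B a (nestedApply B l) := by
  cases l with
  | nil => exact absurd rfl hl
  | cons b l => rfl

theorem nestedApply_replicate_append (r : ℕ) (a : E) {l : List E} (hl : l ≠ []) :
    nestedApply B (List.replicate r a ++ l) = (B a ^ r) (nestedApply B l) := by
  induction r with
  | zero => simp
  | succ r ih =>
    rw [List.replicate_succ, List.cons_append, nestedApply_cons B a (by simp [hl]), ih, pow_succ',
      mul_apply_eq_comp]

theorem nestedApply_blockWord_cons (X Y : E) (q : ℕ × ℕ) {l : List (ℕ × ℕ)}
    (hl : blockWord X Y l ≠ []) :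
    nestedApply B (blockWord X Y (q :: l)) =
      (B X ^ q.1 * B Y ^ q.2) (nestedApply B (blockWord X Y l)) := by
  rw [mul_apply_eq_comp, ← nestedApply_replicate_append B q.2 Y hl,
    ← nestedApply_replicate_append B q.1 X (by simp [hl])]
  simp [blockWord]

variable {B}

theorem nestedApply_replicate (hself : ∀ X, B X X = 0) (r : ℕ) (a : E) :
    nestedApply B (List.replicate (r + 2) a) = 0 := by
  have := nestedApply_replicate_append B r a (l := [a, a]) (by simp)
  rw [show List.replicate r a ++ [a, a] = List.replicate (r + 2) a by
    rw [List.replicate_add]; rfl] at this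
  rw [this]
  simp [nestedApply, hself]

theorem nestedApply_pair (hself : ∀ X, B X X = 0) (r s : ℕ) (X Y : E) :
    nestedApply B (List.replicate r X ++ List.replicate (s + 2) Y) = 0 := by
  rw [nestedApply_replicate_append B r X (by simp), nestedApply_replicate hself, map_zero]

/-- `(B X ^ r) v` is the nested bracket of a word of length r + 1, so r = M is already enough. -/
theorem pow_eq_zero_of_nestedApply {M : ℕ}
    (hnil : ∀ l : List E, M < l.length → nestedApply B l = 0) {r : ℕ} (hr : M ≤ r) (X : E) :
    B X ^ r = 0 := by
  ext v
  have := nestedApply_replicate_append B r X (l := [v]) (by simp)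
  rw [hnil _ (by simp; omega)] at this
  exact this.symm

theorem exp_smul_eq_sum [CompleteSpace E] {M N : ℕ}
    (hnil : ∀ l : List E, M < l.length → nestedApply B l = 0) (hN : M ≤ N) (t : ℝ) (X : E) :
    NormedSpace.exp (t • B X) =
      ∑ r ∈ Finset.range N, (t ^ r / (r.factorial : ℝ)) • B X ^ r := by
  rw [NormedSpace.exp_eq_tsum ℝ]
  dsimp only
  rw [tsum_eq_sum (s := Finset.range N)]
  · refine Finset.sum_congr rfl fun r _ => ?_
    rw [smul_pow, smul_smul, div_eq_inv_mul]
  · intro r hr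
    rw [Finset.mem_range, not_lt] at hr
    rw [smul_pow, pow_eq_zero_of_nestedApply hnil (hN.trans hr), smul_zero, smul_zero]

theorem exp_mul_exp_sub_one [CompleteSpace E] {M N : ℕ}
    (hnil : ∀ l : List E, M < l.length → nestedApply B l = 0) (hN : M < N) (t : ℝ) (X Y : E) :
    NormedSpace.exp (t • B X) * NormedSpace.exp (t • B Y) - 1 =
      ∑ q ∈ blockIndex N, (t ^ (q.1 + q.2) / (q.1.factorial * q.2.factorial : ℝ)) •
        (B X ^ q.1 * B Y ^ q.2) := by
  -- The pair (0, 0) contributes the identity: adding it on both sides absorbs the `- 1` and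
  -- completes the index set to a square.
  rw [blockIndex, ← add_left_inj
    ((t ^ (0 + 0) / (Nat.factorial 0 * Nat.factorial 0 : ℝ)) • (B X ^ 0 * B Y ^ 0)),
    Finset.sum_erase_add _ (a := ((0 : ℕ), (0 : ℕ))) _ (by simp; omega)]
  rw [exp_smul_eq_sum hnil hN.le, exp_smul_eq_sum hnil hN.le, Finset.sum_mul_sum,
    Finset.sum_product]
  simp only [add_zero, pow_zero, Nat.factorial_zero, Nat.cast_one, mul_one, div_one, one_smul,
    sub_add_cancel]
  refine Finset.sum_congr rfl fun r _ => Finset.sum_congr rfl fun s _ => ?_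
  rw [smul_mul_smul_comm, pow_add, mul_div_mul_comm]

/-- Brings X + e^{t ad X} Y into the block form of Dynkin's formula. Since a bracket of equal
letters is 0, blocks with s ≥ 2 vanish, those with s = 1 sum to e^{t ad X} Y, and those with s = 0
reduce to X. The innermost letter carries no factor t, hence the exponent r + s - 1. -/
theorem add_exp_apply_eq_sum [CompleteSpace E] {M N : ℕ} (hself : ∀ X, B X X = 0)
    (hnil : ∀ l : List E, M < l.length → nestedApply B l = 0) (hN : M + 2 ≤ N) (t : ℝ) (X Y : E) :
    X + NormedSpace.exp (t • B X) Y =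
      ∑ q ∈ blockIndex N, (t ^ (q.1 + q.2 - 1) / (q.1.factorial * q.2.factorial : ℝ)) •
        nestedApply B (List.replicate q.1 X ++ List.replicate q.2 Y) := by
  -- The pair (0, 0) may be put back, whatever its truncated exponent: its word is empty and has
  -- nested bracket 0.
  rw [blockIndex, Finset.sum_erase _ (by simp [nestedApply]), Finset.sum_product_right]
  obtain ⟨n, rfl⟩ : ∃ n, N = n + 1 + 1 := ⟨N - 2, by omega⟩
  rw [Finset.sum_range_succ', Finset.sum_range_succ']
  rw [Finset.sum_eq_zero (s := Finset.range n), zero_add, add_comm X]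
  · congr 1
    · rw [exp_smul_eq_sum hnil (N := n + 1 + 1) (by omega), sum_apply]
      refine Finset.sum_congr rfl fun r _ => ?_
      rw [nestedApply_replicate_append B r X (by simp)]
      simp [nestedApply]
    · rw [Finset.sum_range_succ', Finset.sum_range_succ', Finset.sum_eq_zero]
      · simp [nestedApply]
      · intro r _
        simp only [List.replicate_zero, List.append_nil]
        rw [nestedApply_replicate hself, smul_zero]
  · intro s _
    refine Finset.sum_eq_zero fun r _ => ?_
    rw [nestedApply_pair hself, smul_zero]

/-- Each factor e^{t ad X} e^{t ad Y} - 1 prepends one block and the vector X + e^{t ad X} Y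
supplies the last one, hence k + 1 blocks. -/
theorem pow_apply_eq_sum_lists [CompleteSpace E] {M N : ℕ} (hself : ∀ X, B X X = 0)
    (hnil : ∀ l : List E, M < l.length → nestedApply B l = 0) (hN : M + 2 ≤ N) (t : ℝ) (X Y : E)
    (k : ℕ) :
    ((NormedSpace.exp (t • B X) * NormedSpace.exp (t • B Y) - 1) ^ k)
        (X + NormedSpace.exp (t • B X) Y) =
      ∑ l ∈ listsOfLength (blockIndex N) (k + 1),
        (t ^ (blockDeg l - 1) / (blockFact l : ℝ)) • nestedApply B (blockWord X Y l) := by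
  induction k with
  | zero =>
    rw [sum_listsOfLength_succ, pow_zero, one_apply_eq_self,
      add_exp_apply_eq_sum hself hnil hN]
    simp [listsOfLength, blockDeg, blockFact, blockWord]
  | succ k ih =>
    rw [pow_succ', mul_apply_eq_comp, ih, sum_listsOfLength_succ _ (k + 1),
      exp_mul_exp_sub_one hnil (N := N) (by omega), sum_apply]
    refine Finset.sum_congr rfl fun q _ => ?_
    rw [smul_apply, map_sum (B X ^ q.1 * B Y ^ q.2), Finset.smul_sum]
    refine Finset.sum_congr rfl fun l hl => ?_
    have hdeg : 1 ≤ blockDeg l := by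
      have := length_le_blockDeg (zero_notMem_of_mem_listsOfLength hl)
      rw [(mem_listsOfLength.1 hl).1] at this
      omega
    have hw : blockWord X Y l ≠ [] := by
      rw [← List.length_pos_iff, length_blockWord]
      exact hdeg
    rw [nestedApply_blockWord_cons B X Y q hw, map_smul, smul_smul]
    congr 1
    have e : blockDeg (q :: l) - 1 = (blockDeg l - 1) + (q.1 + q.2) := by
      simp only [blockDeg, List.map_cons, List.sum_cons] at hdeg ⊢
      omega
    rw [e, pow_add, div_mul_div_comm]
    simp only [blockFact, List.map_cons, List.prod_cons]
    push_cast
    ring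

/-- The truncated product of a nilpotent bracket as a sum over lists of exponents. -/
theorem bchInt_eq_sum [CompleteSpace E] {M N : ℕ} (hself : ∀ X, B X X = 0)
    (hnil : ∀ l : List E, M < l.length → nestedApply B l = 0) (hN : M + 2 ≤ N) (K : ℕ) (X Y : E) :
    bchInt B K X Y = ∑ k ∈ Finset.range K, ∑ l ∈ listsOfLength (blockIndex N) (k + 1),
      ((-1 : ℝ) ^ (l.length - 1) / (l.length * blockDeg l * blockFact l : ℕ)) •
        nestedApply B (blockWord X Y l) := by
  have h1 : ∀ t : ℝ, logTrunc K (NormedSpace.exp (t • B X) * NormedSpace.exp (t • B Y) - 1)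
      (X + NormedSpace.exp (t • B X) Y) =
      ∑ k ∈ Finset.range K, ∑ l ∈ listsOfLength (blockIndex N) (k + 1),
        t ^ (blockDeg l - 1) • (((-1 : ℝ) ^ k / (k + 1) / blockFact l) •
          nestedApply B (blockWord X Y l)) := by
    intro t
    rw [logTrunc, sum_apply]
    refine Finset.sum_congr rfl fun k _ => ?_
    rw [smul_apply, pow_apply_eq_sum_lists hself hnil hN, Finset.smul_sum]
    refine Finset.sum_congr rfl fun l _ => ?_
    rw [smul_smul, smul_smul]
    congr 1
    ring
  simp only [bchInt, h1]
  rw [intervalIntegral.integral_finsetSum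
    fun k _ => Continuous.intervalIntegrable (by fun_prop) _ _]
  refine Finset.sum_congr rfl fun k _ => ?_
  rw [intervalIntegral.integral_finsetSum
    fun k _ => Continuous.intervalIntegrable (by fun_prop) _ _]
  refine Finset.sum_congr rfl fun l hl => ?_
  have hlen := (mem_listsOfLength.1 hl).1
  -- The integral of t^{deg - 1} over [0, 1] is 1/deg, the degree factor in Dynkin's denominator;
  -- this needs deg ≥ 1, as the exponent is truncated.
  have hdeg : 1 ≤ blockDeg l := by
    have := length_le_blockDeg (zero_notMem_of_mem_listsOfLength hl)
    omega
  rw [intervalIntegral.integral_smul_const, integral_pow, smul_smul]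
  congr 1
  rw [Nat.cast_sub hdeg, hlen]
  simp only [one_pow, Nat.add_sub_cancel]
  rw [zero_pow (by omega)]
  push_cast
  rw [sub_add_cancel, sub_zero, div_div, div_mul_div_comm, one_mul]
  congr 1
  ring

end Nested

/-- A linear map that intertwines a nilpotent bracket with a Lie bracket intertwines the products
of the Baker-Campbell-Hausdorff formula. -/
theorem map_bchInt_eq_bchMul {E L : Type*} [NormedAddCommGroup E] [NormedSpace ℝ E]
    [CompleteSpace E] [LieRing L] [LieAlgebra ℝ L] {B : E →L[ℝ] E →L[ℝ] E} {M : ℕ}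
    (hself : ∀ X, B X X = 0) (hnil : ∀ l : List E, M < l.length → nestedApply B l = 0)
    (θ : E →ₗ[ℝ] L) (hθ : ∀ X Y, θ (B X Y) = ⁅θ X, θ Y⁆) (X Y : E) :
    θ (bchInt B M X Y) = bchMul (θ X) (θ Y) := by
  have hnest : ∀ l : List E, θ (nestedApply B l) = nestedBracket (l.map θ) := by
    intro l
    induction l with
    | nil => exact map_zero θ
    | cons a l ih =>
      cases l with
      | nil => rfl
      | cons b l =>
        rw [nestedApply, hθ, ih]
        rfl
  have hterm : ∀ l, bchTerm (θ X) (θ Y) l =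
      θ (((-1 : ℝ) ^ (l.length - 1) / (l.length * blockDeg l * blockFact l : ℕ)) •
        nestedApply B (blockWord X Y l)) := by
    intro l
    rw [map_smul, hnest, bchTerm]
    congr 2
    simp [blockWord, List.map_flatMap]
  -- A non-zero term of Dynkin's sum has degree at most M, hence at most M blocks with exponents at
  -- most M. Thus K = M and N = M + 2 capture the whole support.
  rw [bchInt_eq_sum hself hnil le_rfl, bchMul, ← Finset.sum_biUnion, map_sum,
    finsum_mem_eq_sum_of_inter_support_eq]
  · exact (Finset.sum_congr rfl fun l _ => (hterm l)).symm
  · ext l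
    simp only [Finset.coe_biUnion, mem_inter_iff, mem_ofPred_eq, Function.mem_support, mem_iUnion,
      Finset.mem_coe, Finset.mem_range, mem_listsOfLength, exists_prop]
    refine and_congr_left fun hl => ⟨fun ⟨h1, h2⟩ => ?_, ?_⟩
    · have hM : blockDeg l ≤ M := by
        by_contra h
        rw [hterm, hnil _ (by rw [length_blockWord]; omega), smul_zero, map_zero] at hl
        exact hl rfl
      have h3 := length_le_blockDeg h2
      have h4 := List.length_pos_iff.2 h1
      refine ⟨l.length - 1, by omega, by omega, fun q hq => ?_⟩
      have h5 := add_le_blockDeg hq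
      rw [blockIndex, Finset.mem_erase, Finset.mem_product, Finset.mem_range, Finset.mem_range]
      exact ⟨fun h => h2 (h ▸ hq), by omega, by omega⟩
    · rintro ⟨k, _, h1, h2⟩
      refine ⟨?_, fun h => ?_⟩
      · rintro rfl; simp at h1
      · have := h2 _ h
        simp [blockIndex] at this
  · intro i _ j _ hij
    rw [Function.onFun, Finset.disjoint_left]
    intro l h1 h2
    have := (mem_listsOfLength.1 h1).1
    have := (mem_listsOfLength.1 h2).1
    omega

/-! ### The bracket of the nilpotentisation as a limit of rescaled brackets -/

namespace LayerSplitting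

variable {E : Type*} [NormedAddCommGroup E] [NormedSpace ℝ E] {m : ℕ}
  {ad : E →L[ℝ] E →L[ℝ] E} (S : LayerSplitting m ad)

theorem bracket_zero_apply (X Y : E) :
    S.bracket 0 X Y = ∑ i ∈ Finset.range (m + 1), ∑ j ∈ Finset.range (m + 1),
      S.proj (i + j) (ad (S.proj i X) (S.proj j Y)) := by
  rw [bracket_apply]
  refine Finset.sum_congr rfl fun i _ => Finset.sum_congr rfl fun j _ => ?_
  rw [Finset.sum_eq_single (i + j)]
  · simp
  · intro k _ hk
    rcases Nat.lt_or_ge (i + j) k with h | h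
    · rw [S.proj_ad i j k X Y h, smul_zero]
    · rw [zero_pow (by omega), zero_smul]
  · intro h
    rw [S.proj_of_lt (by simpa using h), smul_zero]

theorem bracket_self (hself : ∀ X, ad X X = 0) (ε : ℝ) (X : E) : S.bracket ε X X = 0 := by
  have hskew : ∀ X Y, ad X Y = -ad Y X := by
    intro X Y
    have := hself (X + Y)
    simp only [map_add, add_apply, hself, zero_add, add_zero] at this
    exact eq_neg_of_add_eq_zero_right this
  have : S.bracket ε X X = -S.bracket ε X X := by
    conv_lhs => rw [bracket_apply, Finset.sum_comm]
    rw [bracket_apply, ← Finset.sum_neg_distrib]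
    refine Finset.sum_congr rfl fun i _ => ?_
    rw [← Finset.sum_neg_distrib]
    refine Finset.sum_congr rfl fun j _ => ?_
    rw [← Finset.sum_neg_distrib]
    refine Finset.sum_congr rfl fun k _ => ?_
    rw [hskew, map_neg, smul_neg, add_comm]
  have h2 : (2 : ℝ) • S.bracket ε X X = 0 := by
    rw [two_smul, add_eq_zero_iff_eq_neg]; exact this
  exact (smul_eq_zero.1 h2).resolve_left two_ne_zero

/-- Degrees add under the limit bracket and every letter has components of degree at least 1 only,
so a word of length s has no component of degree below s. As there are no layers above m, the limit
bracket is nilpotent of step m. -/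
theorem proj_nestedApply_bracket_zero (l : List E) :
    ∀ n < l.length, S.proj n (nestedApply (S.bracket 0) l) = 0 := by
  induction l with
  | nil => intro n hn; simp at hn
  | cons a l ih =>
    intro n hn
    rcases eq_or_ne l [] with rfl | hl
    · obtain rfl : n = 0 := by simpa using hn
      rw [S.proj_zero]; rfl
    · rw [nestedApply_cons _ a hl, S.proj_bracket_zero]
      refine Finset.sum_eq_zero fun p hp => ?_
      rw [Finset.HasAntidiagonal.mem_antidiagonal] at hp
      rw [List.length_cons] at hn
      rcases Nat.eq_zero_or_pos p.1 with h | h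
      · rw [h, S.proj_zero]; simp
      · rw [ih p.2 (by omega), map_zero, map_zero]

theorem nestedApply_bracket_zero {l : List E} (hl : m < l.length) :
    nestedApply (S.bracket 0) l = 0 := by
  refine S.eq_zero_of_proj fun k => ?_
  rcases Nat.lt_or_ge m k with hk | hk
  · exact S.proj_of_lt hk _
  · exact S.proj_nestedApply_bracket_zero l k (by omega)

end LayerSplitting

/-! ### Strata as a layer splitting, and the graded bracket on classes. -/

namespace Strata

variable {L : Type*} [LieRing L] [LieAlgebra ℝ L] {D : Submodule ℝ L} (S : Strata D)

/-- The component in `W i`. -/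
noncomputable def component (i : ℕ) : L →ₗ[ℝ] L :=
  (S.W i).subtype ∘ₗ DirectSum.component ℝ ℕ (fun i => S.W i) i ∘ₗ S.decomp.toLinearMap

theorem decomp_of_mem {i : ℕ} {x : L} (hx : x ∈ S.W i) :
    S.decomp x = DirectSum.lof ℝ ℕ (fun i => S.W i) i ⟨x, hx⟩ := by
  rw [decomp, LinearEquiv.symm_apply_eq]
  exact (DirectSum.coeLinearMap_lof S.W i ⟨x, hx⟩).symm

theorem component_mem (i : ℕ) (x : L) : S.component i x ∈ S.W i := Subtype.property _

theorem component_of_mem {i : ℕ} (j : ℕ) {x : L} (hx : x ∈ S.W i) :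
    S.component j x = if j = i then x else 0 := by
  rw [component, LinearMap.comp_apply, LinearMap.comp_apply, LinearEquiv.coe_coe,
    S.decomp_of_mem hx]
  split_ifs with h
  · subst h
    rw [DirectSum.component.lof_self]; rfl
  · rw [DirectSum.component.of, dif_neg (Ne.symm h), map_zero]

theorem component_eq_zero {i k : ℕ} (h : i < k) {x : L} (hx : x ∈ lieFiltration D i) :
    S.component k x = 0 := by
  have : lieFiltration D i ≤ LinearMap.ker (S.component k) := by
    rw [S.filtration_eq]
    refine iSup₂_le fun j hj y hy => ?_
    rw [LinearMap.mem_ker, S.component_of_mem k hy, if_neg (by omega)]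
  exact this hx

theorem component_zero : S.component 0 = 0 := by
  ext x
  exact S.le_filtration 0 (S.component_mem 0 x)

/-- Since Vⁿ = Vⁿ⁻¹ ⊕ Wₙ, the class of x modulo Vⁿ⁻¹ is represented by its component in Wₙ. For n =
0 the index n - 1 is again 0 and both terms vanish. -/
theorem sub_component_mem {n : ℕ} {x : L} (hx : x ∈ lieFiltration D n) :
    x - S.component n x ∈ lieFiltration D (n - 1) := by
  have : lieFiltration D n ≤
      (lieFiltration D (n - 1)).comap (LinearMap.id - S.component n) := by
    conv_lhs => rw [S.filtration_eq]
    refine iSup₂_le fun j hj y hy => ?_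
    rw [Submodule.mem_comap, LinearMap.sub_apply, LinearMap.id_apply, S.component_of_mem n hy]
    split_ifs with h
    · rw [sub_self]; exact zero_mem _
    · rw [sub_zero]; exact lieFiltration_mono D (by omega) (S.le_filtration j hy)
  exact this hx

theorem sum_component {m : ℕ} (hm : lieFiltration D m = ⊤) (x : L) :
    ∑ i ∈ Finset.range (m + 1), S.component i x = x := by
  have : lieFiltration D m ≤ LinearMap.eqLocus (∑ i ∈ Finset.range (m + 1), S.component i)
      LinearMap.id := by
    rw [S.filtration_eq]
    refine iSup₂_le fun j hj y hy => ?_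
    rw [LinearMap.mem_eqLocus, LinearMap.sum_apply, LinearMap.id_apply, Finset.sum_eq_single j]
    · rw [S.component_of_mem j hy, if_pos rfl]
    · intro i _ hi
      rw [S.component_of_mem i hy, if_neg hi]
    · intro h
      exact absurd (Finset.mem_range.2 (by omega)) h
  have h := this (hm ▸ Submodule.mem_top : x ∈ lieFiltration D m)
  rw [LinearMap.mem_eqLocus, LinearMap.sum_apply] at h
  exact h

theorem dil_of_mem (ε : ℝ) {i : ℕ} {x : L} (hx : x ∈ S.W i) : S.dil ε x = ε ^ i • x := by
  rw [dil, LinearMap.comp_apply, LinearEquiv.coe_coe, S.decomp_of_mem hx, DirectSum.toModule_lof]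
  rfl

theorem dil_eq_sum {m : ℕ} (hm : lieFiltration D m = ⊤) (ε : ℝ) (x : L) :
    S.dil ε x = ∑ i ∈ Finset.range (m + 1), ε ^ i • S.component i x := by
  conv_lhs => rw [← S.sum_component hm x, map_sum]
  exact Finset.sum_congr rfl fun i _ => S.dil_of_mem ε (S.component_mem i x)

theorem ident_of_mem {i : ℕ} {x : L} (hx : x ∈ S.W i) :
    S.ident x = NilAlgebra.cls D i ⟨x, S.le_filtration i hx⟩ := by
  rw [ident, LinearEquiv.trans_apply, S.decomp_of_mem hx]
  exact DFinsupp.mapRange_single (hf := fun i => map_zero _)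

theorem ident_component {n : ℕ} {z : L} (hz : z ∈ lieFiltration D n) :
    S.ident (S.component n z) = NilAlgebra.cls D n ⟨z, hz⟩ := by
  rw [S.ident_of_mem (S.component_mem n z), eq_comm, ← sub_eq_zero, ← map_sub]
  exact NilAlgebra.cls_eq_zero (sub_mem hz (S.le_filtration n (S.component_mem n z)))
    (S.sub_component_mem hz)

variable {E : Type*} [NormedAddCommGroup E] [NormedSpace ℝ E] [FiniteDimensional ℝ E]
  (φ : E ≃ₗ[ℝ] L) {ad : E →L[ℝ] E →L[ℝ] E} (had : ∀ X Y, φ (ad X Y) = ⁅φ X, φ Y⁆) {m : ℕ}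
  (hm : lieFiltration D m = ⊤)

/-- The splitting of a normed model of the Lie algebra. -/
noncomputable def layerSplitting : LayerSplitting m ad where
  proj i := LinearMap.toContinuousLinearMap (φ.symm.toLinearMap ∘ₗ S.component i ∘ₗ φ.toLinearMap)
  sum_proj x := by
    simp only [LinearMap.coe_toContinuousLinearMap', LinearMap.comp_apply, LinearEquiv.coe_coe]
    rw [← map_sum, S.sum_component hm, φ.symm_apply_apply]
  proj_proj i j x := by
    simp only [LinearMap.coe_toContinuousLinearMap', LinearMap.comp_apply, LinearEquiv.coe_coe,
      φ.apply_symm_apply]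
    rw [S.component_of_mem i (S.component_mem j _)]
    split_ifs
    · rfl
    · exact map_zero _
  proj_zero := by
    ext x
    simp [S.component_zero]
  proj_ad i j k x y h := by
    simp only [LinearMap.coe_toContinuousLinearMap', LinearMap.comp_apply, LinearEquiv.coe_coe,
      had, φ.apply_symm_apply]
    rw [S.component_eq_zero h, map_zero]
    exact lie_mem_lieFiltration D i j (S.le_filtration i (S.component_mem i _))
      (S.le_filtration j (S.component_mem j _))

theorem layerSplitting_proj (i : ℕ) (x : E) :
    (S.layerSplitting φ had hm).proj i x = φ.symm (S.component i (φ x)) := rfl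

theorem layerSplitting_dil (ε : ℝ) (x : E) :
    φ ((S.layerSplitting φ had hm).dil ε x) = S.dil ε (φ x) := by
  rw [LayerSplitting.dil_apply, S.dil_eq_sum hm, map_sum]
  simp only [map_smul, layerSplitting_proj, φ.apply_symm_apply]

/-- For the components in W_i and W_j both sides are the class of [X_i, Y_j] modulo Vⁱ⁺ʲ⁻¹: the
limit bracket keeps exactly the W_{i+j}-component, which represents that class. -/
theorem ident_layerSplitting_bracket (X Y : E) :
    S.ident (φ ((S.layerSplitting φ had hm).bracket 0 X Y)) =
      ⁅S.ident (φ X), S.ident (φ Y)⁆ := by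
  rw [LayerSplitting.bracket_zero_apply]
  conv_rhs => rw [← S.sum_component hm (φ X), ← S.sum_component hm (φ Y)]
  simp only [map_sum]
  rw [sum_lie_sum]
  refine Finset.sum_congr rfl fun i _ => Finset.sum_congr rfl fun j _ => ?_
  simp only [layerSplitting_proj, φ.apply_symm_apply, had]
  rw [S.ident_of_mem (S.component_mem i _), S.ident_of_mem (S.component_mem j _),
    NilAlgebra.cls_lie_cls, S.ident_component]

theorem ident_bchInt (hself : ∀ X, ad X X = 0) (X Y : E) :
    S.ident (φ (bchInt ((S.layerSplitting φ had hm).bracket 0) m X Y)) =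
      bchMul (S.ident (φ X)) (S.ident (φ Y)) :=
  have : CompleteSpace E := FiniteDimensional.complete ℝ E
  map_bchInt_eq_bchMul (LayerSplitting.bracket_self _ hself 0)
    (fun _ hl => LayerSplitting.nestedApply_bracket_zero _ hl)
    (S.ident.toLinearMap ∘ₗ φ.toLinearMap) (S.ident_layerSplitting_bracket φ had hm) X Y

end Strata

/-! ### Germs of topological groups with dilatations -/

/-- The germ at the neutral element of a local topological group. -/
structure LocalGroupGerm {X : Type*} [TopologicalSpace X] (one : X) (mul : X → X → X)
    (inv : X → X) : Prop where
  assoc : ∀ᶠ p : X × X × X in 𝓝 (one, one, one),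
    mul (mul p.1 p.2.1) p.2.2 = mul p.1 (mul p.2.1 p.2.2)
  one_mul : ∀ᶠ x in 𝓝 one, mul one x = x
  mul_one : ∀ᶠ x in 𝓝 one, mul x one = x
  inv_one : inv one = one
  inv_mul : ∀ᶠ x in 𝓝 one, mul (inv x) x = one
  mul_inv : ∀ᶠ x in 𝓝 one, mul x (inv x) = one
  continuousAt_mul : ∀ᶠ p : X × X in 𝓝 (one, one), ContinuousAt (fun p : X × X => mul p.1 p.2) p
  continuousAt_inv : ∀ᶠ x in 𝓝 one, ContinuousAt inv x

namespace LocalGroupGerm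

variable {X Y : Type*} [TopologicalSpace X] [TopologicalSpace Y] {one : X} {mul mul' : X → X → X}
  {inv inv' : X → X}

theorem tendsto_mul (h : LocalGroupGerm one mul inv) {α : Type*} {l : Filter α} {f g : α → X}
    (hf : Tendsto f l (𝓝 one)) (hg : Tendsto g l (𝓝 one)) :
    Tendsto (fun a => mul (f a) (g a)) l (𝓝 one) := by
  have := h.continuousAt_mul.self_of_nhds.tendsto
  simp only [h.one_mul.self_of_nhds] at this
  exact this.comp (hf.prodMk_nhds hg)

theorem tendsto_inv (h : LocalGroupGerm one mul inv) : Tendsto inv (𝓝 one) (𝓝 one) := by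
  have := h.continuousAt_inv.self_of_nhds.tendsto
  rwa [h.inv_one] at this

/-- Allows operations that are known only near the neutral element, such as `virtualMul` and the
inverse in logarithmic coordinates, to be replaced by explicit ones. -/
theorem congr (h : LocalGroupGerm one mul inv)
    (hmul : ∀ᶠ p : X × X in 𝓝 (one, one), mul' p.1 p.2 = mul p.1 p.2)
    (hinv : ∀ᶠ x in 𝓝 one, inv' x = inv x) : LocalGroupGerm one mul' inv' where
  assoc := by
    have t1 : Tendsto (fun p : X × X × X => p.1) (𝓝 (one, one, one)) (𝓝 one) :=
      continuous_fst.tendsto _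
    have t2 : Tendsto (fun p : X × X × X => p.2.1) (𝓝 (one, one, one)) (𝓝 one) :=
      (continuous_fst.comp continuous_snd).tendsto _
    have t3 : Tendsto (fun p : X × X × X => p.2.2) (𝓝 (one, one, one)) (𝓝 one) :=
      (continuous_snd.comp continuous_snd).tendsto _
    filter_upwards [h.assoc, (t1.prodMk_nhds t2).eventually hmul,
      (t2.prodMk_nhds t3).eventually hmul,
      ((h.tendsto_mul t1 t2).prodMk_nhds t3).eventually hmul,
      (t1.prodMk_nhds (h.tendsto_mul t2 t3)).eventually hmul] with p h1 h2 h3 h4 h5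
    rw [h2, h3, h4, h5, h1]
  one_mul := by
    filter_upwards [h.one_mul, (tendsto_const_nhds.prodMk_nhds tendsto_id).eventually hmul]
      with x h1 h2
    exact h2.trans h1
  mul_one := by
    filter_upwards [h.mul_one, (tendsto_id.prodMk_nhds tendsto_const_nhds).eventually hmul]
      with x h1 h2
    exact h2.trans h1
  inv_one := hinv.self_of_nhds.trans h.inv_one
  inv_mul := by
    filter_upwards [h.inv_mul, hinv, (h.tendsto_inv.prodMk_nhds tendsto_id).eventually hmul]
      with x h1 h2 h3
    rw [h2]
    exact h3.trans h1
  mul_inv := by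
    filter_upwards [h.mul_inv, hinv, (tendsto_id.prodMk_nhds h.tendsto_inv).eventually hmul]
      with x h1 h2 h3
    rw [h2]
    exact h3.trans h1
  continuousAt_mul := by
    filter_upwards [h.continuousAt_mul, eventually_eventually_nhds.2 hmul] with p h1 h2
    exact h1.congr (h2.mono fun _ => Eq.symm)
  continuousAt_inv := by
    filter_upwards [h.continuousAt_inv, eventually_eventually_nhds.2 hinv] with p h1 h2
    exact h1.congr (h2.mono fun _ => Eq.symm)

/-- Transport of a germ by a local homeomorphism. -/
theorem map (h : LocalGroupGerm one mul inv) (e : OpenPartialHomeomorph X Y) (h0 : one ∈ e.source) :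
    LocalGroupGerm (e one) (fun x y => e (mul (e.symm x) (e.symm y)))
      (fun x => e (inv (e.symm x))) := by
  have ht : e one ∈ e.target := e.map_source h0
  have ts : Tendsto e.symm (𝓝 (e one)) (𝓝 one) := e.tendsto_symm h0
  have hs : ∀ᶠ x in 𝓝 one, x ∈ e.source := e.open_source.mem_nhds h0
  have htg : ∀ᶠ y in 𝓝 (e one), y ∈ e.target := e.open_target.mem_nhds ht
  have hl : ∀ᶠ x in 𝓝 one, e.symm (e x) = x := hs.mono fun x hx => e.left_inv hx
  have hr : ∀ᶠ y in 𝓝 (e one), e (e.symm y) = y := htg.mono fun x hx => e.right_inv hx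
  refine ⟨?_, ?_, ?_, ?_, ?_, ?_, ?_, ?_⟩
  · have t1 : Tendsto (fun p : Y × Y × Y => e.symm p.1) (𝓝 (e one, e one, e one)) (𝓝 one) :=
      ts.comp (continuous_fst.tendsto _)
    have t2 : Tendsto (fun p : Y × Y × Y => e.symm p.2.1) (𝓝 (e one, e one, e one)) (𝓝 one) :=
      ts.comp ((continuous_fst.comp continuous_snd).tendsto _)
    have t3 : Tendsto (fun p : Y × Y × Y => e.symm p.2.2) (𝓝 (e one, e one, e one)) (𝓝 one) :=
      ts.comp ((continuous_snd.comp continuous_snd).tendsto _)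
    filter_upwards [(t1.prodMk_nhds (t2.prodMk_nhds t3)).eventually h.assoc,
      (h.tendsto_mul t1 t2).eventually hl, (h.tendsto_mul t2 t3).eventually hl] with p h1 h2 h3
    rw [h2, h3]
    exact congrArg e h1
  · filter_upwards [ts.eventually h.one_mul, hr] with y h1 h2
    rw [e.left_inv h0, h1, h2]
  · filter_upwards [ts.eventually h.mul_one, hr] with y h1 h2
    rw [e.left_inv h0, h1, h2]
  · rw [e.left_inv h0, h.inv_one]
  · filter_upwards [ts.eventually h.inv_mul, (h.tendsto_inv.comp ts).eventually hl] with y h1 h2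
    rw [Function.comp_apply] at h2
    rw [h2, h1]
  · filter_upwards [ts.eventually h.mul_inv, (h.tendsto_inv.comp ts).eventually hl] with y h1 h2
    rw [Function.comp_apply] at h2
    rw [h2, h1]
  · have t1 : Tendsto (fun p : Y × Y => e.symm p.1) (𝓝 (e one, e one)) (𝓝 one) :=
      ts.comp (continuous_fst.tendsto _)
    have t2 : Tendsto (fun p : Y × Y => e.symm p.2) (𝓝 (e one, e one)) (𝓝 one) :=
      ts.comp (continuous_snd.tendsto _)
    have htp : ∀ᶠ p : Y × Y in 𝓝 (e one, e one), p.1 ∈ e.target ∧ p.2 ∈ e.target :=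
      (continuous_fst.tendsto _ |>.eventually htg).and (continuous_snd.tendsto _ |>.eventually htg)
    filter_upwards [(t1.prodMk_nhds t2).eventually h.continuousAt_mul,
      (h.tendsto_mul t1 t2).eventually hs, htp] with p h1 h2 h3
    have c : ContinuousAt (fun p : Y × Y => (e.symm p.1, e.symm p.2)) p :=
      ((e.continuousAt_symm h3.1).comp continuousAt_fst).prodMk
        ((e.continuousAt_symm h3.2).comp continuousAt_snd)
    exact (e.continuousAt h2).comp (f := fun p : Y × Y => mul (e.symm p.1) (e.symm p.2))
      (ContinuousAt.comp (f := fun p : Y × Y => (e.symm p.1, e.symm p.2)) h1 c)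
  · filter_upwards [ts.eventually h.continuousAt_inv, (h.tendsto_inv.comp ts).eventually hs,
      htg] with y h1 h2 h3
    exact (e.continuousAt h2).comp (f := fun y => inv (e.symm y))
      (ContinuousAt.comp h1 (e.continuousAt_symm h3))

/-- A germ of topological group on a locally compact space is a uniform local group, for every
uniformity that induces the topology. -/
theorem isLocalGroup [LocallyCompactSpace X] (h : LocalGroupGerm one mul inv) (u : UniformSpace X)
    (hu : u.toTopologicalSpace = ‹TopologicalSpace X›) :
    (LocalGroupData.mk u one mul inv).IsLocalGroup := by
  subst hu
  obtain ⟨U₁, hU₁, h₁⟩ : ∃ U ∈ 𝓝 one, ∀ x ∈ U, ∀ y ∈ U, ∀ z ∈ U,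
      mul (mul x y) z = mul x (mul y z) := by
    have := h.assoc
    rw [nhds_prod_eq, nhds_prod_eq] at this
    obtain ⟨a, ha, b, hb, H⟩ := eventually_prod_iff.1 this
    obtain ⟨a', ha', b', hb', H'⟩ := eventually_prod_iff.1 hb
    refine ⟨{x | a x ∧ a' x ∧ b' x}, ha.and (ha'.and hb'), fun x hx y hy z hz => ?_⟩
    exact H hx.1 (H' hy.2.1 hz.2.2)
  obtain ⟨U₂, hU₂, h₂⟩ : ∃ U ∈ 𝓝 one, ∀ x ∈ U, ∀ y ∈ U,
      ContinuousAt (fun p : X × X => mul p.1 p.2) (x, y) := by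
    have := h.continuousAt_mul
    rw [nhds_prod_eq] at this
    obtain ⟨a, ha, b, hb, H⟩ := eventually_prod_iff.1 this
    exact ⟨{x | a x ∧ b x}, ha.and hb, fun x hx y hy => H hx.1 hy.2⟩
  have hall : ∀ᶠ x in 𝓝 one, x ∈ U₁ ∧ x ∈ U₂ ∧ (mul one x = x ∧ mul x one = x) ∧
      (mul (inv x) x = one ∧ mul x (inv x) = one) ∧ ContinuousAt inv x :=
    Filter.Eventually.and hU₁ (Filter.Eventually.and hU₂ ((h.one_mul.and h.mul_one).and
      ((h.inv_mul.and h.mul_inv).and h.continuousAt_inv)))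
  obtain ⟨K, hK, hKs, hKc⟩ := local_compact_nhds hall
  refine ⟨K, hK, fun x hx y hy z hz => h₁ x (hKs hx).1 y (hKs hy).1 z (hKs hz).1,
    fun x hx => (hKs hx).2.2.1, fun x hx => (hKs hx).2.2.2.1, ?_, ?_⟩
  · refine (hKc.prod hKc).uniformContinuousOn_of_continuous fun p hp => ?_
    exact (h₂ p.1 (hKs hp.1).2.1 p.2 (hKs hp.2).2.1).continuousWithinAt
  · exact hKc.uniformContinuousOn_of_continuous fun x hx => (hKs hx).2.2.2.2.continuousWithinAt

end LocalGroupGerm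

/-- Convergence along l ×ˢ 𝓝 x lets the point move with the parameter. Together with continuity of
the limit it is locally uniform convergence, which is uniform on a compact set. -/
theorem tendstoUniformlyOn_of_isCompact {ι X Y : Type*} [TopologicalSpace X] [UniformSpace Y]
    {l : Filter ι} {F : ι → X → Y} {f : X → Y} {K : Set X} (hK : IsCompact K)
    (hf : ∀ x ∈ K, ContinuousAt f x)
    (hF : ∀ x ∈ K, Tendsto (fun p : ι × X => F p.1 p.2) (l ×ˢ 𝓝 x) (𝓝 (f x))) :
    TendstoUniformlyOn F f l K := by
  rw [← tendstoLocallyUniformlyOn_iff_tendstoUniformlyOn_of_compact hK,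
    tendstoLocallyUniformlyOn_iff_forall_tendsto]
  intro x hx
  have h1 : Tendsto (fun p : ι × X => f p.2) (l ×ˢ 𝓝 x) (𝓝 (f x)) :=
    (hf x hx).tendsto.comp tendsto_snd
  exact ((h1.prodMk_nhds (hF x hx)).mono_right (nhds_le_uniformity (f x))).mono_left
    (prod_mono le_rfl nhdsWithin_le_nhds)

/-- A germ of topological group with dilatations, and the limit `β` of its rescaled products. -/
structure DilatationGerm {X : Type*} [TopologicalSpace X] (one : X) (mul : X → X → X)
    (inv : X → X) (δ : ℝ → X → X) (β : X → X → X) : Prop where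
  group : LocalGroupGerm one mul inv
  tangent : LocalGroupGerm one β inv
  continuousAt_dil : ∀ᶠ p : ℝ × X in 𝓝 (1, one), ContinuousAt (fun p : ℝ × X => δ p.1 p.2) p
  tendsto_dil : ∀ ε > 0, Tendsto (δ ε) (𝓝 one) (𝓝 one)
  dil_mul : ∀ ε > 0, ∀ η > 0, ∀ᶠ x in 𝓝 one, δ (ε * η⁻¹) x = δ ε (δ η⁻¹ x)
  tendsto_one : ∀ᶠ x in 𝓝 one,
    Tendsto (fun p : ℝ × X => δ p.1 p.2) (𝓝[>] 0 ×ˢ 𝓝 x) (𝓝 one)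
  tendsto_mul : ∀ᶠ p in 𝓝 (one, one),
    Tendsto (fun q : ℝ × X × X => δ q.1⁻¹ (mul (δ q.1 q.2.1) (δ q.1 q.2.2))) (𝓝[>] 0 ×ˢ 𝓝 p)
      (𝓝 (β p.1 p.2))
  tendsto_inv : ∀ᶠ x in 𝓝 one,
    Tendsto (fun q : ℝ × X => δ q.1⁻¹ (inv (δ q.1 q.2))) (𝓝[>] 0 ×ˢ 𝓝 x) (𝓝 (inv x))

namespace DilatationGerm

variable {X : Type*} [TopologicalSpace X] [T2Space X] {one : X} {mul : X → X → X} {inv : X → X}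
  {δ : ℝ → X → X} {β : X → X → X}

theorem virtualMul_eq (u : UniformSpace X) (hu : u.toTopologicalSpace = ‹TopologicalSpace X›)
    {x y b : X} (h : Tendsto (fun ε => δ ε⁻¹ (mul (δ ε x) (δ ε y))) (𝓝[>] 0) (𝓝 b)) :
    (LocalGroupData.mk u one mul inv).virtualMul δ x y = b := by
  subst hu
  exact h.limUnder_eq

theorem eventually_virtualMul_eq (h : DilatationGerm one mul inv δ β) (u : UniformSpace X)
    (hu : u.toTopologicalSpace = ‹TopologicalSpace X›) :
    ∀ᶠ p : X × X in 𝓝 (one, one),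
      (LocalGroupData.mk u one mul inv).virtualMul δ p.1 p.2 = β p.1 p.2 := by
  filter_upwards [h.tendsto_mul] with p hp
  exact virtualMul_eq u hu (hp.comp (tendsto_id.prodMk (tendsto_const_nhds (x := p))))

theorem isLocalGroup_virtualTangent [LocallyCompactSpace X] (h : DilatationGerm one mul inv δ β)
    (u : UniformSpace X) (hu : u.toTopologicalSpace = ‹TopologicalSpace X›) :
    ((LocalGroupData.mk u one mul inv).virtualTangent δ).IsLocalGroup :=
  (h.tangent.congr (h.eventually_virtualMul_eq u hu)
    (Eventually.of_forall fun _ => rfl)).isLocalGroup u hu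

theorem hasVirtualTangent [LocallyCompactSpace X] (h : DilatationGerm one mul inv δ β)
    (u : UniformSpace X) (hu : u.toTopologicalSpace = ‹TopologicalSpace X›) :
    (LocalGroupData.mk u one mul inv).HasVirtualTangent δ := by
  have hg := h.group.isLocalGroup u hu
  have hv := h.eventually_virtualMul_eq u hu
  have htan := h.tangent.congr hv (Eventually.of_forall fun _ => rfl)
  subst hu
  refine ⟨hg, ⟨?_, h.tendsto_dil, h.dil_mul⟩, ?_, ?_, ?_⟩
  · obtain ⟨K, hK, hKs, hKc⟩ := local_compact_nhds h.continuousAt_dil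
    rw [nhds_prod_eq] at hK
    obtain ⟨T, hT, U, hU, hTU⟩ := mem_prod_iff.1 hK
    exact ⟨T, hT, U, hU, (hKc.uniformContinuousOn_of_continuous fun p hp =>
      ContinuousAt.continuousWithinAt (mem_ofPred_eq ▸ hKs hp :)).mono hTU⟩
  · obtain ⟨K, hK, hKs, hKc⟩ := local_compact_nhds h.tendsto_one
    exact ⟨K, hK, tendstoUniformlyOn_of_isCompact hKc (fun _ _ => continuousAt_const)
      fun x hx => hKs hx⟩
  · obtain ⟨K, hK, hKs, hKc⟩ :=
      local_compact_nhds ((h.tendsto_mul.and htan.continuousAt_mul).and hv)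
    have H : TendstoUniformlyOn (fun (ε : ℝ) (p : X × X) => δ ε⁻¹ (mul (δ ε p.1) (δ ε p.2)))
        (fun p => (LocalGroupData.mk u one mul inv).virtualMul δ p.1 p.2) (𝓝[>] 0) K :=
      tendstoUniformlyOn_of_isCompact hKc (fun p hp => (hKs hp).1.2)
        (fun p hp => (hKs hp).2.symm ▸ (hKs hp).1.1)
    rw [nhds_prod_eq] at hK
    obtain ⟨U, hU, V, hV, hUV⟩ := mem_prod_iff.1 hK
    exact ⟨U ∩ V, inter_mem hU hV, H.mono fun p hp => hUV ⟨hp.1.1, hp.2.2⟩⟩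
  · obtain ⟨K, hK, hKs, hKc⟩ := local_compact_nhds (h.tendsto_inv.and h.group.continuousAt_inv)
    exact ⟨K, hK, tendstoUniformlyOn_of_isCompact hKc (fun x hx => (hKs hx).2)
      fun x hx => (hKs hx).1⟩

end DilatationGerm

/-- A local homeomorphism that is a homomorphism near the neutral element is an isomorphism of
local uniform groups. -/
theorem LocalGroupData.isLocalIso_of_openPartialHomeomorph {X Y : Type*} [TopologicalSpace X]
    [TopologicalSpace Y] [LocallyCompactSpace X] (P : LocalGroupData X) (Q : LocalGroupData Y)
    (hP : P.unif.toTopologicalSpace = ‹TopologicalSpace X›)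
    (hQ : Q.unif.toTopologicalSpace = ‹TopologicalSpace Y›) (e : OpenPartialHomeomorph X Y)
    (h0 : P.one ∈ e.source) (hone : e P.one = Q.one)
    (hmul : ∀ᶠ p in 𝓝 (P.one, P.one), e (P.mul p.1 p.2) = Q.mul (e p.1) (e p.2)) :
    P.IsLocalIso Q e := by
  subst hP
  subst hQ
  let _ := P.unif
  let _ := Q.unif
  obtain ⟨K, hK, hKs, hKc⟩ := local_compact_nhds (e.open_source.mem_nhds h0)
  have hc : ContinuousOn e K := e.continuousOn.mono hKs
  refine ⟨hone, hmul, K, hK, e '' K, ?_, e.symm, mapsTo_image _ _, ?_, ⟨?_, ?_⟩, ?_, ?_⟩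
  · rw [← hone, ← e.map_nhds_eq h0]
    exact image_mem_map hK
  · rintro _ ⟨x, hx, rfl⟩
    rwa [e.left_inv (hKs hx)]
  · exact fun x hx => e.left_inv (hKs hx)
  · rintro _ ⟨x, hx, rfl⟩
    rw [e.left_inv (hKs hx)]
  · exact hKc.uniformContinuousOn_of_continuous hc
  · refine (hKc.image_of_continuousOn hc).uniformContinuousOn_of_continuous
      (e.symm.continuousOn.mono ?_)
    rintro _ ⟨x, hx, rfl⟩
    exact e.map_source (hKs hx)

/-! ### The tangent germs of a group with an exponential chart -/

theorem localGroupGerm_of_isTopologicalGroup (G : Type*) [TopologicalSpace G] [Group G]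
    [IsTopologicalGroup G] :
    LocalGroupGerm (1 : G) (fun x y => x * y) (fun x => x⁻¹) where
  assoc := Eventually.of_forall fun _ => mul_assoc _ _ _
  one_mul := Eventually.of_forall one_mul
  mul_one := Eventually.of_forall mul_one
  inv_one := inv_one
  inv_mul := Eventually.of_forall inv_mul_cancel
  mul_inv := Eventually.of_forall mul_inv_cancel
  continuousAt_mul := Eventually.of_forall fun _ => continuous_mul.continuousAt
  continuousAt_inv := Eventually.of_forall fun _ => continuous_inv.continuousAt

namespace ExpChart

variable {E G : Type*} [NormedAddCommGroup E] [NormedSpace ℝ E] [TopologicalSpace G]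
  [Group G] (M : ExpChart E G) {e : OpenPartialHomeomorph E G}

theorem openPartialHomeomorph_zero (h0 : 0 ∈ e.source) (he : EqOn e M.exp e.source) : e 0 = 1 := by
  rw [he h0, M.exp_zero]

theorem one_mem_target (h0 : 0 ∈ e.source) (he : EqOn e M.exp e.source) : 1 ∈ e.target :=
  M.openPartialHomeomorph_zero h0 he ▸ e.map_source h0

theorem symm_one (h0 : 0 ∈ e.source) (he : EqOn e M.exp e.source) : e.symm 1 = 0 := by
  rw [← M.openPartialHomeomorph_zero h0 he, e.left_inv h0]

theorem continuousAt_exp_of_mem (he : EqOn e M.exp e.source) {x : E} (hx : x ∈ e.source) :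
    ContinuousAt M.exp x :=
  (e.continuousAt hx).congr (he.eventuallyEq_of_mem (e.open_source.mem_nhds hx))

theorem exp_symm (he : EqOn e M.exp e.source) {g : G} (hg : g ∈ e.target) :
    M.exp (e.symm g) = g := by
  rw [← he (e.map_target hg), e.right_inv hg]

theorem symm_exp (he : EqOn e M.exp e.source) {x : E} (hx : x ∈ e.source) :
    e.symm (M.exp x) = x := by
  rw [← he hx, e.left_inv hx]

theorem eventually_inv (h0 : 0 ∈ e.source) (he : EqOn e M.exp e.source) :
    ∀ᶠ x in 𝓝 (0 : E), e.symm (M.exp x)⁻¹ = -x := by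
  have : ∀ᶠ x in 𝓝 (0 : E), -x ∈ e.source :=
    (continuous_neg.tendsto' (0 : E) 0 neg_zero).eventually (e.open_source.mem_nhds h0)
  filter_upwards [this] with x hx
  rw [← M.exp_neg, M.symm_exp he hx]

theorem continuous_bchInt_bracket [FiniteDimensional ℝ E] {m : ℕ} (S : LayerSplitting m M.ad) :
    Continuous fun p : E × E => bchInt (S.bracket 0) m p.1 p.2 :=
  have : CompleteSpace E := FiniteDimensional.complete ℝ E
  continuous_bchInt continuous_const continuous_fst continuous_snd

variable [IsTopologicalGroup G]

/-- The group in logarithmic coordinates. -/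
theorem localGroupGerm_log (h0 : 0 ∈ e.source) (he : EqOn e M.exp e.source) :
    LocalGroupGerm (0 : E) (fun X Y => e.symm (M.exp X * M.exp Y))
      (fun X => e.symm (M.exp X)⁻¹) := by
  have h := (localGroupGerm_of_isTopologicalGroup G).map e.symm (M.one_mem_target h0 he)
  rw [M.symm_one h0 he] at h
  have hs : ∀ᶠ x in 𝓝 (0 : E), x ∈ e.source := e.open_source.mem_nhds h0
  refine h.congr ?_ ?_
  · filter_upwards [(continuous_fst.tendsto ((0 : E), (0 : E))).eventually hs,
      (continuous_snd.tendsto ((0 : E), (0 : E))).eventually hs] with p h1 h2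
    simp only [e.symm_symm]
    rw [he h1, he h2]
  · filter_upwards [hs] with x hx
    simp only [e.symm_symm]
    rw [he hx]

variable [FiniteDimensional ℝ E] {m : ℕ} (S : LayerSplitting m M.ad)

theorem tendsto_dil_mul (h0 : 0 ∈ e.source) (he : EqOn e M.exp e.source) (p : E × E) :
    Tendsto (fun q : ℝ × E × E =>
      S.dil q.1⁻¹ (e.symm (M.exp (S.dil q.1 q.2.1) * M.exp (S.dil q.1 q.2.2))))
      (𝓝[>] 0 ×ˢ 𝓝 p) (𝓝 (bchInt (S.bracket 0) m p.1 p.2)) := by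
  have : CompleteSpace E := FiniteDimensional.complete ℝ E
  obtain ⟨r, hr, C, hC, hμ⟩ := M.exists_norm_log_sub_bchInt_le h0 he m
  obtain ⟨K, hK, hpK⟩ := exists_compact_mem_nhds p
  have h := S.tendstoUniformlyOn_dil_inv hr hC hμ hK
  rw [tendstoUniformlyOn_iff_tendsto] at h
  have h1 := h.mono_left (prod_mono (le_refl (𝓝[>] (0 : ℝ))) (le_principal_iff.2 hpK))
  have h2 : Tendsto (fun q : ℝ × E × E => bchInt (S.bracket 0) m q.2.1 q.2.2)
      (𝓝[>] 0 ×ˢ 𝓝 p) (𝓝 (bchInt (S.bracket 0) m p.1 p.2)) :=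
    ((M.continuous_bchInt_bracket S).tendsto p).comp tendsto_snd
  exact h2.congr_uniformity h1

/-- Arguments that move with ε make it possible to nest limits, for instance by inserting a rescaled
product as an argument. -/
theorem tendsto_dil_mul_comp (h0 : 0 ∈ e.source) (he : EqOn e M.exp e.source) {x y : ℝ → E}
    {X Y : E} (hx : Tendsto x (𝓝[>] 0) (𝓝 X)) (hy : Tendsto y (𝓝[>] 0) (𝓝 Y)) :
    Tendsto (fun ε : ℝ => S.dil ε⁻¹ (e.symm (M.exp (S.dil ε (x ε)) * M.exp (S.dil ε (y ε)))))
      (𝓝[>] 0) (𝓝 (bchInt (S.bracket 0) m X Y)) := by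
  have hxy : Tendsto (fun ε : ℝ => (ε, (x ε, y ε))) (𝓝[>] 0) (𝓝[>] 0 ×ˢ 𝓝 (X, Y)) :=
    tendsto_id.prodMk (hx.prodMk_nhds hy)
  have h := M.tendsto_dil_mul S h0 he (X, Y)
  exact Tendsto.comp (f := fun ε : ℝ => (ε, (x ε, y ε))) h hxy

end ExpChart

namespace LayerSplitting

variable {E : Type*} [NormedAddCommGroup E] [NormedSpace ℝ E] {m : ℕ}
  {ad : E →L[ℝ] E →L[ℝ] E} (S : LayerSplitting m ad)

theorem dil_zero (x : E) : S.dil 0 x = 0 := by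
  rw [dil_apply]
  refine Finset.sum_eq_zero fun i _ => ?_
  rcases Nat.eq_zero_or_pos i with rfl | hi
  · rw [S.proj_zero]; simp
  · rw [zero_pow hi.ne', zero_smul]

theorem continuous_dil_apply : Continuous fun p : ℝ × E => S.dil p.1 p.2 :=
  (S.continuous_dil.comp continuous_fst).clm_apply continuous_snd

theorem tendsto_dil_zero (x : E) : Tendsto (fun ε : ℝ => S.dil ε x) (𝓝[>] 0) (𝓝 0) := by
  have : Continuous fun ε : ℝ => S.dil ε x := 
    S.continuous_dil_apply.comp (continuous_id.prodMk continuous_const)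
  exact (this.tendsto' 0 0 (S.dil_zero x)).mono_left nhdsWithin_le_nhds

theorem dil_inv_dil {ε : ℝ} (hε : ε ≠ 0) (x : E) : S.dil ε⁻¹ (S.dil ε x) = x := by
  rw [S.dil_dil, inv_mul_cancel₀ hε, S.dil_one]

theorem dil_dil_inv {ε : ℝ} (hε : ε ≠ 0) (x : E) : S.dil ε (S.dil ε⁻¹ x) = x := by
  rw [S.dil_dil, mul_inv_cancel₀ hε, S.dil_one]

end LayerSplitting

/-! ### Group laws of the limit product, and the dilatation germs of log G and G. -/

namespace ExpChart

variable {E G : Type*} [NormedAddCommGroup E] [NormedSpace ℝ E] [TopologicalSpace G]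
  [Group G] (M : ExpChart E G) {e : OpenPartialHomeomorph E G}
  [IsTopologicalGroup G] [FiniteDimensional ℝ E] {m : ℕ} (S : LayerSplitting m M.ad)

/-- The limit product is associative. -/
theorem bchInt_bracket_assoc (h0 : 0 ∈ e.source) (he : EqOn e M.exp e.source) (X Y Z : E) :
    bchInt (S.bracket 0) m (bchInt (S.bracket 0) m X Y) Z =
      bchInt (S.bracket 0) m X (bchInt (S.bracket 0) m Y Z) := by
  have hc := fun x : E => tendsto_const_nhds (x := x) (f := 𝓝[>] (0 : ℝ))
  -- The inner rescaled product enters as a moving argument. The dilatation δ_ε outside it cancels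
  -- its δ_ε⁻¹, so both sides become δ_ε⁻¹ of a triple product.
  have h1 := M.tendsto_dil_mul_comp S h0 he (M.tendsto_dil_mul_comp S h0 he (hc X) (hc Y)) (hc Z)
  have h2 := M.tendsto_dil_mul_comp S h0 he (hc X) (M.tendsto_dil_mul_comp S h0 he (hc Y) (hc Z))
  refine tendsto_nhds_unique h1 (h2.congr' ?_)
  -- For every X, Y, Z the dilated triple eventually lies where the group law is associative; the
  -- limit law is therefore associative everywhere, not only near 0.
  have hev := ((S.tendsto_dil_zero X).prodMk_nhds ((S.tendsto_dil_zero Y).prodMk_nhds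
    (S.tendsto_dil_zero Z))).eventually (M.localGroupGerm_log h0 he).assoc
  filter_upwards [hev, self_mem_nhdsWithin] with ε h hε
  have hε : ε ≠ 0 := ne_of_gt hε
  rw [S.dil_dil_inv hε, S.dil_dil_inv hε, h]

theorem bchInt_bracket_zero_left (h0 : 0 ∈ e.source) (he : EqOn e M.exp e.source) (X : E) :
    bchInt (S.bracket 0) m 0 X = X := by
  refine tendsto_nhds_unique (M.tendsto_dil_mul_comp S h0 he tendsto_const_nhds
    tendsto_const_nhds) (tendsto_const_nhds.congr' ?_)
  filter_upwards [(S.tendsto_dil_zero X).eventually (M.localGroupGerm_log h0 he).one_mul,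
    self_mem_nhdsWithin] with ε h hε
  rw [map_zero, h, S.dil_inv_dil (ne_of_gt hε)]

theorem bchInt_bracket_zero_right (h0 : 0 ∈ e.source) (he : EqOn e M.exp e.source) (X : E) :
    bchInt (S.bracket 0) m X 0 = X := by
  refine tendsto_nhds_unique (M.tendsto_dil_mul_comp S h0 he tendsto_const_nhds
    tendsto_const_nhds) (tendsto_const_nhds.congr' ?_)
  filter_upwards [(S.tendsto_dil_zero X).eventually (M.localGroupGerm_log h0 he).mul_one,
    self_mem_nhdsWithin] with ε h hε
  rw [map_zero, h, S.dil_inv_dil (ne_of_gt hε)]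

theorem bchInt_bracket_neg_left (h0 : 0 ∈ e.source) (he : EqOn e M.exp e.source) (X : E) :
    bchInt (S.bracket 0) m (-X) X = 0 := by
  refine tendsto_nhds_unique (M.tendsto_dil_mul_comp S h0 he tendsto_const_nhds
    tendsto_const_nhds) (tendsto_const_nhds.congr fun ε => ?_)
  rw [map_neg, M.exp_neg, inv_mul_cancel, M.symm_one h0 he, map_zero]

theorem bchInt_bracket_neg_right (h0 : 0 ∈ e.source) (he : EqOn e M.exp e.source) (X : E) :
    bchInt (S.bracket 0) m X (-X) = 0 := by
  simpa using M.bchInt_bracket_neg_left S h0 he (-X)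

/-- The inverse for the limit product is X ↦ -X, which is also the inverse of log G near 0. The
tangent group can thus keep the inverse of the original group. -/
theorem localGroupGerm_bchInt_bracket (h0 : 0 ∈ e.source) (he : EqOn e M.exp e.source) :
    LocalGroupGerm (0 : E) (bchInt (S.bracket 0) m) (fun X => e.symm (M.exp X)⁻¹) := by
  refine LocalGroupGerm.congr (mul := bchInt (S.bracket 0) m) (inv := fun x => -x) ?_
    (Eventually.of_forall fun _ => rfl) (M.eventually_inv h0 he)
  exact {
    assoc := Eventually.of_forall fun p => M.bchInt_bracket_assoc S h0 he _ _ _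
    one_mul := Eventually.of_forall (M.bchInt_bracket_zero_left S h0 he)
    mul_one := Eventually.of_forall (M.bchInt_bracket_zero_right S h0 he)
    inv_one := neg_zero
    inv_mul := Eventually.of_forall (M.bchInt_bracket_neg_left S h0 he)
    mul_inv := Eventually.of_forall (M.bchInt_bracket_neg_right S h0 he)
    continuousAt_mul := Eventually.of_forall fun p =>
      (M.continuous_bchInt_bracket S).continuousAt
    continuousAt_inv := Eventually.of_forall fun _ => continuous_neg.continuousAt }

/-- The group in logarithmic coordinates, with the dilatations. -/
theorem dilatationGerm_log (h0 : 0 ∈ e.source) (he : EqOn e M.exp e.source) :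
    DilatationGerm (0 : E) (fun X Y => e.symm (M.exp X * M.exp Y))
      (fun X => e.symm (M.exp X)⁻¹) (fun ε X => S.dil ε X) (bchInt (S.bracket 0) m) where
  group := M.localGroupGerm_log h0 he
  tangent := M.localGroupGerm_bchInt_bracket S h0 he
  continuousAt_dil := Eventually.of_forall fun p => S.continuous_dil_apply.continuousAt
  tendsto_dil ε _ := (S.dil ε).continuous.tendsto' 0 0 (map_zero _)
  dil_mul ε _ η _ := Eventually.of_forall fun x => (S.dil_dil ε η⁻¹ x).symm
  tendsto_one := Eventually.of_forall fun x =>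
    (S.continuous_dil_apply.tendsto' (0, x) 0 (S.dil_zero x)).mono_left
      (nhds_prod_eq (x := (0 : ℝ)) (y := x) ▸ prod_mono nhdsWithin_le_nhds le_rfl)
  tendsto_mul := Eventually.of_forall fun p => M.tendsto_dil_mul S h0 he p
  tendsto_inv := by
    have hi := M.eventually_inv h0 he
    filter_upwards [hi] with x hx
    rw [hx]
    have h1 : Tendsto (fun p : ℝ × E => S.dil p.1 p.2) (𝓝[>] 0 ×ˢ 𝓝 x) (𝓝 0) :=
      (S.continuous_dil_apply.tendsto' (0, x) 0 (S.dil_zero x)).mono_left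
        (nhds_prod_eq (x := (0 : ℝ)) (y := x) ▸ prod_mono nhdsWithin_le_nhds le_rfl)
    have h2 : Tendsto (fun p : ℝ × E => -p.2) (𝓝[>] 0 ×ˢ 𝓝 x) (𝓝 (-x)) := tendsto_snd.neg
    have h3 : ∀ᶠ p : ℝ × E in 𝓝[>] 0 ×ˢ 𝓝 x, p.1 ≠ 0 :=
      tendsto_fst.eventually (eventually_mem_nhdsWithin.mono fun ε (hε : 0 < ε) => hε.ne')
    refine h2.congr' ?_
    filter_upwards [h1.eventually hi, h3] with p e1 e2
    rw [e1, map_neg, S.dil_inv_dil e2]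

/-- The group with the dilatations `exp X ↦ exp (δ_ε X)`. -/
theorem dilatationGerm_exp (h0 : 0 ∈ e.source) (he : EqOn e M.exp e.source) :
    DilatationGerm (1 : G) (fun x y => x * y) (fun x => x⁻¹)
      (fun ε g => M.exp (S.dil ε (e.symm g)))
      (fun g h => e (bchInt (S.bracket 0) m (e.symm g) (e.symm h))) := by
  have hlog := M.dilatationGerm_log S h0 he
  have h10 := M.openPartialHomeomorph_zero h0 he
  have h1 := M.one_mem_target h0 he
  have hs1 := M.symm_one h0 he
  have ts : Tendsto e.symm (𝓝 1) (𝓝 0) := by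
    have := (e.continuousAt_symm h1).tendsto
    rwa [hs1] at this
  have hsrc : ∀ᶠ x in 𝓝 (0 : E), x ∈ e.source := e.open_source.mem_nhds h0
  have htgt : ∀ᶠ g in 𝓝 (1 : G), g ∈ e.target := e.open_target.mem_nhds h1
  have hinvt : ∀ᶠ g in 𝓝 (1 : G), g⁻¹ ∈ e.target :=
    (continuous_inv.tendsto' (1 : G) 1 inv_one).eventually htgt
  have cs : ∀ (l : Filter ℝ) (g : G), g ∈ e.target →
      Tendsto (fun p : ℝ × G => (p.1, e.symm p.2)) (l ×ˢ 𝓝 g) (l ×ˢ 𝓝 (e.symm g)) :=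
    fun l g hg => tendsto_id.prodMap (e.continuousAt_symm hg).tendsto
  refine ⟨localGroupGerm_of_isTopologicalGroup G, ?_, ?_, ?_, ?_, ?_, ?_, ?_⟩
  · have h := hlog.tangent.map e h0
    rw [h10] at h
    refine h.congr (Eventually.of_forall fun _ => rfl) ?_
    filter_upwards [htgt, hinvt] with g hg hg'
    rw [M.exp_symm he hg, e.right_inv hg']
  · have hp : ∀ᶠ p : ℝ × G in 𝓝 (1, 1), p.2 ∈ e.target :=
      (continuous_snd.tendsto ((1 : ℝ), (1 : G))).eventually htgt
    have hd : ∀ p : ℝ × G, p.2 ∈ e.target →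
        ContinuousAt (fun p : ℝ × G => S.dil p.1 (e.symm p.2)) p := fun p hp =>
      ContinuousAt.comp (f := fun p : ℝ × G => (p.1, e.symm p.2))
        S.continuous_dil_apply.continuousAt
        (continuousAt_fst.prodMk ((e.continuousAt_symm hp).comp continuousAt_snd))
    have hd1 : Tendsto (fun p : ℝ × G => S.dil p.1 (e.symm p.2)) (𝓝 (1, 1)) (𝓝 0) := by
      have := (hd (1, 1) h1).tendsto
      simpa only [hs1, map_zero] using this
    filter_upwards [hp, hd1.eventually hsrc] with p h2 h3
    exact ContinuousAt.comp (M.continuousAt_exp_of_mem he h3) (hd p h2)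
  · intro ε hε
    exact M.tendsto_exp.comp ((hlog.tendsto_dil ε hε).comp ts)
  · intro ε hε η hη
    have := ((hlog.tendsto_dil η⁻¹ (inv_pos.2 hη)).comp ts).eventually hsrc
    filter_upwards [this] with g hg
    have hg : S.dil η⁻¹ (e.symm g) ∈ e.source := hg
    rw [M.symm_exp he hg, S.dil_dil]
  · filter_upwards [htgt, ts.eventually hlog.tendsto_one] with g hg h
    have h2 : Tendsto (fun p : ℝ × G => S.dil p.1 (e.symm p.2)) (𝓝[>] 0 ×ˢ 𝓝 g) (𝓝 0) :=
      Tendsto.comp (g := fun p : ℝ × E => S.dil p.1 p.2)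
        (f := fun p : ℝ × G => (p.1, e.symm p.2)) h (cs _ g hg)
    exact Tendsto.comp (g := M.exp) (f := fun p : ℝ × G => S.dil p.1 (e.symm p.2))
      M.tendsto_exp h2
  · have t2 : Tendsto (fun p : G × G => bchInt (S.bracket 0) m (e.symm p.1) (e.symm p.2))
        (𝓝 (1, 1)) (𝓝 0) :=
      hlog.tangent.tendsto_mul (ts.comp (continuous_fst.tendsto _))
        (ts.comp (continuous_snd.tendsto _))
    filter_upwards [(continuous_fst.tendsto ((1 : G), (1 : G))).eventually htgt,
      (continuous_snd.tendsto ((1 : G), (1 : G))).eventually htgt, t2.eventually hsrc]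
      with p hp1 hp2 hp3
    rw [he hp3]
    have c₀ : Tendsto (fun q : G × G => (e.symm q.1, e.symm q.2)) (𝓝 p)
        (𝓝 (e.symm p.1, e.symm p.2)) :=
      ((e.continuousAt_symm hp1).tendsto.comp (continuous_fst.tendsto p)).prodMk_nhds
        ((e.continuousAt_symm hp2).tendsto.comp (continuous_snd.tendsto p))
    have c : Tendsto (fun q : ℝ × G × G => (q.1, (e.symm q.2.1, e.symm q.2.2)))
        (𝓝[>] 0 ×ˢ 𝓝 p) (𝓝[>] 0 ×ˢ 𝓝 (e.symm p.1, e.symm p.2)) :=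
      (tendsto_id (x := 𝓝[>] (0 : ℝ))).prodMap c₀
    -- By unfolding, the rescaled product in G is exp of the rescaled product of the logarithms, so
    -- only continuity of exp at the limit is added.
    have h2 := M.tendsto_dil_mul S h0 he (e.symm p.1, e.symm p.2)
    have h3 := Tendsto.comp (f := fun q : ℝ × G × G => (q.1, (e.symm q.2.1, e.symm q.2.2))) h2 c
    have h4 := Tendsto.comp (M.continuousAt_exp_of_mem he hp3).tendsto h3
    exact h4
  · filter_upwards [htgt, hinvt, ts.eventually hlog.tendsto_inv] with g hg hg' h
    have h2 : M.exp (e.symm (M.exp (e.symm g))⁻¹) = g⁻¹ := by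
      rw [M.exp_symm he hg, M.exp_symm he hg']
    have h3 : e.symm (M.exp (e.symm g))⁻¹ ∈ e.source := by
      rw [M.exp_symm he hg]
      exact e.map_target hg'
    have h4 := Tendsto.comp (f := fun p : ℝ × G => (p.1, e.symm p.2)) h (cs _ g hg)
    have h5 := Tendsto.comp (M.continuousAt_exp_of_mem he h3).tendsto h4
    rw [h2] at h5
    exact h5

end ExpChart

/-! ### The virtual tangent spaces of a Lie group -/

section VirtualTangent

variable {E : Type*} [NormedAddCommGroup E] [NormedSpace ℝ E] [FiniteDimensional ℝ E]
  {G : Type*} [TopologicalSpace G] [ChartedSpace E G] [Group G] [LieGroup 𝓘(ℝ, E) ∞ G]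

variable (E G) in
-- Gives access to the choice made in `lieLog`: only that it inverts some local homeomorphism
-- agreeing with exp is ever used.
theorem exists_lieLog_eq_symm : ∃ e : OpenPartialHomeomorph E G, 0 ∈ e.source ∧
    EqOn e (lieExpChart E G).exp e.source ∧ (lieLog E G : G → E) = e.symm := by
  have : IsTopologicalGroup G := topologicalGroup_of_lieGroup 𝓘(ℝ, E) ∞
  have h : ∃ e : OpenPartialHomeomorph (LieAlg E G) G, 0 ∈ e.source ∧ EqOn e lieExp e.source :=
    (lieExpChart E G).exists_openPartialHomeomorph_exp
  refine ⟨h.choose, h.choose_spec.1, h.choose_spec.2, ?_⟩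
  rw [lieLog, dif_pos h]
  rfl

variable (E G) in
/-- The model space as the Lie algebra. -/
noncomputable def modelEquivLieAlg : E ≃ₗ[ℝ] LieAlg E G := LinearEquiv.refl ℝ E

theorem modelEquivLieAlg_ad (X Y : E) :
    modelEquivLieAlg E G ((lieExpChart E G).ad X Y) =
      ⁅modelEquivLieAlg E G X, modelEquivLieAlg E G Y⁆ :=
  lieGroupChart_ad (E := E) (G := G) X Y

theorem lieExpChart_ad_self (X : E) : (lieExpChart E G).ad X X = 0 := by
  rw [GroupChart.ad_apply, sub_self]

variable {D : Submodule ℝ (LieAlg E G)} (S : Strata D) {m : ℕ} (hm : lieFiltration D m = ⊤)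

/-- The splitting of the model space given by the strata. -/
noncomputable def Strata.modelSplitting : LayerSplitting m (lieExpChart E G).ad :=
  S.layerSplitting (modelEquivLieAlg E G) modelEquivLieAlg_ad hm

theorem Strata.dil_eq_modelSplitting_dil (ε : ℝ) (X : E) :
    S.dil ε (modelEquivLieAlg E G X) = modelEquivLieAlg E G ((S.modelSplitting hm).dil ε X) :=
  (S.layerSplitting_dil (modelEquivLieAlg E G) modelEquivLieAlg_ad hm ε X).symm

/-- The limit product. -/
noncomputable def Strata.limitMul (X Y : LieAlg E G) : LieAlg E G :=
  modelEquivLieAlg E G (bchInt ((S.modelSplitting hm).bracket 0) m X Y)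

theorem Strata.ident_limitMul (X Y : LieAlg E G) :
    S.ident (S.limitMul hm X Y) = bchMul (S.ident X) (S.ident Y) :=
  S.ident_bchInt (modelEquivLieAlg E G) modelEquivLieAlg_ad hm lieExpChart_ad_self X Y

theorem Strata.dilatationGerm_log : DilatationGerm (0 : LieAlg E G) (logLocalGroup E G).mul
    (logLocalGroup E G).inv (fun ε X => S.dil ε X) (S.limitMul hm) := by
  have : IsTopologicalGroup G := topologicalGroup_of_lieGroup 𝓘(ℝ, E) ∞
  obtain ⟨e, h0, he, hlog⟩ := exists_lieLog_eq_symm E G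
  have h := (lieExpChart E G).dilatationGerm_log (S.modelSplitting hm) h0 he
  rw [← hlog] at h
  have hd : (fun ε X => S.dil ε X) = fun ε X => (S.modelSplitting hm).dil ε X := by
    funext ε X
    exact S.dil_eq_modelSplitting_dil hm ε X
  rw [hd]
  exact h

theorem Strata.tendsto_limitMul (X Y : LieAlg E G) :
    Tendsto (fun ε : ℝ => S.dil ε⁻¹ ((logLocalGroup E G).mul (S.dil ε X) (S.dil ε Y))) (𝓝[>] 0)
      (𝓝 (S.limitMul hm X Y)) := by
  have : IsTopologicalGroup G := topologicalGroup_of_lieGroup 𝓘(ℝ, E) ∞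
  obtain ⟨e, h0, he, hlog⟩ := exists_lieLog_eq_symm E G
  have h := (lieExpChart E G).tendsto_dil_mul_comp (S.modelSplitting hm) h0 he
    (tendsto_const_nhds (x := (X : E))) (tendsto_const_nhds (x := (Y : E)))
  rw [← hlog] at h
  have hd : (fun ε X => S.dil ε X) = fun ε X => (S.modelSplitting hm).dil ε X := by
    funext ε X
    exact S.dil_eq_modelSplitting_dil hm ε X
  change Tendsto (fun ε : ℝ => (fun ε X => S.dil ε X) ε⁻¹ ((logLocalGroup E G).mul
    ((fun ε X => S.dil ε X) ε X) ((fun ε X => S.dil ε X) ε Y))) _ _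
  rw [hd]
  exact h

/-- Valid for all X and Y, because δ_ε X and δ_ε Y tend to 0 whatever their size. For G the
analogous equality is obtained near the identity only. -/
theorem Strata.virtualMul_log (X Y : LieAlg E G) :
    (logLocalGroup E G).virtualMul (fun ε X => S.dil ε X) X Y = S.limitMul hm X Y :=
  letI t : TopologicalSpace (LieAlg E G) := inferInstance
  haveI : T2Space (LieAlg E G) := inferInstanceAs (T2Space E)
  have h := S.tendsto_limitMul hm X Y
  have key := fun (u : UniformSpace (LieAlg E G)) (hu : u.toTopologicalSpace = t) =>
    DilatationGerm.virtualMul_eq (one := 0) (inv := (logLocalGroup E G).inv) u hu h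
  key (logLocalGroup E G).unif rfl

theorem Strata.limitMul_zero (X : LieAlg E G) : S.limitMul hm X 0 = X := by
  have : IsTopologicalGroup G := topologicalGroup_of_lieGroup 𝓘(ℝ, E) ∞
  obtain ⟨e, h0, he, -⟩ := exists_lieLog_eq_symm E G
  exact (lieExpChart E G).bchInt_bracket_zero_right (S.modelSplitting hm) h0 he X

theorem Strata.limitMul_assoc (X Y Z : LieAlg E G) :
    S.limitMul hm (S.limitMul hm X Y) Z = S.limitMul hm X (S.limitMul hm Y Z) := by
  have : IsTopologicalGroup G := topologicalGroup_of_lieGroup 𝓘(ℝ, E) ∞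
  obtain ⟨e, h0, he, -⟩ := exists_lieLog_eq_symm E G
  exact (lieExpChart E G).bchInt_bracket_assoc (S.modelSplitting hm) h0 he X Y Z

/-- The identification of the Lie algebra with its nilpotentisation is a homeomorphism. -/
noncomputable def Strata.identHomeomorph :
    letI : TopologicalSpace (NilAlgebra D) := moduleTopology ℝ (NilAlgebra D)
    LieAlg E G ≃ₜ NilAlgebra D :=
  letI : TopologicalSpace (NilAlgebra D) := moduleTopology ℝ (NilAlgebra D)
  haveI : IsModuleTopology ℝ (NilAlgebra D) := ⟨rfl⟩
  haveI : IsTopologicalAddGroup (NilAlgebra D) := IsModuleTopology.topologicalAddGroup ℝ _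
  haveI : ContinuousSMul ℝ (NilAlgebra D) := IsModuleTopology.toContinuousSMul ℝ _
  { toEquiv := S.ident.toEquiv
    continuous_toFun := LinearMap.continuous_of_finiteDimensional
      (S.ident.toLinearMap ∘ₗ (modelEquivLieAlg E G).toLinearMap)
    continuous_invFun := IsModuleTopology.continuous_of_linearMap S.ident.symm.toLinearMap }

/-- The dilatations of the group, with the limit product in exponential coordinates. -/
theorem Strata.exists_dilatationGerm_exp : ∃ e : OpenPartialHomeomorph (LieAlg E G) G,
    0 ∈ e.source ∧ e 0 = 1 ∧ lieLog E G = e.symm ∧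
      DilatationGerm (1 : G) (fun x y => x * y) (fun x => x⁻¹) S.groupDil
        (fun g h => e (S.limitMul hm (e.symm g) (e.symm h))) := by
  have : IsTopologicalGroup G := topologicalGroup_of_lieGroup 𝓘(ℝ, E) ∞
  obtain ⟨e, h0, he, hlog⟩ := exists_lieLog_eq_symm E G
  refine ⟨e, h0, (lieExpChart E G).openPartialHomeomorph_zero h0 he, hlog, ?_⟩
  have h := (lieExpChart E G).dilatationGerm_exp (S.modelSplitting hm) h0 he
  have hd : S.groupDil = fun (ε : ℝ) (g : G) =>
      (lieExpChart E G).exp ((S.modelSplitting hm).dil ε (e.symm g)) := by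
    funext ε g
    rw [← hlog]
    exact congrArg lieExp (S.dil_eq_modelSplitting_dil hm ε (lieLog E G g))
  rw [hd]
  exact h

end VirtualTangent

/-! ### The theorem, assembled from the two dilatation germs. -/

theorem mainTheorem1
    {E : Type*} [NormedAddCommGroup E] [NormedSpace ℝ E] [FiniteDimensional ℝ E]
    {G : Type*} [TopologicalSpace G] [ChartedSpace E G] [Group G]
    [LieGroup 𝓘(ℝ, E) ∞ G] [ConnectedSpace G]
    (D : Submodule ℝ (LieAlg E G)) (hD : BracketGenerating D) (S : Strata D) :
    -- the virtual tangent spaces of `log G` and of `G` are defined, and are local groups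
    (logLocalGroup E G).HasVirtualTangent (fun ε X => S.dil ε X) ∧
    (lieLocalGroup E G).HasVirtualTangent S.groupDil ∧
    ((logLocalGroup E G).virtualTangent (fun ε X => S.dil ε X)).IsLocalGroup ∧
    ((lieLocalGroup E G).virtualTangent S.groupDil).IsLocalGroup ∧
    -- the limit that defines `β` is the nilpotent product, for all `X` and `Y`
    (∀ X Y : LieAlg E G,
      Tendsto (fun ε : ℝ => S.dil ε⁻¹ ((logLocalGroup E G).mul (S.dil ε X) (S.dil ε Y)))
        (𝓝[>] 0)
        (𝓝 (S.ident.symm ((nilpotentisation D).mul (S.ident X) (S.ident Y))))) ∧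
    (∀ X Y : LieAlg E G,
      S.ident (((logLocalGroup E G).virtualTangent (fun ε X => S.dil ε X)).mul X Y) =
        (nilpotentisation D).mul (S.ident X) (S.ident Y)) ∧
    -- under the identification of `𝔤` with `𝔫(𝔤, D)`, `N(G, D)` is `VT_0 log G`
    ((logLocalGroup E G).virtualTangent (fun ε X => S.dil ε X)).IsLocalIso
      (nilpotentisation D) S.ident ∧
    -- the same in terms of the infinitesimal translations that form `VT_0 log G`
    Function.Injective ((logLocalGroup E G).virtualTranslation (fun ε X => S.dil ε X)) ∧
    (∀ X Y : LieAlg E G,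
      (logLocalGroup E G).virtualTranslation (fun ε X => S.dil ε X)
          (S.ident.symm ((nilpotentisation D).mul (S.ident X) (S.ident Y))) =
        (logLocalGroup E G).virtualTranslation (fun ε X => S.dil ε X) X ∘
          (logLocalGroup E G).virtualTranslation (fun ε X => S.dil ε X) Y) ∧
    -- `VT_e G` is isomorphic to `N(G, D)`
    ((lieLocalGroup E G).virtualTangent S.groupDil).IsLocalIso
      (nilpotentisation D) (fun g => S.ident (lieLog E G g)) := by
  obtain ⟨m, hm⟩ := hD
  have : IsTopologicalGroup G := topologicalGroup_of_lieGroup 𝓘(ℝ, E) ∞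
  have : T2Space (LieAlg E G) := inferInstanceAs (T2Space E)
  have : LocallyCompactSpace (LieAlg E G) := inferInstanceAs (LocallyCompactSpace E)
  have : T2Space G := t2Space_of_lieGroup E G
  have : LocallyCompactSpace G := ChartedSpace.locallyCompactSpace E G
  have hL := S.dilatationGerm_log hm
  obtain ⟨e, h0, he0, hlog, hG⟩ := S.exists_dilatationGerm_exp hm
  have hvm := S.virtualMul_log hm
  have hid := S.ident_limitMul hm
  have hβ : ∀ X Y : LieAlg E G,
      S.ident.symm ((nilpotentisation D).mul (S.ident X) (S.ident Y)) = S.limitMul hm X Y :=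
    fun X Y => by rw [LinearEquiv.symm_apply_eq, hid]; rfl
  let _ : TopologicalSpace (NilAlgebra D) := moduleTopology ℝ (NilAlgebra D)
  refine ⟨hL.hasVirtualTangent _ rfl, hG.hasVirtualTangent _ rfl,
    hL.isLocalGroup_virtualTangent _ rfl, hG.isLocalGroup_virtualTangent _ rfl,
    fun X Y => ?_, fun X Y => ?_, ?_, fun X Y h => ?_, fun X Y => ?_, ?_⟩
  · rw [hβ]
    exact S.tendsto_limitMul hm X Y
  · exact (congrArg S.ident (hvm X Y)).trans (hid X Y)
  · refine LocalGroupData.isLocalIso_of_openPartialHomeomorph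
      ((logLocalGroup E G).virtualTangent fun ε X => S.dil ε X) (nilpotentisation D) (by rfl)
      (by rfl) S.identHomeomorph.toOpenPartialHomeomorph (mem_univ _) (map_zero S.ident)
      (Eventually.of_forall fun p => ?_)
    exact (congrArg S.ident (hvm p.1 p.2)).trans (hid p.1 p.2)
  -- Evaluation at 0 recovers the point from its translation: L_X 0 = X.
  · have h1 := (hvm X 0).symm.trans ((congrFun h 0).trans (hvm Y 0))
    rwa [S.limitMul_zero, S.limitMul_zero] at h1
  -- Composition of translations is associativity of β, which holds on all of 𝔤.
  · funext Z
    rw [hβ]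
    refine (hvm _ Z).trans ((S.limitMul_assoc hm X Y Z).trans ?_)
    exact ((congrArg _ (hvm Y Z)).trans (hvm X _)).symm
  · rw [hlog]
    have hs1 : e.symm 1 = 0 :=
      (congrArg e.symm he0).symm.trans (e.left_inv h0)
    have h1 : (1 : G) ∈ e.symm.source := he0 ▸ e.map_source h0
    have ts : Tendsto e.symm (𝓝 1) (𝓝 0) := hs1 ▸ e.symm.continuousAt h1
    have hsrc : ∀ᶠ X in 𝓝 (0 : LieAlg E G), X ∈ e.source := e.open_source.mem_nhds h0
    refine LocalGroupData.isLocalIso_of_openPartialHomeomorph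
      ((lieLocalGroup E G).virtualTangent S.groupDil) (nilpotentisation D) (by rfl) (by rfl)
      (e.symm.trans S.identHomeomorph.toOpenPartialHomeomorph) ⟨h1, mem_univ _⟩
      ((congrArg S.ident hs1).trans (map_zero S.ident)) ?_
    -- Near (1, 1) the operation on G is `e` applied to the limit product of logarithms. The map
    -- `e.symm` undoes `e` once that limit product lies in `e.source`, which holds close enough to
    -- (1, 1).
    have hsmall := (hL.tangent.tendsto_mul (ts.comp (continuous_fst.tendsto ((1 : G), (1 : G))))
      (ts.comp (continuous_snd.tendsto ((1 : G), (1 : G))))).eventually hsrc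
    have hv := hG.eventually_virtualMul_eq (lieLocalGroup E G).unif (by rfl)
    filter_upwards [hsmall, hv] with p hp1 hp2
    refine (congrArg (fun g => S.ident (e.symm g)) hp2).trans ?_
    exact (congrArg S.ident (e.left_inv hp1)).trans (hid _ _)
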